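/- Let $N\ge 0$ be an integer and write $\mathbf z=(z_1,\dots,z_N)$, $\boldsymbol\lambda=(\lambda_1,\dots,\lambda_N)$. **Bethe algebra.** Let $e_{ij}$ be the matrix units of $\mathfrak{gl}_N(\mathbb C)$, and put $e_{ij}(u)=\sum_{s\ge 0}(e_{ij}\otimes t^s)u^{-s-1}$, a power series in $u^{-1}$ over $U(\mathfrak{gl}_N[t])$. For a matrix $A=(a_{ij})$ over a ring let $\operatorname{rdet}A=\sum_{\sigma\in S_N}(-1)^\sigma a_{1\sigma(1)}a_{2\sigma(2)}\cdots a_{N\sigma(N)}$. With $\partial=d/du$, write $$\operatorname{rdet}\bigl(\delta_{ij}(\partial-\lambda_i)-e_{ji}(u)\bigr)_{i,j=1}^N=\partial^N+\sum_{i=1}^N\sum_{j\ge 0}B_{ij}\,u^{-j}\,\partial^{N-i},\qquad B_{ij}\in U(\mathfrak{gl}_N[t])[\boldsymbol\lambda].$$ The Bethe algebra $\mathcal B_N$ is the unital $\mathbb C$-subalgebra of $U(\mathfrak{gl}_N[t])[\boldsymbol\lambda]$ generated by all $B_{ij}$, $1\le i\le N$, $j\ge0$. Let $V=\mathbb C^N$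 and $\mathcal V=V^{\otimes N}\otimes\mathbb C[\mathbf z,\boldsymbol\lambda]$. Let $g\otimes t^r$ act on $\mathcal V$ by $p\,v_1\otimes\cdots\otimes v_N\mapsto\sum_{k=1}^N z_k^r\,p\,v_1\otimes\cdots\otimes gv_k\otimes\cdots\otimes v_N$, and let $\lambda_i$ act by multiplication. The Bethe algebra preserves $\mathcal V_{\mathbf 1}=(V^{\otimes N})_{\mathbf 1}\otimes\mathbb C[\mathbf z,\boldsymbol\lambda]$, where $(V^{\otimes N})_{\mathbf 1}=\{v: e_{ii}v=v,\ i=1,\dots,N\}$. Let $\bar{\mathcal B}_N$ be the image of $\mathcal B_N$ in $\operatorname{End}(\mathcal V_{\mathbf 1})$, let $\bar B_{ij}$ be the image of $B_{ij}$, and for $0\le i,j\le N$ let $\bar b_{ij}\in\operatorname{End}(\mathcal V_{\mathbf 1})$ be the coefficient of $u^{N-i}v^{N-j}$ in $$\prod_{k=1}^N(u-z_k)\Bigl(v^N+\sum_{i=1}^N\sum_{j\ge 0}\bar B_{ij}\,u^{-j}v^{N-i}\Bigr).$$ **Cherednik algebra.** Let $H_N$ be the unital $\mathbb C$-algebra with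 generators $x_i,y_i,s_{jk}$ ($1\le i,j,k\le N$, $j\ne k$) and relations $s_{ij}=s_{ji}$, $s_{ij}^2=1$, $s_{ij}s_{jk}=s_{ik}s_{ij}$, $s_{ij}s_{kl}=s_{kl}s_{ij}$, $[x_i,x_j]=[y_i,y_j]=0$, $s_{ij}x_i=x_js_{ij}$, $s_{ij}y_i=y_js_{ij}$, $[s_{ij},x_k]=[s_{ij},y_k]=0$, $[x_i,y_j]=s_{ij}$, $[x_i,y_i]=-\sum_{a\ne i}s_{ia}$, where distinct letters in a relation denote distinct indices. A permutation $\sigma\in S_N$ is regarded as an element of $H_N$ through $(i\,j)\mapsto s_{ij}$. Let $\mathcal Z_N$ be the center of $H_N$. For $0\le i,j\le N$ let $c_{ij}\in H_N$ be the coefficient of $v^{N-i}u^{N-j}$ in $$(-1)^N\sum_{\sigma\in S_N}:\!\!\prod_{i:\ \sigma(i)=i}\bigl(1-(v-x_i)(u-y_i)\bigr)\!:\,(-1)^\sigma\sigma,$$ where $:\ :$ denotes normal ordering (the product is expanded as a polynomial in commuting variables, and in each monomial the $x$'s are placed to the left of the $y$'s). **Statement.** All $\bar b_{ij}$ lie in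 $\bar{\mathcal B}_N$, and there is a unique isomorphism of $\mathbb C$-algebras $\tau_{BZ}:\bar{\mathcal B}_N\to\mathcal Z_N$ with $\tau_{BZ}(\bar b_{ij})=c_{ij}$ for all $0\le i,j\le N$. Likewise, there is a unique isomorphism of $\mathbb C$-algebras $\bar{\mathcal B}_N\to\mathcal Z_N$ that sends $\bar b_{ij}$ to $c_{ji}$ for all $0\le i,j\le N$, that is, the coefficient of each monomial $u^av^b$ of the first polynomial to the coefficient of the same monomial $u^av^b$ of the second. -/

import Mathlib

open scoped TensorProduct

noncomputable section

namespace BetheCherednik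

/-! ### The row determinant -/

/-- The row determinant `∑_σ (-1)^σ a_{1σ(1)} a_{2σ(2)} ⋯ a_{Nσ(N)}` of a square matrix with entries
in a possibly non-commutative ring. -/
def rdet {R : Type*} [Ring R] {N : ℕ} (a : Matrix (Fin N) (Fin N) R) : R :=
  ∑ σ : Equiv.Perm (Fin N),
    ((Equiv.Perm.sign σ : ℤˣ) : ℤ) • (List.ofFn fun i => a i (σ i)).prod

/-! ### Formal differential operators in `u` with coefficients in `A⟦u⁻¹⟧`

A power series over `A` in Mathlib's variable `X` is read as a power series in `u⁻¹`.
The operator `∑ₙ aₙ(u) ∂ⁿ`, written with `∂` on the right, is stored as the polynomial with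
coefficients `aₙ`.  Composition of differential operators is given by letting `∂` and the
multiplications by functions act on such normal forms from the left. -/

section DiffOp

variable (A : Type*) [Ring A] [Algebra ℂ A]

/-- Normal forms `∑ₙ aₙ(u) ∂ⁿ`, `aₙ ∈ A⟦u⁻¹⟧`. -/
abbrev DiffOp : Type _ := Polynomial (PowerSeries A)

/-- `d/du` on `A⟦u⁻¹⟧`: the coefficient of `u^{-(n+1)}` in `f'` is `-n` times the coefficient
of `u^{-n}` in `f`. -/
def uDeriv : PowerSeries A →ₗ[ℂ] PowerSeries A where
  toFun f := PowerSeries.mk fun m =>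
    match m with
    | 0 => 0
    | n + 1 => -((n : ℂ) • PowerSeries.coeff n f)
  map_add' f g := by
    ext m; cases m <;> simp [add_comm]
  map_smul' c f := by
    ext m; cases m <;> simp [smul_comm c]

/-- Left composition with `∂`: `∂ ∘ (a ∂ⁿ) = a ∂ⁿ⁺¹ + a' ∂ⁿ`. -/
def partialOp : Module.End ℂ (DiffOp A) :=
  Polynomial.lsum fun n =>
    (Polynomial.monomial (n + 1)).restrictScalars ℂ
      + (Polynomial.monomial n).restrictScalars ℂ ∘ₗ uDeriv A

variable {A}

/-- Left composition with multiplication by `f ∈ A⟦u⁻¹⟧`. -/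
def mulOp (f : PowerSeries A) : Module.End ℂ (DiffOp A) :=
  LinearMap.mulLeft ℂ (Polynomial.C f)

end DiffOp

/-! ### The current algebra and the Bethe algebra -/

attribute [local instance 100] LieRing.ofAssociativeRing

/-- The current algebra `gl_N[t]`: matrices with entries in `ℂ[t]`, with the commutator bracket. -/
abbrev Current (N : ℕ) : Type := Matrix (Fin N) (Fin N) (Polynomial ℂ)

/-- The algebra `U(gl_N[t])[λ₁, …, λ_N]`. -/
def UCurrent (N : ℕ) : Type :=
  UniversalEnvelopingAlgebra ℂ (Current N) ⊗[ℂ] MvPolynomial (Fin N) ℂ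

instance (N : ℕ) : Ring (UCurrent N) :=
  inferInstanceAs (Ring (UniversalEnvelopingAlgebra ℂ (Current N) ⊗[ℂ] MvPolynomial (Fin N) ℂ))

instance (N : ℕ) : Algebra ℂ (UCurrent N) :=
  inferInstanceAs
    (Algebra ℂ (UniversalEnvelopingAlgebra ℂ (Current N) ⊗[ℂ] MvPolynomial (Fin N) ℂ))

/-- The inclusion of `U(gl_N[t])` into `U(gl_N[t])[λ]`. -/
def inclU (N : ℕ) : UniversalEnvelopingAlgebra ℂ (Current N) →ₐ[ℂ] UCurrent N :=
  Algebra.TensorProduct.includeLeft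

/-- The inclusion of `ℂ[λ]` into `U(gl_N[t])[λ]`. -/
def inclLam (N : ℕ) : MvPolynomial (Fin N) ℂ →ₐ[ℂ] UCurrent N :=
  Algebra.TensorProduct.includeRight

lemma commute_inclU_inclLam {N : ℕ} (x : UniversalEnvelopingAlgebra ℂ (Current N))
    (p : MvPolynomial (Fin N) ℂ) : Commute (inclU N x) (inclLam N p) := by
  change (x ⊗ₜ[ℂ] (1 : MvPolynomial (Fin N) ℂ)) * ((1 : UniversalEnvelopingAlgebra ℂ (Current N)) ⊗ₜ[ℂ] p) = ((1 : UniversalEnvelopingAlgebra ℂ (Current N)) ⊗ₜ[ℂ] p) * (x ⊗ₜ[ℂ] (1 : MvPolynomial (Fin N) ℂ))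
  simp

/-- The element `e_{ij} ⊗ t^r` of `U(gl_N[t])[λ]`. -/
def eCur {N : ℕ} (i j : Fin N) (r : ℕ) : UCurrent N :=
  inclU N (UniversalEnvelopingAlgebra.ι ℂ (Matrix.single i j (Polynomial.X ^ r) : Current N))

/-- The element `λ_i` of `U(gl_N[t])[λ]`. -/
def lamCur {N : ℕ} (i : Fin N) : UCurrent N := inclLam N (MvPolynomial.X i)

/-- The series `e_{ij}(u) = ∑_{s ≥ 0} (e_{ij} ⊗ t^s) u^{-s-1}`. -/
def eSeries {N : ℕ} (i j : Fin N) : PowerSeries (UCurrent N) :=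
  PowerSeries.mk fun m =>
    match m with
    | 0 => 0
    | s + 1 => eCur i j s

/-- The matrix whose `(i, j)` entry is `δ_{ij} (∂ - λ_i) - e_{ji}(u)`. -/
def betheMatrix (N : ℕ) : Matrix (Fin N) (Fin N) (Module.End ℂ (DiffOp (UCurrent N))) :=
  fun i j =>
    (if i = j then partialOp (UCurrent N) - mulOp (PowerSeries.C (lamCur i)) else 0)
      - mulOp (eSeries j i)

/-- The universal operator `D^B`, in normal form (the row determinant acts on normal forms by left
composition, so its normal form is its value at the operator `1`). -/
def universalOp (N : ℕ) : DiffOp (UCurrent N) := rdet (betheMatrix N) 1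

/-- `B_{ij}`: the coefficient of `u^{-j} ∂^{N-i}` in `D^B`. -/
def B {N : ℕ} (i j : ℕ) : UCurrent N :=
  PowerSeries.coeff j ((universalOp N).coeff (N - i))

/-- The Bethe algebra `B_N`, generated by `B_{ij}`, `1 ≤ i ≤ N`, `j ≥ 0`. -/
def betheAlgebra (N : ℕ) : Subalgebra ℂ (UCurrent N) :=
  Algebra.adjoin ℂ {b | ∃ i j : ℕ, 1 ≤ i ∧ i ≤ N ∧ b = B i j}

/-! ### The Bethe algebra has weight zero -/

section Weight

variable {A : Type*} [Ring A] [Algebra ℂ A]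

lemma partialOp_monomial (n : ℕ) (a : PowerSeries A) :
    partialOp A (Polynomial.monomial n a)
      = Polynomial.monomial (n + 1) a + Polynomial.monomial n (uDeriv A a) := by
  simp [partialOp, Polynomial.lsum_apply, Polynomial.sum_monomial_index]

lemma uDeriv_C_mul (h : A) (f : PowerSeries A) :
    uDeriv A (PowerSeries.C h * f) = PowerSeries.C h * uDeriv A f := by
  ext m; cases m <;> simp [uDeriv, PowerSeries.coeff_C_mul]

lemma uDeriv_mul_C (h : A) (f : PowerSeries A) :
    uDeriv A (f * PowerSeries.C h) = uDeriv A f * PowerSeries.C h := by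
  ext m; cases m <;> simp [uDeriv, PowerSeries.coeff_mul_C]

/-- Right multiplication of normal forms by a constant. -/
def rightC (h : A) : Module.End ℂ (DiffOp A) :=
  LinearMap.mulRight ℂ (Polynomial.C (PowerSeries.C h))

lemma commute_partialOp_left (h : A) :
    Commute (mulOp (PowerSeries.C h)) (partialOp A) := by
  refine LinearMap.ext fun Q => ?_
  induction Q using Polynomial.induction_on' with
  | add p q hp hq => simp only [map_add, hp, hq]
  | monomial n a =>
    simp [mulOp, partialOp_monomial, Polynomial.C_mul_monomial, mul_add, uDeriv_C_mul]

lemma commute_partialOp_right (h : A) : Commute (rightC h) (partialOp A) := by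
  refine LinearMap.ext fun Q => ?_
  induction Q using Polynomial.induction_on' with
  | add p q hp hq => simp only [map_add, hp, hq]
  | monomial n a =>
    simp [rightC, partialOp_monomial, Polynomial.monomial_mul_C, add_mul, uDeriv_mul_C]

lemma commute_mulOp_right (h : A) (f : PowerSeries A) : Commute (rightC h) (mulOp f) := by
  refine LinearMap.ext fun Q => ?_
  simp [rightC, mulOp, mul_assoc]

lemma mulOp_mul (f g : PowerSeries A) : mulOp (f * g) = mulOp f * mulOp g := by
  refine LinearMap.ext fun Q => ?_
  simp [mulOp]

lemma list_prod_weight {R : Type*} [Ring R] [Algebra ℂ R] (H : R) :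
    ∀ (n : ℕ) (f : Fin n → R) (c : Fin n → ℂ), (∀ i, H * f i = f i * H + c i • f i) →
      H * (List.ofFn f).prod = (List.ofFn f).prod * H + (∑ i, c i) • (List.ofFn f).prod
  | 0, f, c, _ => by simp
  | n + 1, f, c, hf => by
    have ih := list_prod_weight H n (fun i => f i.succ) (fun i => c i.succ) fun i => hf _
    rw [List.ofFn_succ, List.prod_cons, ← mul_assoc, hf 0, add_mul, mul_assoc, ih,
      Fin.sum_univ_succ, mul_add, mul_assoc, add_smul, smul_mul_assoc, mul_smul_comm]
    abel

lemma weight_diag {R : Type*} [Ring R] [Algebra ℂ R] {H P L E : R} (hP : H * P = P * H)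
    (hL : H * L = L * H) (c : ℂ) (hE : H * E = E * H + (c - c) • E) :
    H * (P - L - E) = (P - L - E) * H + (c - c) • (P - L - E) := by
  simp only [mul_sub, sub_mul, hP, hL, hE, sub_self, zero_smul, add_zero]

lemma weight_off {R : Type*} [Ring R] [Algebra ℂ R] {H E : R} (c : ℂ)
    (hE : H * E = E * H + c • E) : H * (0 - E) = (0 - E) * H + c • (0 - E) := by
  simp only [zero_sub, mul_neg, neg_mul, hE, smul_neg]
  abel

end Weight

lemma eCur_bracket {N : ℕ} (k i j : Fin N) (s : ℕ) :
    eCur k k 0 * eCur i j s = eCur i j s * eCur k k 0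
      + ((if k = i then (1 : ℂ) else 0) - (if k = j then 1 else 0)) • eCur i j s := by
  have h := (UniversalEnvelopingAlgebra.ι ℂ (L := Current N)).map_lie
    (Matrix.single k k (Polynomial.X ^ 0)) (Matrix.single i j (Polynomial.X ^ s))
  rw [LieRing.of_associative_ring_bracket, LieRing.of_associative_ring_bracket] at h
  have h2 : (Matrix.single k k (Polynomial.X ^ 0) * Matrix.single i j (Polynomial.X ^ s)
      - Matrix.single i j (Polynomial.X ^ s) * Matrix.single k k (Polynomial.X ^ 0) : Current N)
      = ((if k = i then (1 : ℂ) else 0) - (if k = j then 1 else 0)) •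
        Matrix.single i j (Polynomial.X ^ s) := by
    by_cases hi : k = i <;> by_cases hj : k = j
    · subst hi; subst hj; simp
    · subst hi; simp [hj, Matrix.single_mul_single_of_ne _ _ _ _ (Ne.symm hj)]
    · subst hj; simp [hi, Matrix.single_mul_single_of_ne _ _ _ _ hi]
    · simp [hi, hj, Matrix.single_mul_single_of_ne _ _ _ _ hi,
        Matrix.single_mul_single_of_ne _ _ _ _ (Ne.symm hj)]
  rw [h2, map_smul, eq_sub_iff_add_eq] at h
  simp only [eCur]
  rw [← map_mul, ← h, map_add, map_smul, map_mul, add_comm]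

lemma commute_eCur_lamCur {N : ℕ} (k i : Fin N) : Commute (eCur k k 0) (lamCur i) :=
  commute_inclU_inclLam _ _

lemma betheMatrix_weight {N : ℕ} (k i j : Fin N) :
    mulOp (PowerSeries.C (eCur k k 0)) * betheMatrix N i j
      = betheMatrix N i j * mulOp (PowerSeries.C (eCur k k 0))
        + ((if k = j then (1 : ℂ) else 0) - (if k = i then 1 else 0)) • betheMatrix N i j := by
  have hE : mulOp (PowerSeries.C (eCur k k 0)) * mulOp (eSeries j i)
      = mulOp (eSeries j i) * mulOp (PowerSeries.C (eCur k k 0))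
        + ((if k = j then (1 : ℂ) else 0) - (if k = i then 1 else 0)) • mulOp (eSeries j i) := by
    rw [← mulOp_mul, ← mulOp_mul]
    have : PowerSeries.C (eCur k k 0) * eSeries j i
        = eSeries j i * PowerSeries.C (eCur k k 0)
          + ((if k = j then (1 : ℂ) else 0) - (if k = i then 1 else 0)) • eSeries j i := by
      ext m
      cases m with
      | zero => simp [eSeries]
      | succ s =>
        simp only [eSeries, PowerSeries.coeff_C_mul, PowerSeries.coeff_mul_C, map_add,
          PowerSeries.coeff_mk, PowerSeries.coeff_smul]
        exact eCur_bracket k j i s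
    rw [this]
    refine LinearMap.ext fun Q => ?_
    simp [mulOp, add_mul, mul_assoc, ← Polynomial.smul_C]
  have hP := (commute_partialOp_left (eCur k k 0)).eq
  have hL : mulOp (PowerSeries.C (eCur k k 0)) * mulOp (PowerSeries.C (lamCur i))
      = mulOp (PowerSeries.C (lamCur i)) * mulOp (PowerSeries.C (eCur k k 0)) := by
    rw [← mulOp_mul, ← mulOp_mul, ← map_mul, ← map_mul, (commute_eCur_lamCur k i).eq]
  unfold betheMatrix
  by_cases hij : i = j
  · subst hij
    rw [if_pos rfl]
    exact weight_diag (R := Module.End ℂ (DiffOp (UCurrent N))) hP hL _ hE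
  · rw [if_neg hij]
    exact weight_off (R := Module.End ℂ (DiffOp (UCurrent N))) _ hE

lemma commute_B {N : ℕ} (k : Fin N) (i j : ℕ) : Commute (eCur k k 0) (B i j) := by
  have h1 : mulOp (PowerSeries.C (eCur k k 0)) * rdet (betheMatrix N)
      = rdet (betheMatrix N) * mulOp (PowerSeries.C (eCur k k 0)) := by
    unfold rdet
    rw [Finset.mul_sum, Finset.sum_mul]
    refine Finset.sum_congr rfl fun σ _ => ?_
    rw [mul_smul_comm, smul_mul_assoc]
    congr 1
    rw [list_prod_weight _ N (fun i => betheMatrix N i (σ i))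
      (fun i => (if k = σ i then (1 : ℂ) else 0) - (if k = i then 1 else 0))
      fun i => betheMatrix_weight k i (σ i)]
    have : ∑ i, ((if k = σ i then (1 : ℂ) else 0) - (if k = i then 1 else 0)) = 0 := by
      rw [Finset.sum_sub_distrib, Equiv.sum_comp σ (fun i => if k = i then (1 : ℂ) else 0),
        sub_self]
    rw [this, zero_smul, add_zero]
  have h2 : Commute (rightC (eCur k k 0)) (rdet (betheMatrix N)) := by
    unfold rdet
    refine Commute.sum_right _ _ _ fun σ _ => Commute.smul_right ?_ _
    refine Commute.list_prod_right _ _ fun x hx => ?_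
    rw [List.mem_ofFn] at hx
    obtain ⟨i, rfl⟩ := hx
    unfold betheMatrix
    have hE := commute_mulOp_right (eCur k k 0) (eSeries (σ i) i)
    split_ifs
    · exact Commute.sub_right (R := Module.End ℂ (DiffOp (UCurrent N)))
        (Commute.sub_right (R := Module.End ℂ (DiffOp (UCurrent N)))
          (commute_partialOp_right _) (commute_mulOp_right _ _)) hE
    · exact Commute.sub_right (R := Module.End ℂ (DiffOp (UCurrent N)))
        (Commute.zero_right _) hE
  have h3 : Polynomial.C (PowerSeries.C (eCur k k 0)) * universalOp N
      = universalOp N * Polynomial.C (PowerSeries.C (eCur k k 0)) := by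
    have e1 := LinearMap.congr_fun h1 1
    have e2 := LinearMap.congr_fun h2.eq 1
    simp only [Module.End.mul_apply, mulOp, rightC, LinearMap.mulLeft_apply,
      LinearMap.mulRight_apply, mul_one, one_mul] at e1 e2
    exact e1.trans e2.symm
  have h4 := congrArg (fun p => PowerSeries.coeff j (Polynomial.coeff p (N - i))) h3
  simp only [Polynomial.coeff_C_mul, Polynomial.coeff_mul_C, PowerSeries.coeff_C_mul,
    PowerSeries.coeff_mul_C] at h4
  exact h4

lemma commute_betheAlgebra {N : ℕ} (k : Fin N) {b : UCurrent N} (hb : b ∈ betheAlgebra N) :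
    Commute (eCur k k 0) b := by
  induction hb using Algebra.adjoin_induction with
  | mem x hx => obtain ⟨i, j, -, -, rfl⟩ := hx; exact commute_B k i j
  | algebraMap r => exact (Algebra.commutes r (eCur k k 0)).symm
  | add x y _ _ hx hy => exact hx.add_right hy
  | mul x y _ _ hx hy => exact hx.mul_right hy

/-! ### The module `𝒱` and its weight subspace `𝒱₁` -/

/-- `ℂ[z, λ]`; the variable `Sum.inl k` is `z_k` and `Sum.inr k` is `λ_k`. -/
abbrev PolyZL (N : ℕ) : Type := MvPolynomial (Fin N ⊕ Fin N) ℂ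

/-- `V^{⊗N}`, where `V = ℂ^N` is the vector representation. -/
def VTensor (N : ℕ) : Type := ⨂[ℂ] _ : Fin N, (Fin N → ℂ)

instance (N : ℕ) : AddCommGroup (VTensor N) :=
  inferInstanceAs (AddCommGroup (⨂[ℂ] _ : Fin N, (Fin N → ℂ)))

instance (N : ℕ) : Module ℂ (VTensor N) :=
  inferInstanceAs (Module ℂ (⨂[ℂ] _ : Fin N, (Fin N → ℂ)))

/-- `𝒱 = V^{⊗N} ⊗ ℂ[z, λ]`. -/
abbrev VPoly (N : ℕ) : Type := VTensor N ⊗[ℂ] PolyZL N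

/-- The operator `g` acting on the `k`-th tensor factor of `V^{⊗N}`. -/
def siteOp {N : ℕ} (k : Fin N) (g : Matrix (Fin N) (Fin N) ℂ) : Module.End ℂ (VTensor N) :=
  PiTensorProduct.map (Function.update (fun _ => LinearMap.id) k g.mulVecLin)

/-- Multiplication by a polynomial in `z, λ` on `𝒱`. -/
def polyMul (N : ℕ) : PolyZL N →ₐ[ℂ] Module.End ℂ (VPoly N) :=
  (Module.End.lTensorAlgHom ℂ (PolyZL N) (VTensor N)).comp (Algebra.lmul ℂ (PolyZL N))

/-- The operator by which `∑ e_{ab} ⊗ M_{ab}(t)` acts through the `k`-th factor: `e_{ab}` acts on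
the `k`-th tensor factor and `t` acts as `z_k`. -/
def siteAction {N : ℕ} (k : Fin N) (M : Current N) : Module.End ℂ (VPoly N) :=
  ∑ a, ∑ b, TensorProduct.map (siteOp k (Matrix.single a b 1))
    (Algebra.lmul ℂ (PolyZL N) (Polynomial.aeval (MvPolynomial.X (Sum.inl k)) (M a b)))

lemma siteOp_mul {N : ℕ} (k : Fin N) (g h : Matrix (Fin N) (Fin N) ℂ) :
    siteOp k g * siteOp k h = siteOp k (g * h) := by
  refine (PiTensorProduct.map_mul _ _).symm.trans (congrArg PiTensorProduct.map (funext fun i => ?_))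
  by_cases hi : i = k
  · subst hi; simp [Matrix.mulVecLin_mul, Module.End.mul_eq_comp]
  · simp [Function.update_of_ne hi, Module.End.mul_eq_comp]

lemma siteOp_zero {N : ℕ} (k : Fin N) : siteOp k (0 : Matrix (Fin N) (Fin N) ℂ) = 0 := by
  have := PiTensorProduct.map_update_smul (R := ℂ)
    (fun _ : Fin N => (LinearMap.id : (Fin N → ℂ) →ₗ[ℂ] (Fin N → ℂ))) k 0 0
  rw [zero_smul, zero_smul] at this
  unfold siteOp
  rw [Matrix.mulVecLin_zero]
  exact this

lemma siteOp_commute {N : ℕ} {k l : Fin N} (hkl : k ≠ l) (g h : Matrix (Fin N) (Fin N) ℂ) :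
    Commute (siteOp k g) (siteOp l h) := by
  refine (PiTensorProduct.map_mul _ _).symm.trans
    ((congrArg PiTensorProduct.map (funext fun i => ?_)).trans (PiTensorProduct.map_mul _ _))
  by_cases hi : i = k
  · subst hi; simp [Function.update_of_ne hkl, Module.End.mul_eq_comp]
  · simp [Function.update_of_ne hi, Module.End.mul_eq_comp]

lemma tmap_mul {N : ℕ} (f g : Module.End ℂ (VTensor N)) (p q : PolyZL N) :
    (TensorProduct.map f (Algebra.lmul ℂ (PolyZL N) p) : Module.End ℂ (VPoly N))
        * TensorProduct.map g (Algebra.lmul ℂ (PolyZL N) q)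
      = TensorProduct.map (f * g) (Algebra.lmul ℂ (PolyZL N) (p * q)) := by
  rw [map_mul, TensorProduct.map_mul]

lemma siteAction_mul {N : ℕ} (k : Fin N) (M M' : Current N) :
    siteAction k M * siteAction k M' = siteAction k (M * M') := by
  have hR : siteAction k (M * M') = ∑ a, ∑ d, ∑ b,
      TensorProduct.map (siteOp k (Matrix.single a d 1)) (Algebra.lmul ℂ (PolyZL N)
        (Polynomial.aeval (MvPolynomial.X (Sum.inl k)) (M a b)
          * Polynomial.aeval (MvPolynomial.X (Sum.inl k)) (M' b d))) := by
    unfold siteAction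
    refine Finset.sum_congr rfl fun a _ => Finset.sum_congr rfl fun d _ => ?_
    rw [Matrix.mul_apply, map_sum, map_sum]
    simp only [map_mul (Polynomial.aeval (R := ℂ) (MvPolynomial.X (Sum.inl k) : PolyZL N))]
    exact map_sum (TensorProduct.mapBilinear (R := ℂ) _ _ _ _ _ (siteOp k (Matrix.single a d 1))) _ _
  have hL : siteAction k M * siteAction k M' = ∑ a, ∑ b, ∑ c, ∑ d,
      TensorProduct.map (siteOp k (Matrix.single a b 1 * Matrix.single c d 1))
        (Algebra.lmul ℂ (PolyZL N)
        (Polynomial.aeval (MvPolynomial.X (Sum.inl k)) (M a b)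
          * Polynomial.aeval (MvPolynomial.X (Sum.inl k)) (M' c d))) := by
    unfold siteAction
    simp only [Finset.sum_mul]
    simp only [Finset.mul_sum, tmap_mul, siteOp_mul]
  rw [hL, hR]
  refine Finset.sum_congr rfl fun a _ => ?_
  rw [Finset.sum_comm (γ := Fin N) (s := Finset.univ) (t := Finset.univ)
    (f := fun d b => TensorProduct.map (siteOp k (Matrix.single a d 1)) (Algebra.lmul ℂ (PolyZL N)
        (Polynomial.aeval (MvPolynomial.X (Sum.inl k)) (M a b)
          * Polynomial.aeval (MvPolynomial.X (Sum.inl k)) (M' b d))))]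
  refine Finset.sum_congr rfl fun b _ => ?_
  rw [Finset.sum_eq_single b]
  · simp only [Matrix.single_mul_single_same, mul_one]
  · intro c _ hc
    refine Finset.sum_eq_zero fun d _ => ?_
    rw [Matrix.single_mul_single_of_ne _ _ _ _ (Ne.symm hc), siteOp_zero, TensorProduct.map_zero_left]
  · simp

lemma siteAction_commute {N : ℕ} {k l : Fin N} (hkl : k ≠ l) (M M' : Current N) :
    Commute (siteAction k M) (siteAction l M') := by
  unfold siteAction
  refine Commute.sum_left _ _ _ fun a _ => Commute.sum_left _ _ _ fun b _ =>
    Commute.sum_right _ _ _ fun c _ => Commute.sum_right _ _ _ fun d _ => ?_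
  rw [Commute, SemiconjBy, tmap_mul, tmap_mul, (siteOp_commute hkl _ _).eq, mul_comm]

/-- The action of `gl_N[t]` on `𝒱`:
`g ⊗ t^r` acts on `p(z, λ) v₁ ⊗ ⋯ ⊗ v_N` as `∑ₖ z_k^r p(z, λ) v₁ ⊗ ⋯ ⊗ g v_k ⊗ ⋯ ⊗ v_N`. -/
def currentAction (N : ℕ) : Current N →ₗ⁅ℂ⁆ Module.End ℂ (VPoly N) where
  toFun M := ∑ k, siteAction k M
  map_add' M M' := by
    rw [← Finset.sum_add_distrib]
    refine Finset.sum_congr rfl fun k _ => ?_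
    simp only [siteAction, Matrix.add_apply, map_add, TensorProduct.map_add_right,
      Finset.sum_add_distrib]
  map_smul' c M := by
    rw [RingHom.id_apply, Finset.smul_sum]
    refine Finset.sum_congr rfl fun k _ => ?_
    simp only [siteAction, Matrix.smul_apply, map_smul, TensorProduct.map_smul_right,
      Finset.smul_sum]
  map_lie' {M M'} := by
    have hsub : ∀ (k : Fin N) (A A' : Current N),
        siteAction k (A - A') = siteAction k A - siteAction k A' := by
      intro k A A'
      rw [eq_sub_iff_add_eq]
      simp only [siteAction, ← Finset.sum_add_distrib, ← TensorProduct.map_add_right, ← map_add,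
        ← Matrix.add_apply, sub_add_cancel]
    simp only [LieRing.of_associative_ring_bracket, hsub, ← siteAction_mul]
    rw [Finset.sum_mul_sum, Finset.sum_mul_sum, Finset.sum_comm (s := Finset.univ)
      (f := fun i j => siteAction i M' * siteAction j M), ← Finset.sum_sub_distrib]
    refine Finset.sum_congr rfl fun k _ => ?_
    rw [← Finset.sum_sub_distrib, Finset.sum_eq_single k]
    · intro l _ hl
      rw [(siteAction_commute hl.symm M M').eq, sub_self]
    · simp

lemma commute_currentAction {N : ℕ} (M : Current N) (p : PolyZL N) :
    Commute (currentAction N M) (polyMul N p) := by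
  refine Commute.sum_left _ _ _ fun k _ => Commute.sum_left _ _ _ fun a _ =>
    Commute.sum_left _ _ _ fun b _ => ?_
  have : polyMul N p = TensorProduct.map 1 (Algebra.lmul ℂ (PolyZL N) p) := rfl
  rw [this, Commute, SemiconjBy, tmap_mul, tmap_mul, mul_comm p, one_mul, mul_one]

lemma commute_liftAction {N : ℕ} (x : UniversalEnvelopingAlgebra ℂ (Current N)) (p : PolyZL N) :
    Commute (UniversalEnvelopingAlgebra.lift ℂ (currentAction N) x) (polyMul N p) := by
  let S : Subalgebra ℂ (Module.End ℂ (VPoly N)) := Subalgebra.centralizer ℂ {polyMul N p}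
  have hS : ∀ M, currentAction N M ∈ S := fun M => by
    rw [Subalgebra.mem_centralizer_iff]
    rintro _ rfl
    exact (commute_currentAction M p).eq.symm
  let f : Current N →ₗ⁅ℂ⁆ S :=
    { toFun := fun M => ⟨currentAction N M, hS M⟩
      map_add' := fun _ _ => Subtype.ext (map_add _ _ _)
      map_smul' := fun _ _ => Subtype.ext (map_smul _ _ _)
      map_lie' := fun {_ _} => Subtype.ext (LieHom.map_lie _ _ _) }
  have h : S.val.comp (UniversalEnvelopingAlgebra.lift ℂ f)
      = UniversalEnvelopingAlgebra.lift ℂ (currentAction N) := by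
    refine (UniversalEnvelopingAlgebra.lift_unique ℂ (currentAction N) _).mp (funext fun M => ?_)
    exact congrArg Subtype.val (UniversalEnvelopingAlgebra.lift_ι_apply ℂ f M)
  rw [← h]
  have hx := (UniversalEnvelopingAlgebra.lift ℂ f x).2
  rw [Subalgebra.mem_centralizer_iff] at hx
  exact (hx _ rfl).symm

/-- `𝒱` as a module over `U(gl_N[t])[λ]`; the variables `λ_i` act by multiplication. -/
def action (N : ℕ) : UCurrent N →ₐ[ℂ] Module.End ℂ (VPoly N) :=
  Algebra.TensorProduct.lift (UniversalEnvelopingAlgebra.lift ℂ (currentAction N))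
    ((polyMul N).comp (MvPolynomial.rename Sum.inr)) fun x _ => commute_liftAction x _

/-- The action of `g ∈ gl_N` on `V^{⊗N}`: `∑ₖ v₁ ⊗ ⋯ ⊗ g v_k ⊗ ⋯ ⊗ v_N`. -/
def glAction {N : ℕ} (g : Matrix (Fin N) (Fin N) ℂ) : Module.End ℂ (VTensor N) :=
  ∑ k, siteOp k g

/-- `(V^{⊗N})₁ = {v | e_{ii} v = v for all i}`. -/
def VTensorOne (N : ℕ) : Submodule ℂ (VTensor N) where
  carrier := {v | ∀ i, glAction (Matrix.single i i 1) v = v}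
  add_mem' ha hb i := by rw [map_add, ha i, hb i]
  zero_mem' i := map_zero _
  smul_mem' c v hv i := by rw [map_smul, hv i]

/-- `𝒱₁ = (V^{⊗N})₁ ⊗ ℂ[z, λ]`, as a subspace of `𝒱`. -/
def VOne (N : ℕ) : Submodule ℂ (VPoly N) :=
  LinearMap.range ((VTensorOne N).subtype.rTensor (PolyZL N))

lemma action_eCur_zero {N : ℕ} (i : Fin N) :
    action N (eCur i i 0) = (glAction (Matrix.single i i 1)).rTensor (PolyZL N) := by
  have h1 : action N (eCur i i 0)
      = currentAction N (Matrix.single i i (Polynomial.X ^ 0)) := by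
    have : action N (eCur i i 0) = UniversalEnvelopingAlgebra.lift ℂ (currentAction N)
        (UniversalEnvelopingAlgebra.ι ℂ (Matrix.single i i (Polynomial.X ^ 0) : Current N)) := by
      refine (Algebra.TensorProduct.lift_tmul _ _ _ _ _).trans ?_
      rw [map_one, mul_one]
    rw [this, UniversalEnvelopingAlgebra.lift_ι_apply]
  rw [h1]
  have h2 : (glAction (Matrix.single i i 1)).rTensor (PolyZL N)
      = ∑ k, (siteOp k (Matrix.single i i 1)).rTensor (PolyZL N) :=
    map_sum (LinearMap.rTensorHom (R := ℂ) (N := VTensor N) (P := VTensor N) (PolyZL N))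
      (fun k => siteOp k (Matrix.single i i 1)) _
  rw [h2]
  change ∑ k, siteAction k _ = _
  refine Finset.sum_congr rfl fun k _ => ?_
  unfold siteAction
  rw [Finset.sum_eq_single i, Finset.sum_eq_single i]
  · rw [Matrix.single_apply_same, pow_zero, map_one, map_one]
    rfl
  · intro b _ hb
    rw [Matrix.single_apply_of_col_ne _ _ (Ne.symm hb), map_zero, map_zero,
      TensorProduct.map_zero_right]
  · simp
  · intro a _ ha
    refine Finset.sum_eq_zero fun b _ => ?_
    rw [Matrix.single_apply_of_row_ne (Ne.symm ha), map_zero, map_zero,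
      TensorProduct.map_zero_right]
  · simp

/-- `𝒱₁` is the weight subspace of `𝒱`. -/
lemma mem_VOne_iff {N : ℕ} (v : VPoly N) :
    v ∈ VOne N ↔ ∀ i, action N (eCur i i 0) v = v := by
  simp only [action_eCur_zero]
  let ψ : Fin N → Module.End ℂ (VTensor N) := fun i =>
    glAction (Matrix.single i i 1) - LinearMap.id
  let φ : VTensor N →ₗ[ℂ] (Fin N → VTensor N) := LinearMap.pi ψ
  have hex : Function.Exact (VTensorOne N).subtype φ := by
    intro w
    rw [Submodule.coe_subtype, Subtype.range_coe]
    constructor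
    · intro hw i
      exact sub_eq_zero.mp (congrFun hw i)
    · intro hw
      funext i
      exact sub_eq_zero.mpr (hw i)
  have hex' := Module.Flat.rTensor_exact (PolyZL N) hex
  have hφ : φ = ∑ i, (LinearMap.single ℂ (fun _ : Fin N => VTensor N) i) ∘ₗ ψ i := by
    refine LinearMap.ext fun w => funext fun j => ?_
    simp [φ, Finset.sum_apply, Pi.single_apply]
  have hψ : ∀ i, (ψ i).rTensor (PolyZL N) v
      = (glAction (Matrix.single i i 1)).rTensor (PolyZL N) v - v := by
    intro i
    simp only [ψ, LinearMap.rTensor_sub, LinearMap.rTensor_id, LinearMap.sub_apply,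
      LinearMap.id_apply]
  have hr : v ∈ VOne N ↔ φ.rTensor (PolyZL N) v = 0 := (hex' v).symm
  rw [hr]
  constructor
  · intro h i
    have : ψ i = (LinearMap.proj i) ∘ₗ φ := rfl
    rw [← sub_eq_zero, ← hψ, this, LinearMap.rTensor_comp, LinearMap.comp_apply, h, map_zero]
  · intro h
    have hs : φ.rTensor (PolyZL N) = ∑ i,
        ((LinearMap.single ℂ (fun _ : Fin N => VTensor N) i) ∘ₗ ψ i).rTensor (PolyZL N) := by
      conv_lhs => rw [hφ]
      exact map_sum (LinearMap.rTensorHom (R := ℂ) (N := VTensor N) (P := Fin N → VTensor N)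
        (PolyZL N)) (fun i => (LinearMap.single ℂ (fun _ : Fin N => VTensor N) i) ∘ₗ ψ i) _
    rw [hs, LinearMap.sum_apply]
    refine Finset.sum_eq_zero fun i _ => ?_
    rw [LinearMap.rTensor_comp, LinearMap.comp_apply, hψ, h i, sub_self, map_zero]

lemma action_mem_VOne {N : ℕ} {b : UCurrent N} (hb : b ∈ betheAlgebra N) {v : VPoly N}
    (hv : v ∈ VOne N) : action N b v ∈ VOne N := by
  rw [mem_VOne_iff] at hv ⊢
  intro i
  have h := (commute_betheAlgebra i hb).eq
  have h2 := LinearMap.congr_fun (congrArg (action N) h) v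
  rw [map_mul, map_mul, Module.End.mul_apply, Module.End.mul_apply, hv i] at h2
  exact h2

lemma polyMul_mem_VOne {N : ℕ} (p : PolyZL N) {v : VPoly N} (hv : v ∈ VOne N) :
    polyMul N p v ∈ VOne N := by
  obtain ⟨w, rfl⟩ := hv
  refine ⟨(Algebra.lmul ℂ (PolyZL N) p).lTensor _ w, ?_⟩
  exact LinearMap.congr_fun ((LinearMap.rTensor_comp_lTensor _ _ _).trans
    (LinearMap.lTensor_comp_rTensor _ _ _).symm) w

/-- Multiplication by a polynomial in `z, λ` on `𝒱₁`. -/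
def polyMulOne (N : ℕ) : PolyZL N →ₐ[ℂ] Module.End ℂ (VOne N) where
  toFun p := (polyMul N p).restrict fun _ hv => polyMul_mem_VOne p hv
  map_one' := by ext; simp
  map_mul' p q := by ext; simp
  map_zero' := by ext; simp
  map_add' p q := by ext; simp
  commutes' r := by ext; simp [Algebra.algebraMap_eq_smul_one]

/-- The action of the Bethe algebra on `𝒱₁`. -/
def betheRep (N : ℕ) : betheAlgebra N →ₐ[ℂ] Module.End ℂ (VOne N) where
  toFun b := (action N b).restrict fun _ hv => action_mem_VOne b.2 hv
  map_one' := by ext; simp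
  map_mul' p q := by ext; simp
  map_zero' := by ext; simp
  map_add' p q := by ext; simp
  commutes' r := by ext; simp [Algebra.algebraMap_eq_smul_one]

/-- The image of the Bethe algebra in `End(𝒱₁)`. -/
def betheImage (N : ℕ) : Subalgebra ℂ (Module.End ℂ (VOne N)) := (betheRep N).range

/-- The image of `B_{ij}` in `End(𝒱₁)`, `1 ≤ i ≤ N`, `j ≥ 0`. -/
def BBar {N : ℕ} (i : Finset.Icc 1 N) (j : ℕ) : Module.End ℂ (VOne N) :=
  betheRep N ⟨B i j, Algebra.subset_adjoin
    ⟨i, j, (Finset.mem_Icc.mp i.2).1, (Finset.mem_Icc.mp i.2).2, rfl⟩⟩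

/-- The universal Bethe polynomial `∏ₖ (u - z_k) (v^N + ∑_{i,j} B̄_{ij} u^{-j} v^{N-i})`, divided
by `u^N`: a polynomial in `v` whose coefficients are power series in `u⁻¹` over `End(𝒱₁)`.
Here `u^{-N} ∏ₖ (u - z_k) = ∏ₖ (1 - z_k u⁻¹)`. -/
def bethePoly (N : ℕ) : Polynomial (PowerSeries (Module.End ℂ (VOne N))) :=
  Polynomial.C (PowerSeries.map (polyMulOne N : PolyZL N →+* Module.End ℂ (VOne N))
      (∏ k : Fin N, (1 - PowerSeries.C (MvPolynomial.X (Sum.inl k)) * PowerSeries.X)))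
    * (Polynomial.X ^ N
      + ∑ i : Finset.Icc 1 N, Polynomial.C (PowerSeries.mk (BBar i)) * Polynomial.X ^ (N - i))

/-- `b̄_{ij}`: the coefficient of `u^{N-i} v^{N-j}` in the universal Bethe polynomial, that is, of
`u^{-i} v^{N-j}` in `bethePoly`. -/
def bBar (N : ℕ) (i j : Fin (N + 1)) : Module.End ℂ (VOne N) :=
  PowerSeries.coeff (i : ℕ) ((bethePoly N).coeff (N - j))

/-! ### The rational Cherednik algebra -/

/-- The generators `x_i`, `y_i`, `s_{jk}` (`j ≠ k`). -/
inductive Gen (N : ℕ) : Type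
  | x (i : Fin N) : Gen N
  | y (i : Fin N) : Gen N
  | s (j k : Fin N) (h : j ≠ k) : Gen N

namespace Free

/-- The generator `x_i` in the free algebra. -/
def x {N : ℕ} (i : Fin N) : FreeAlgebra ℂ (Gen N) := FreeAlgebra.ι ℂ (Gen.x i)

/-- The generator `y_i` in the free algebra. -/
def y {N : ℕ} (i : Fin N) : FreeAlgebra ℂ (Gen N) := FreeAlgebra.ι ℂ (Gen.y i)

/-- The generator `s_{jk}` in the free algebra. -/
def s {N : ℕ} (j k : Fin N) (h : j ≠ k) : FreeAlgebra ℂ (Gen N) := FreeAlgebra.ι ℂ (Gen.s j k h)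

end Free

open Free in
/-- The defining relations of the rational Cherednik algebra. -/
inductive CherednikRel (N : ℕ) : FreeAlgebra ℂ (Gen N) → FreeAlgebra ℂ (Gen N) → Prop
  | s_symm (i j : Fin N) (h : i ≠ j) : CherednikRel N (s i j h) (s j i h.symm)
  | s_sq (i j : Fin N) (h : i ≠ j) : CherednikRel N (s i j h * s i j h) 1
  | s_braid (i j k : Fin N) (hij : i ≠ j) (hjk : j ≠ k) (hik : i ≠ k) :
      CherednikRel N (s i j hij * s j k hjk) (s i k hik * s i j hij)
  | s_comm (i j k l : Fin N) (hij : i ≠ j) (hkl : k ≠ l) (hik : i ≠ k) (hil : i ≠ l) (hjk : j ≠ k)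
      (hjl : j ≠ l) : CherednikRel N (s i j hij * s k l hkl) (s k l hkl * s i j hij)
  | x_comm (i j : Fin N) (h : i ≠ j) : CherednikRel N (x i * x j - x j * x i) 0
  | y_comm (i j : Fin N) (h : i ≠ j) : CherednikRel N (y i * y j - y j * y i) 0
  | s_x (i j : Fin N) (h : i ≠ j) : CherednikRel N (s i j h * x i) (x j * s i j h)
  | s_y (i j : Fin N) (h : i ≠ j) : CherednikRel N (s i j h * y i) (y j * s i j h)
  | s_x_comm (i j k : Fin N) (h : i ≠ j) (hki : k ≠ i) (hkj : k ≠ j) :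
      CherednikRel N (s i j h * x k - x k * s i j h) 0
  | s_y_comm (i j k : Fin N) (h : i ≠ j) (hki : k ≠ i) (hkj : k ≠ j) :
      CherednikRel N (s i j h * y k - y k * s i j h) 0
  | x_y (i j : Fin N) (h : i ≠ j) : CherednikRel N (x i * y j - y j * x i) (s i j h)
  | x_y_self (i : Fin N) :
      CherednikRel N (x i * y i - y i * x i)
        (-∑ a : {a : Fin N // a ≠ i}, s i a a.2.symm)

/-- The rational Cherednik algebra `H_N`. -/
abbrev Cherednik (N : ℕ) : Type := RingQuot (CherednikRel N)

/-- The element `x_i` of `H_N`. -/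
def xH {N : ℕ} (i : Fin N) : Cherednik N := RingQuot.mkAlgHom ℂ (CherednikRel N) (Free.x i)

/-- The element `y_i` of `H_N`. -/
def yH {N : ℕ} (i : Fin N) : Cherednik N := RingQuot.mkAlgHom ℂ (CherednikRel N) (Free.y i)

/-- The element `s_{ij}` of `H_N`, with the convention `s_{ii} = 1`. -/
def sH {N : ℕ} (i j : Fin N) : Cherednik N :=
  if h : i ≠ j then RingQuot.mkAlgHom ℂ (CherednikRel N) (Free.s i j h) else 1

/-! The elements `s_{ij}` satisfy the relations of the transpositions, so they define a
homomorphism from the symmetric group. -/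

section PermLift

variable {N : ℕ} {R : Type*} [Monoid R]

/-- The value on `σ` of the homomorphism given on transpositions by `s`: peel off a transposition
for each entry of a list of points. -/
def permAux (s : Fin N → Fin N → R) : List (Fin N) → Equiv.Perm (Fin N) → R
  | [], _ => 1
  | a :: l, σ => s a (σ a) * permAux s l (Equiv.swap a (σ a) * σ)

lemma permAux_swap_mul (s : Fin N → Fin N → R) (h0 : ∀ i, s i i = 1) (hsymm : ∀ i j, s i j = s j i)
    (hsq : ∀ i j, s i j * s i j = 1)
    (hconj : ∀ i j a b, i ≠ j →
      s (Equiv.swap i j a) (Equiv.swap i j b) * s i j = s i j * s a b) :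
    ∀ (l : List (Fin N)) (σ : Equiv.Perm (Fin N)), (∀ x, x ∉ l → σ x = x) →
      ∀ i ∈ l, ∀ j ∈ l, i ≠ j → permAux s l (Equiv.swap i j * σ) = s i j * permAux s l σ
  | [], _, _, i, hi, _, _, _ => by simp at hi
  | a :: l, σ, hσ, i, hi, j, hj, hij => by
    have hfix : ∀ x, x ∉ l → (Equiv.swap a (σ a) * σ) x = x := by
      intro x hx
      rw [Equiv.Perm.mul_apply]
      by_cases hxa : x = a
      · subst hxa; simp
      · have hx' : σ x = x := hσ x (by simp [hxa, hx])
        rw [hx', Equiv.swap_apply_of_ne_of_ne hxa]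
        intro h
        exact hxa (σ.injective (hx'.trans h))
    have ih := permAux_swap_mul s h0 hsymm hsq hconj l (Equiv.swap a (σ a) * σ) hfix
    -- the case in which the head of the list is `i`
    have key : ∀ j, j ∈ l → a ≠ j →
        permAux s (a :: l) (Equiv.swap a j * σ) = s a j * permAux s (a :: l) σ := by
      intro j hj haj
      by_cases hb : σ a = a
      · simp only [permAux, Equiv.Perm.mul_apply, hb, Equiv.swap_apply_left, h0, one_mul,
          Equiv.swap_self, ← mul_assoc, Equiv.swap_mul_self]
        rfl
      by_cases hb' : σ a = j
      · simp only [permAux, Equiv.Perm.mul_apply, hb', Equiv.swap_apply_right, h0, one_mul,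
          Equiv.swap_self, ← mul_assoc, hsq]
        rfl
      · have hbl : σ a ∈ l := by
          by_contra hbl
          exact hb (σ.injective (hσ _ (by simp [hb, hbl])))
        have e : (Equiv.swap a j * σ) a = σ a := by
          rw [Equiv.Perm.mul_apply, Equiv.swap_apply_of_ne_of_ne hb hb']
        have e2 : Equiv.swap a (σ a) * (Equiv.swap a j * σ)
            = Equiv.swap (σ a) j * (Equiv.swap a (σ a) * σ) := by
          rw [← mul_assoc, ← mul_assoc, Equiv.mul_swap_eq_swap_mul, Equiv.swap_apply_left,
            Equiv.swap_apply_of_ne_of_ne (Ne.symm haj) (Ne.symm hb')]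
        rw [permAux, permAux, e, e2, ih _ hbl _ hj hb', ← mul_assoc, ← mul_assoc]
        congr 1
        have := hconj a (σ a) (σ a) j (Ne.symm hb)
        rw [Equiv.swap_apply_right,
          Equiv.swap_apply_of_ne_of_ne (Ne.symm haj) (Ne.symm hb')] at this
        exact this.symm
    by_cases hia : i = a
    · subst hia
      exact key j (by simpa [Ne.symm hij] using hj) hij
    by_cases hja : j = a
    · subst hja
      rw [Equiv.swap_comm, hsymm i j]
      exact key i (by simpa [hij] using hi) (Ne.symm hij)
    · have hi' : i ∈ l := by simpa [hia] using hi
      have hj' : j ∈ l := by simpa [hja] using hj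
      have ea : Equiv.swap i j a = a :=
        Equiv.swap_apply_of_ne_of_ne (Ne.symm hia) (Ne.symm hja)
      have e2 : Equiv.swap a (Equiv.swap i j (σ a)) * (Equiv.swap i j * σ)
          = Equiv.swap i j * (Equiv.swap a (σ a) * σ) := by
        rw [← mul_assoc, ← mul_assoc, Equiv.mul_swap_eq_swap_mul (Equiv.swap i j), ea]
      have := hconj i j a (σ a) hij
      rw [ea] at this
      rw [permAux, permAux, Equiv.Perm.mul_apply, e2, ih i hi' j hj' hij, ← mul_assoc, this,
        mul_assoc]

/-- The homomorphism from the symmetric group with prescribed values `s i j` on the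
transpositions `(i j)`. -/
def permLift (s : Fin N → Fin N → R) (h0 : ∀ i, s i i = 1) (hsymm : ∀ i j, s i j = s j i)
    (hsq : ∀ i j, s i j * s i j = 1)
    (hconj : ∀ i j a b, i ≠ j →
      s (Equiv.swap i j a) (Equiv.swap i j b) * s i j = s i j * s a b) :
    Equiv.Perm (Fin N) →* R where
  toFun := permAux s (List.finRange N)
  map_one' := by
    have : ∀ l : List (Fin N), permAux s l 1 = 1 := by
      intro l
      induction l with
      | nil => rfl
      | cons a l ih =>
        rw [permAux, Equiv.Perm.one_apply, h0, Equiv.swap_self, one_mul]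
        exact ih
    exact this _
  map_mul' σ τ := by
    have hsw : ∀ (i j : Fin N) (ρ : Equiv.Perm (Fin N)), i ≠ j →
        permAux s (List.finRange N) (Equiv.swap i j * ρ)
          = s i j * permAux s (List.finRange N) ρ := fun i j ρ hij =>
      permAux_swap_mul s h0 hsymm hsq hconj _ ρ (fun x hx => absurd (List.mem_finRange x) hx)
        i (List.mem_finRange i) j (List.mem_finRange j) hij
    have h1 : permAux s (List.finRange N) 1 = 1 := by
      have : ∀ l : List (Fin N), permAux s l 1 = 1 := by
        intro l
        induction l with
        | nil => rfl
        | cons a l ih =>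
          rw [permAux, Equiv.Perm.one_apply, h0, Equiv.swap_self, one_mul]
          exact ih
      exact this _
    induction σ using Equiv.Perm.swap_induction_on with
    | one => rw [one_mul, h1, one_mul]
    | swap_mul f x y hxy ih => rw [mul_assoc, hsw _ _ _ hxy, ih, hsw _ _ _ hxy, mul_assoc]

lemma permLift_swap (s : Fin N → Fin N → R) (h0 hsymm hsq hconj) (i j : Fin N) :
    permLift s h0 hsymm hsq hconj (Equiv.swap i j) = s i j := by
  by_cases hij : i = j
  · subst hij
    rw [Equiv.swap_self, h0]
    exact map_one _
  · have h := permAux_swap_mul s h0 hsymm hsq hconj (List.finRange N) 1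
      (fun x hx => absurd (List.mem_finRange x) hx) i (List.mem_finRange i) j
      (List.mem_finRange j) hij
    rw [mul_one] at h
    have h1 : permAux s (List.finRange N) 1 = 1 := map_one (permLift s h0 hsymm hsq hconj)
    rw [h1, mul_one] at h
    exact h

end PermLift

lemma sH_self {N : ℕ} (i : Fin N) : (sH i i : Cherednik N) = 1 := by simp [sH]

lemma sH_symm {N : ℕ} (i j : Fin N) : (sH i j : Cherednik N) = sH j i := by
  by_cases h : i = j
  · rw [h]
  · rw [sH, sH, dif_pos h, dif_pos (Ne.symm h)]
    exact RingQuot.mkAlgHom_rel ℂ (CherednikRel.s_symm i j h)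

lemma sH_sq {N : ℕ} (i j : Fin N) : (sH i j * sH i j : Cherednik N) = 1 := by
  by_cases h : i = j
  · rw [h, sH_self, one_mul]
  · rw [sH, dif_pos h, ← map_mul, RingQuot.mkAlgHom_rel ℂ (CherednikRel.s_sq i j h), map_one]

lemma sH_braid {N : ℕ} {i j k : Fin N} (hij : i ≠ j) (hjk : j ≠ k) (hik : i ≠ k) :
    (sH i j * sH j k : Cherednik N) = sH i k * sH i j := by
  rw [sH, sH, sH, dif_pos hij, dif_pos hjk, dif_pos hik, ← map_mul, ← map_mul]
  exact RingQuot.mkAlgHom_rel ℂ (CherednikRel.s_braid i j k hij hjk hik)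

lemma sH_comm {N : ℕ} {i j k l : Fin N} (hij : i ≠ j) (hkl : k ≠ l) (hik : i ≠ k) (hil : i ≠ l)
    (hjk : j ≠ k) (hjl : j ≠ l) : (sH i j * sH k l : Cherednik N) = sH k l * sH i j := by
  rw [sH, sH, dif_pos hij, dif_pos hkl, ← map_mul, ← map_mul]
  exact RingQuot.mkAlgHom_rel ℂ (CherednikRel.s_comm i j k l hij hkl hik hil hjk hjl)

lemma sH_conj {N : ℕ} (i j a b : Fin N) (hij : i ≠ j) :
    (sH (Equiv.swap i j a) (Equiv.swap i j b) * sH i j : Cherednik N) = sH i j * sH a b := by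
  by_cases hab : a = b
  · subst hab; rw [sH_self, sH_self, one_mul, mul_one]
  -- one index moved by the transposition
  have h1 : ∀ i j b : Fin N, i ≠ j → b ≠ i → b ≠ j →
      (sH j b * sH i j : Cherednik N) = sH i j * sH i b := fun i j b hij hbi hbj => by
    rw [sH_symm i j, sH_braid hij.symm hbi.symm hbj.symm]
  by_cases hai : a = i
  · subst hai
    by_cases hbj : b = j
    · subst hbj
      rw [Equiv.swap_apply_left, Equiv.swap_apply_right, sH_symm b a]
    · rw [Equiv.swap_apply_left, Equiv.swap_apply_of_ne_of_ne (Ne.symm hab) hbj]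
      exact h1 _ _ _ hij (Ne.symm hab) hbj
  by_cases haj : a = j
  · subst haj
    by_cases hbi : b = i
    · subst hbi
      rw [Equiv.swap_apply_left, Equiv.swap_apply_right, sH_symm b a]
    · rw [Equiv.swap_apply_right, Equiv.swap_apply_of_ne_of_ne hbi (Ne.symm hab), sH_symm i a]
      exact h1 _ _ _ (Ne.symm hij) (Ne.symm hab) hbi
  rw [Equiv.swap_apply_of_ne_of_ne hai haj]
  by_cases hbi : b = i
  · subst hbi
    rw [Equiv.swap_apply_left, sH_symm a j, sH_symm a b]
    exact h1 _ _ _ hij hai haj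
  by_cases hbj : b = j
  · subst hbj
    rw [Equiv.swap_apply_right, sH_symm a i, sH_symm a b, sH_symm i b]
    exact h1 _ _ _ (Ne.symm hij) haj hai
  · rw [Equiv.swap_apply_of_ne_of_ne hbi hbj]
    exact (sH_comm hij hab (Ne.symm hai) (Ne.symm hbi) (Ne.symm haj) (Ne.symm hbj)).symm

/-- The homomorphism `S_N → H_N` that sends the transposition `(i j)` to `s_{ij}`. -/
def permH (N : ℕ) : Equiv.Perm (Fin N) →* Cherednik N :=
  permLift sH sH_self sH_symm sH_sq sH_conj

lemma permH_swap {N : ℕ} (i j : Fin N) : permH N (Equiv.swap i j) = sH i j :=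
  permLift_swap _ _ _ _ _ i j

/-- The polynomial ring `ℂ[x] ⊗ ℂ[y]`: `Sum.inl i` is `x_i` and `Sum.inr i` is `y_i`. -/
abbrev PolyXY (N : ℕ) : Type := MvPolynomial (Fin N ⊕ Fin N) ℂ

/-- Normal ordering `ℂ[x] ⊗ ℂ[y] → H_N`, `q(x) p(y) ↦ q(x) p(y)`: in the image of a monomial the
`x_i` stand to the left of the `y_i`. -/
def normalOrder (N : ℕ) : PolyXY N →ₗ[ℂ] Cherednik N :=
  (MvPolynomial.basisMonomials (Fin N ⊕ Fin N) ℂ).constr ℂ fun m =>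
    (List.ofFn fun i => xH i ^ m (Sum.inl i)).prod * (List.ofFn fun i => yH i ^ m (Sum.inr i)).prod

/-- `∏_{i, σ(i) = i} (1 - (v - x_i)(u - y_i))` as a polynomial in `v` with coefficients in
`ℂ[x, y][u]`. -/
def fixedProd {N : ℕ} (σ : Equiv.Perm (Fin N)) : Polynomial (Polynomial (PolyXY N)) :=
  ∏ i ∈ Finset.univ.filter (fun i => σ i = i),
    (1 - (Polynomial.X - Polynomial.C (Polynomial.C (MvPolynomial.X (Sum.inl i))))
      * Polynomial.C (Polynomial.X - Polynomial.C (MvPolynomial.X (Sum.inr i))))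

/-- `c_{ij}`: the coefficient of `v^{N-i} u^{N-j}` in the universal central polynomial
`(-1)^N ∑_σ :∏_{i, σ(i) = i} (1 - (v - x_i)(u - y_i)): (-1)^σ σ`. -/
def cZ (N : ℕ) (i j : Fin (N + 1)) : Cherednik N :=
  (-1) ^ N * ∑ σ : Equiv.Perm (Fin N),
    normalOrder N (((fixedProd σ).coeff (N - i)).coeff (N - j))
      * (((Equiv.Perm.sign σ : ℤˣ) : ℤ) • permH N σ)

end BetheCherednik

end

noncomputable section

namespace BetheCherednik

attribute [local instance 100] LieRing.ofAssociativeRing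

/-! Both algebras are realised by the same operators on one space, the free `ℂ[z, λ]`-module of
functions `S_N → ℂ[z, λ]`.

On the Bethe side this module is `𝒱₁`: its basis consists of the words in which every letter occurs
exactly once (`permEquiv`). On the basis vector of `τ` the row determinant can be evaluated as if
all entries commuted. The terms in which `∂` differentiates a pole `1/(u - z_k)` cancel against the
terms in which a letter is replaced twice, by a sign-reversing pairing of permutations
(`tail_cancel`). The entry from `τ` to `ρ` is therefore `sign(ρτ⁻¹) ∏_k ([ρ(k) = τ(k)] (∂ -
λ_{τ(k)}) - 1/(u - z_k))` (`records_rdet`, `betheEntry`), and multiplication by `∏ (u - z_k)` turns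
it into a polynomial (`zSeries_mul_betheEntry`). The series `B̄_{1j}` yields the power sums of the
`z_k`, hence by Newton's identities the coefficients of `∏ (u - z_k)`. So the `b̄_{ij}` lie in the
image of the Bethe algebra, and they generate it (`betheImage_eq_adjoin_bBar`).

On the Cherednik side `x_k` acts by `z_k`, a permutation acts on the `z_k` and on the index, and
`y_j` acts by `λ_{τ(j)}` plus divided differences. This representation `dunklRep` is faithful, and
it also gives the independence half of the PBW theorem (`pbw_injective`): `y_j` is diagonal on
values free of `z`, so `:f: σ` sends a basis vector to a multiple of another one from which `f` can
be read off.

The `c_{ij}` are central. Commutation with `x_k` is a cancellation in `H_N[u][v]` (`x_mul_central`).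
The antiautomorphism exchanging `x` and `y` sends `c_{ij}` to `c_{ji}` (`antiFlip_cZ`), which gives
commutation with `y_k`; the transpositions are commutators of `x` and `y`. The `c_{ij}` generate the
center (`center_eq_cAlgebra`): the leading term of a central element sits at the identity
permutation and is invariant under the diagonal action of `S_N`, and by polarization the leading
terms coming from the `c_{ij}` exhaust these invariants.

Finally, `c_{ij}` and `b̄_{ij}` have the same matrix (`centerRep_cZ`). So `dunklRep` carries the
center isomorphically onto the image of the Bethe algebra. The second isomorphism is the first one
followed by the flip of `x` and `y`, and uniqueness holds because the `b̄_{ij}` generate. -/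

/-! ### The word basis of `V^{⊗N}` -/

/-- The basis vector `v_{w(1)} ⊗ ⋯ ⊗ v_{w(N)}` of `V^{⊗N}`. -/
def wordVec {N : ℕ} (w : Fin N → Fin N) : VTensor N :=
  PiTensorProduct.tprod ℂ fun k => (Pi.single (w k) 1 : Fin N → ℂ)

/-- The words form a basis of `V^{⊗N}`. -/
def wordBasis (N : ℕ) : Module.Basis (Fin N → Fin N) ℂ (VTensor N) :=
  Basis.piTensorProduct fun _ => Pi.basisFun ℂ (Fin N)

lemma wordBasis_apply {N : ℕ} (w : Fin N → Fin N) : wordBasis N w = wordVec w := by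
  refine (Basis.piTensorProduct_apply _ _).trans ?_
  simp [wordVec]

/-- Coordinates on `𝒱` with respect to the word basis. -/
def wordEquiv (N : ℕ) : ((Fin N → Fin N) → PolyZL N) ≃ₗ[ℂ] VPoly N :=
  ((TensorProduct.equivFinsuppOfBasisLeft (wordBasis N)).trans
    (Finsupp.linearEquivFunOnFinite ℂ (PolyZL N) (Fin N → Fin N))).symm

lemma wordEquiv_single {N : ℕ} (w : Fin N → Fin N) (p : PolyZL N) :
    wordEquiv N (Pi.single w p) = wordVec w ⊗ₜ[ℂ] p := by
  rw [← wordBasis_apply, wordEquiv, LinearEquiv.symm_apply_eq]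
  simp

lemma siteOp_wordVec {N : ℕ} (k a b : Fin N) (w : Fin N → Fin N) :
    siteOp k (Matrix.single a b 1) (wordVec w)
      = if w k = b then wordVec (Function.update w k a) else 0 := by
  have h : siteOp k (Matrix.single a b 1) (wordVec w) = PiTensorProduct.tprod ℂ
      (Function.update (fun l => (Pi.single (w l) 1 : Fin N → ℂ)) k
        (if w k = b then Pi.single a 1 else 0)) := by
    refine (PiTensorProduct.map_tprod _ _).trans ?_
    congr 1
    funext l
    by_cases hl : l = k
    · subst hl
      simp only [Function.update_self, Matrix.mulVecLin_apply, Matrix.mulVec_single_one]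
      funext x
      split_ifs with hb
      · subst hb
        by_cases hx : x = a
        · subst hx; simp
        · simp [hx, Ne.symm hx]
      · simp [Ne.symm hb]
    · simp [Function.update_of_ne hl]
  rw [h]
  split_ifs with hb
  · refine congrArg (PiTensorProduct.tprod ℂ) (funext fun l => ?_)
    by_cases hl : l = k
    · subst hl; simp
    · simp [Function.update_of_ne hl]
  · exact MultilinearMap.map_coord_zero
      (PiTensorProduct.tprod ℂ (s := fun _ : Fin N => (Fin N → ℂ))) k (by simp)

lemma siteAction_single {N : ℕ} (k a b : Fin N) (s : ℕ) :
    siteAction k (Matrix.single a b (Polynomial.X ^ s))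
      = TensorProduct.map (siteOp k (Matrix.single a b 1))
        (Algebra.lmul ℂ (PolyZL N) (MvPolynomial.X (Sum.inl k) ^ s)) := by
  unfold siteAction
  rw [Finset.sum_eq_single a, Finset.sum_eq_single b]
  · rw [Matrix.single_apply_same, map_pow, Polynomial.aeval_X]
  · intro c _ hc
    rw [Matrix.single_apply_of_col_ne _ _ (Ne.symm hc), map_zero, map_zero,
      TensorProduct.map_zero_right]
  · simp
  · intro c _ hc
    refine Finset.sum_eq_zero fun d _ => ?_
    rw [Matrix.single_apply_of_row_ne (Ne.symm hc), map_zero, map_zero,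
      TensorProduct.map_zero_right]
  · simp

lemma action_eCur {N : ℕ} (a b : Fin N) (s : ℕ) :
    action N (eCur a b s) = ∑ k, TensorProduct.map (siteOp k (Matrix.single a b 1))
        (Algebra.lmul ℂ (PolyZL N) (MvPolynomial.X (Sum.inl k) ^ s)) := by
  have : action N (eCur a b s) = UniversalEnvelopingAlgebra.lift ℂ (currentAction N)
      (UniversalEnvelopingAlgebra.ι ℂ (Matrix.single a b (Polynomial.X ^ s) : Current N)) := by
    refine (Algebra.TensorProduct.lift_tmul _ _ _ _ _).trans ?_
    rw [map_one, mul_one]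
  rw [this, UniversalEnvelopingAlgebra.lift_ι_apply]
  change ∑ k, siteAction k _ = _
  exact Finset.sum_congr rfl fun k _ => siteAction_single k a b s

lemma action_eCur_wordVec {N : ℕ} (a b : Fin N) (s : ℕ) (w : Fin N → Fin N) (p : PolyZL N) :
    action N (eCur a b s) (wordVec w ⊗ₜ p) = ∑ k, if w k = b then
      wordVec (Function.update w k a) ⊗ₜ (MvPolynomial.X (Sum.inl k) ^ s * p) else 0 := by
  rw [action_eCur, LinearMap.sum_apply]
  refine Finset.sum_congr rfl fun k _ => ?_
  rw [TensorProduct.map_tmul, siteOp_wordVec]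
  split_ifs
  · rfl
  · rw [TensorProduct.zero_tmul]

lemma action_inclLam {N : ℕ} (p : MvPolynomial (Fin N) ℂ) :
    action N (inclLam N p) = polyMul N (MvPolynomial.rename Sum.inr p) := by
  refine (Algebra.TensorProduct.lift_tmul _ _ _ _ _).trans ?_
  rw [map_one, one_mul]
  rfl

lemma polyMul_wordEquiv {N : ℕ} (p : PolyZL N) (φ : (Fin N → Fin N) → PolyZL N) :
    polyMul N p (wordEquiv N φ) = wordEquiv N (fun w => p * φ w) := by
  let f : ((Fin N → Fin N) → PolyZL N) →ₗ[ℂ] ((Fin N → Fin N) → PolyZL N) :=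
    LinearMap.pi fun w => (Algebra.lmul ℂ (PolyZL N) p) ∘ₗ LinearMap.proj w
  suffices h : (polyMul N p) ∘ₗ (wordEquiv N).toLinearMap = (wordEquiv N).toLinearMap ∘ₗ f from
    LinearMap.congr_fun h φ
  refine LinearMap.pi_ext fun w q => ?_
  have : f (Pi.single w q) = Pi.single w (p * q) := by
    funext w'
    by_cases h : w' = w
    · subst h; simp [f]
    · simp [f, h]
  simp only [LinearMap.comp_apply, this, LinearEquiv.coe_coe, wordEquiv_single]
  rfl

lemma action_eCur_wordEquiv {N : ℕ} (a b : Fin N) (s : ℕ) (φ : (Fin N → Fin N) → PolyZL N) :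
    action N (eCur a b s) (wordEquiv N φ) = wordEquiv N (fun w => ∑ k, if w k = a then
      MvPolynomial.X (Sum.inl k) ^ s * φ (Function.update w k b) else 0) := by
  let f : ((Fin N → Fin N) → PolyZL N) →ₗ[ℂ] ((Fin N → Fin N) → PolyZL N) :=
    LinearMap.pi fun w => ∑ k, if w k = a then
      (Algebra.lmul ℂ (PolyZL N) (MvPolynomial.X (Sum.inl k) ^ s)) ∘ₗ
        LinearMap.proj (Function.update w k b) else 0
  have hf : ∀ φ, f φ = fun w => ∑ k, if w k = a then
      MvPolynomial.X (Sum.inl k) ^ s * φ (Function.update w k b) else 0 := by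
    intro φ
    funext w
    simp only [f, LinearMap.pi_apply, LinearMap.sum_apply]
    refine Finset.sum_congr rfl fun k _ => ?_
    split_ifs <;> rfl
  rw [← hf]
  suffices h : (action N (eCur a b s)) ∘ₗ (wordEquiv N).toLinearMap
      = (wordEquiv N).toLinearMap ∘ₗ f from LinearMap.congr_fun h φ
  refine LinearMap.pi_ext fun w q => ?_
  have : f (Pi.single w q) = ∑ k, if w k = b then
      Pi.single (Function.update w k a) (MvPolynomial.X (Sum.inl k) ^ s * q) else 0 := by
    rw [hf]
    funext w'
    rw [Finset.sum_apply]
    refine Finset.sum_congr rfl fun k _ => ?_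
    by_cases h1 : w' k = a
    · rw [if_pos h1]
      by_cases h2 : Function.update w' k b = w
      · have h3 : w' = Function.update w k a := by
          rw [← h2, Function.update_idem, ← h1, Function.update_eq_self]
        have h4 : w k = b := by rw [← h2, Function.update_self]
        rw [if_pos h4, h2, Pi.single_eq_same, h3, Pi.single_eq_same]
      · rw [Pi.single_eq_of_ne h2, mul_zero]
        split_ifs with h4
        · rw [Pi.single_eq_of_ne]
          rintro rfl
          exact h2 (by rw [Function.update_idem, ← h4, Function.update_eq_self])
        · rfl
    · rw [if_neg h1]
      split_ifs with h4
      · rw [Pi.single_eq_of_ne]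
        rintro rfl
        exact h1 (Function.update_self _ _ _)
      · rfl
  simp only [LinearMap.comp_apply, this, LinearEquiv.coe_coe, wordEquiv_single,
    action_eCur_wordVec, map_sum]
  refine Finset.sum_congr rfl fun k _ => ?_
  split_ifs
  · rw [wordEquiv_single]
  · rw [map_zero]

end BetheCherednik

end

noncomputable section

namespace BetheCherednik

/-! ### Calculus with formal differential operators over a commutative ring -/

section CommDiffOp

variable {A : Type*} [CommRing A] [Algebra ℂ A]

/-- The chain rule for `X = u⁻¹`: `d/du = -X² d/dX`. It brings in the Leibniz rule for power series.
-/
lemma uDeriv_eq (f : PowerSeries A) :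
    uDeriv A f = -(PowerSeries.X ^ 2 * PowerSeries.derivative A f) := by
  ext m
  match m with
  | 0 => simp [uDeriv]
  | 1 => simp [uDeriv, PowerSeries.coeff_X_pow_mul']
  | n + 2 =>
    simp only [uDeriv, LinearMap.coe_mk, AddHom.coe_mk, PowerSeries.coeff_mk, map_neg,
      PowerSeries.coeff_X_pow_mul', PowerSeries.coeff_derivative]
    simp [Algebra.smul_def, mul_comm]

lemma uDeriv_mul (f g : PowerSeries A) :
    uDeriv A (f * g) = uDeriv A f * g + f * uDeriv A g := by
  simp only [uDeriv_eq, Derivation.leibniz, smul_eq_mul]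
  ring

lemma uDeriv_C (a : A) : uDeriv A (PowerSeries.C a) = 0 := by
  rw [uDeriv_eq, PowerSeries.derivative_C, mul_zero, neg_zero]

/-- The coefficientwise derivative of a differential operator in normal form. -/
def diffCoeff (f : DiffOp A) : DiffOp A := partialOp A f - Polynomial.X * f

lemma partialOp_eq (f : DiffOp A) : partialOp A f = Polynomial.X * f + diffCoeff f := by
  rw [diffCoeff]; ring

lemma diffCoeff_add (f g : DiffOp A) : diffCoeff (f + g) = diffCoeff f + diffCoeff g := by
  simp only [diffCoeff, map_add]; ring

lemma diffCoeff_monomial (n : ℕ) (a : PowerSeries A) :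
    diffCoeff (Polynomial.monomial n a) = Polynomial.monomial n (uDeriv A a) := by
  rw [diffCoeff, partialOp_monomial, Polynomial.X_mul_monomial]
  ring

lemma diffCoeff_mul (f g : DiffOp A) :
    diffCoeff (f * g) = diffCoeff f * g + f * diffCoeff g := by
  induction f using Polynomial.induction_on' with
  | add p q hp hq => rw [add_mul, diffCoeff_add, hp, hq, diffCoeff_add]; ring
  | monomial n a =>
    induction g using Polynomial.induction_on' with
    | add p q hp hq => rw [mul_add, diffCoeff_add, hp, hq, diffCoeff_add]; ring
    | monomial m b =>
      simp only [diffCoeff_monomial, Polynomial.monomial_mul_monomial, uDeriv_mul, map_add]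

lemma diffCoeff_C (a : PowerSeries A) :
    diffCoeff (Polynomial.C a) = Polynomial.C (uDeriv A a) := by
  rw [← Polynomial.monomial_zero_left, diffCoeff_monomial]
  rfl

lemma diffCoeff_X : diffCoeff (Polynomial.X : DiffOp A) = 0 := by
  rw [Polynomial.X, diffCoeff_monomial, ← map_one PowerSeries.C, uDeriv_C, map_zero]

lemma diffCoeff_sub (f g : DiffOp A) : diffCoeff (f - g) = diffCoeff f - diffCoeff g := by
  simp only [diffCoeff, map_sub]; ring

lemma diffCoeff_zero : diffCoeff (0 : DiffOp A) = 0 := by simp [diffCoeff]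

lemma diffCoeff_one : diffCoeff (1 : DiffOp A) = 0 := by
  rw [← map_one Polynomial.C, diffCoeff_C, ← map_one PowerSeries.C, uDeriv_C, map_zero]

lemma diffCoeff_prod {ι : Type*} [DecidableEq ι] (s : Finset ι) (f : ι → DiffOp A) :
    diffCoeff (∏ i ∈ s, f i) = ∑ i ∈ s, diffCoeff (f i) * ∏ j ∈ s.erase i, f j := by
  induction s using Finset.induction_on with
  | empty => simp [diffCoeff_one]
  | insert a s ha ih =>
    rw [Finset.prod_insert ha, diffCoeff_mul, ih, Finset.sum_insert ha, Finset.erase_insert ha,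
      Finset.mul_sum]
    congr 1
    refine Finset.sum_congr rfl fun i hi => ?_
    have hia : a ≠ i := fun h => ha (h ▸ hi)
    rw [Finset.erase_insert_of_ne hia, Finset.prod_insert (fun h => ha (Finset.mem_of_mem_erase h))]
    ring

end CommDiffOp

/-- The series `1 / (u - z) = ∑ₛ zˢ u^{-s-1}`. -/
def poleSeries {A : Type*} [CommRing A] (z : A) : PowerSeries A :=
  PowerSeries.mk fun m =>
    match m with
    | 0 => 0
    | s + 1 => z ^ s

lemma one_sub_mul_poleSeries {A : Type*} [CommRing A] (z : A) :
    (1 - PowerSeries.C z * PowerSeries.X) * poleSeries z = PowerSeries.X := by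
  ext m
  rw [sub_mul, one_mul, mul_assoc, map_sub, PowerSeries.coeff_C_mul]
  match m with
  | 0 => simp [poleSeries]
  | 1 =>
    rw [show (1 : ℕ) = 0 + 1 from rfl, PowerSeries.coeff_succ_X_mul]
    simp [poleSeries]
  | n + 2 =>
    rw [PowerSeries.coeff_succ_X_mul]
    simp [poleSeries, PowerSeries.coeff_X, pow_succ, mul_comm]

/-- The inverse `1/(u - z)` is characterised by `(1 - zX) f = X`; differentiating this identity and
cancelling `1 - zX` in a domain gives the derivative. -/
lemma uDeriv_poleSeries {A : Type*} [CommRing A] [Algebra ℂ A] [IsDomain A] (z : A) :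
    uDeriv A (poleSeries z) = -(poleSeries z) ^ 2 := by
  have h := one_sub_mul_poleSeries z
  have hne : (1 - PowerSeries.C z * PowerSeries.X : PowerSeries A) ≠ 0 := by
    intro h0
    have := congrArg PowerSeries.constantCoeff h0
    simp at this
  have hX : uDeriv A (PowerSeries.X : PowerSeries A) = -PowerSeries.X ^ 2 := by
    rw [uDeriv_eq, PowerSeries.derivative_X, mul_one]
  have h1 : uDeriv A (1 : PowerSeries A) = 0 := by rw [← map_one PowerSeries.C, uDeriv_C]
  have h2 := congrArg (uDeriv A) h
  rw [uDeriv_mul, map_sub, h1, uDeriv_C_mul, hX] at h2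
  refine mul_left_cancel₀ hne ?_
  linear_combination h2 + (PowerSeries.X + poleSeries z) * h

/-! ### The row determinant on the word basis -/

section Capelli

variable {N : ℕ}

/-- `1 / (u - z_k)`. -/
def zPole (k : Fin N) : PowerSeries (PolyZL N) := poleSeries (MvPolynomial.X (Sum.inl k))

/-- `∂ - λ_i`, as a polynomial in `∂`. -/
def lamFactor (i : Fin N) : DiffOp (PolyZL N) :=
  Polynomial.X - Polynomial.C (PowerSeries.C (MvPolynomial.X (Sum.inr i)))

lemma diffCoeff_lamFactor (i : Fin N) : diffCoeff (lamFactor i) = 0 := by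
  rw [lamFactor, diffCoeff_sub, diffCoeff_X, diffCoeff_C, uDeriv_C, map_zero, sub_zero]

/-- The action of an entry of the matrix of `D^B` on `𝒱`-valued differential operators, written in
coordinates with respect to the word basis. -/
def rowOp (i j : Fin N) :
    ((Fin N → Fin N) → DiffOp (PolyZL N)) →+ ((Fin N → Fin N) → DiffOp (PolyZL N)) where
  toFun Ψ w := (if i = j then lamFactor i * Ψ w + diffCoeff (Ψ w) else 0)
    - ∑ k, if w k = j then Polynomial.C (zPole k) * Ψ (Function.update w k i) else 0
  map_zero' := by
    funext w
    simp [diffCoeff_zero]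
  map_add' Ψ Ψ' := by
    funext w
    simp only [Pi.add_apply, diffCoeff_add, mul_add]
    have : ∀ k, (if w k = j then Polynomial.C (zPole k) * Ψ (Function.update w k i)
        + Polynomial.C (zPole k) * Ψ' (Function.update w k i) else 0)
        = (if w k = j then Polynomial.C (zPole k) * Ψ (Function.update w k i) else 0)
        + (if w k = j then Polynomial.C (zPole k) * Ψ' (Function.update w k i) else 0) := by
      intro k; split_ifs <;> simp
    simp only [this, Finset.sum_add_distrib]
    split_ifs <;> ring

/-- `rowOp` is defined on coordinates, which transposes the replacement of letters. On a basis
vector the entry `e_{ji}` replaces a letter `i` by `j`. -/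
lemma rowOp_single (i j : Fin N) (w : Fin N → Fin N) (f : DiffOp (PolyZL N)) :
    rowOp i j (Pi.single w f) = (if i = j then Pi.single w (lamFactor i * f + diffCoeff f) else 0)
      - ∑ k, if w k = i then
          Pi.single (Function.update w k j) (Polynomial.C (zPole k) * f) else 0 := by
  funext w'
  change (if i = j then lamFactor i * _ + diffCoeff _ else 0) - _ = _
  rw [Pi.sub_apply, Finset.sum_apply]
  congr 1
  · split_ifs
    · by_cases h : w' = w
      · subst h; simp
      · simp [h, diffCoeff_zero]
    · rfl
  refine Finset.sum_congr rfl fun k _ => ?_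
  by_cases h1 : w' k = j
  · rw [if_pos h1]
    by_cases h2 : Function.update w' k i = w
    · have h3 : w' = Function.update w k j := by
        rw [← h2, Function.update_idem, ← h1, Function.update_eq_self]
      have h4 : w k = i := by rw [← h2, Function.update_self]
      rw [if_pos h4, h2, Pi.single_eq_same, h3, Pi.single_eq_same]
    · rw [Pi.single_eq_of_ne h2, mul_zero]
      split_ifs with h4
      · rw [Pi.single_eq_of_ne]
        rintro rfl
        exact h2 (by rw [Function.update_idem, ← h4, Function.update_eq_self])
      · rfl
  · rw [if_neg h1]
    split_ifs with h4
    · rw [Pi.single_eq_of_ne]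
      rintro rfl
      exact h1 (Function.update_self _ _ _)
    · rfl

/-- `Ψ` records the action of the differential operator `Q` on the vector `v`. -/
def Records (v : VPoly N) (Q : DiffOp (UCurrent N))
    (Ψ : (Fin N → Fin N) → DiffOp (PolyZL N)) : Prop :=
  ∀ n m, action N (PowerSeries.coeff m (Q.coeff n)) v
    = wordEquiv N fun w => PowerSeries.coeff m ((Ψ w).coeff n)

lemma Records.sub {v : VPoly N} {Q Q' Ψ Ψ'} (h : Records v Q Ψ) (h' : Records v Q' Ψ') :
    Records v (Q - Q') (Ψ - Ψ') := by
  intro n m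
  rw [Polynomial.coeff_sub, map_sub, map_sub, LinearMap.sub_apply, h, h', ← map_sub]
  refine congrArg _ (funext fun w => ?_)
  simp

lemma Records.add {v : VPoly N} {Q Q' Ψ Ψ'} (h : Records v Q Ψ) (h' : Records v Q' Ψ') :
    Records v (Q + Q') (Ψ + Ψ') := by
  intro n m
  rw [Polynomial.coeff_add, map_add, map_add, LinearMap.add_apply, h, h', ← map_add]
  refine congrArg _ (funext fun w => ?_)
  simp

lemma records_zero (v : VPoly N) : Records v 0 0 := by
  intro n m
  simp only [Polynomial.coeff_zero, map_zero, LinearMap.zero_apply, Pi.zero_apply]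
  exact (map_zero (wordEquiv N)).symm

lemma Records.zsmul {v : VPoly N} {Q Ψ} (h : Records v Q Ψ) (c : ℤ) :
    Records v (c • Q) (c • Ψ) := by
  intro n m
  rw [Polynomial.coeff_smul, map_zsmul, map_zsmul, LinearMap.smul_apply, h, ← map_zsmul]
  refine congrArg _ (funext fun w => ?_)
  simp only [Pi.smul_apply, Polynomial.coeff_smul, map_zsmul]

lemma Records.sum {ι : Type*} {v : VPoly N} (s : Finset ι) {Q : ι → DiffOp (UCurrent N)}
    {Ψ : ι → (Fin N → Fin N) → DiffOp (PolyZL N)} (h : ∀ i, Records v (Q i) (Ψ i)) :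
    Records v (∑ i ∈ s, Q i) (∑ i ∈ s, Ψ i) := by
  classical
  induction s using Finset.induction_on with
  | empty => exact records_zero v
  | insert a s ha ih => rw [Finset.sum_insert ha, Finset.sum_insert ha]; exact (h a).add ih

lemma coeff_partialOp_zero {A : Type*} [Ring A] [Algebra ℂ A] (Q : DiffOp A) :
    (partialOp A Q).coeff 0 = uDeriv A (Q.coeff 0) := by
  induction Q using Polynomial.induction_on' with
  | add p q hp hq => simp [hp, hq]
  | monomial n a =>
    simp [partialOp_monomial, Polynomial.coeff_monomial, apply_ite (uDeriv A)]

lemma coeff_partialOp_succ {A : Type*} [Ring A] [Algebra ℂ A] (Q : DiffOp A) (n : ℕ) :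
    (partialOp A Q).coeff (n + 1) = Q.coeff n + uDeriv A (Q.coeff (n + 1)) := by
  induction Q using Polynomial.induction_on' with
  | add p q hp hq => simp only [map_add, Polynomial.coeff_add, hp, hq]; abel
  | monomial k a =>
    simp [partialOp_monomial, Polynomial.coeff_monomial, apply_ite (uDeriv A)]

lemma Records.partialOp {v : VPoly N} {Q Ψ} (h : Records v Q Ψ) :
    Records v (partialOp (UCurrent N) Q) (fun w => partialOp (PolyZL N) (Ψ w)) := by
  have hd : ∀ n m, action N (PowerSeries.coeff m (uDeriv (UCurrent N) (Q.coeff n))) v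
      = wordEquiv N fun w => PowerSeries.coeff m (uDeriv (PolyZL N) ((Ψ w).coeff n)) := by
    intro n m
    cases m with
    | zero =>
      simp only [uDeriv, LinearMap.coe_mk, AddHom.coe_mk, PowerSeries.coeff_mk, map_zero,
        LinearMap.zero_apply]
      exact (map_zero (wordEquiv N)).symm
    | succ m =>
      simp only [uDeriv, LinearMap.coe_mk, AddHom.coe_mk, PowerSeries.coeff_mk, map_neg,
        map_smul, LinearMap.neg_apply, LinearMap.smul_apply, h n m]
      rw [← map_smul, ← map_neg]
      rfl
  intro n m
  cases n with
  | zero => simp only [coeff_partialOp_zero, hd]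
  | succ n =>
    simp only [coeff_partialOp_succ, map_add, LinearMap.add_apply, hd]
    rw [h n m, ← map_add]
    rfl

lemma Records.mulOp_C {v : VPoly N} {Q Ψ} (h : Records v Q Ψ) (i : Fin N) :
    Records v (mulOp (PowerSeries.C (lamCur i)) Q)
      (fun w => Polynomial.C (PowerSeries.C (MvPolynomial.X (Sum.inr i))) * Ψ w) := by
  intro n m
  simp only [mulOp, LinearMap.mulLeft_apply, Polynomial.coeff_C_mul, PowerSeries.coeff_C_mul,
    map_mul, Module.End.mul_apply, h n m]
  rw [lamCur, action_inclLam, MvPolynomial.rename_X, polyMul_wordEquiv]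

lemma Records.mulOp_eSeries {v : VPoly N} {Q Ψ} (h : Records v Q Ψ) (i j : Fin N) :
    Records v (mulOp (eSeries j i) Q)
      (fun w => ∑ k, if w k = j then Polynomial.C (zPole k) * Ψ (Function.update w k i) else 0) := by
  intro n m
  simp only [mulOp, LinearMap.mulLeft_apply, Polynomial.coeff_C_mul, PowerSeries.coeff_mul,
    map_sum, LinearMap.sum_apply, map_mul, Module.End.mul_apply, h n, Polynomial.finsetSum_coeff]
  have key : ∀ a b : ℕ, action N (PowerSeries.coeff a (eSeries j i))
      (wordEquiv N fun w => PowerSeries.coeff b ((Ψ w).coeff n))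
      = wordEquiv N fun w => ∑ k, if w k = j then PowerSeries.coeff a (zPole k)
        * PowerSeries.coeff b ((Ψ (Function.update w k i)).coeff n) else 0 := by
    intro a b
    cases a with
    | zero =>
      simp only [eSeries, zPole, poleSeries, PowerSeries.coeff_mk, map_zero, LinearMap.zero_apply,
        zero_mul, ite_self, Finset.sum_const_zero]
      exact (map_zero (wordEquiv N)).symm
    | succ s =>
      simp only [eSeries, zPole, poleSeries, PowerSeries.coeff_mk]
      exact action_eCur_wordEquiv j i s _
  simp only [key]
  rw [← map_sum]
  congr 1
  funext w
  rw [Finset.sum_apply, Finset.sum_comm]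
  refine Finset.sum_congr rfl fun k _ => ?_
  split_ifs
  · rw [Polynomial.coeff_C_mul, PowerSeries.coeff_mul]
  · simp

lemma Records.betheMatrix {v : VPoly N} {Q Ψ} (h : Records v Q Ψ) (i j : Fin N) :
    Records v (betheMatrix N i j Q) (rowOp i j Ψ) := by
  have hE := h.mulOp_eSeries i j
  unfold BetheCherednik.betheMatrix
  by_cases hij : i = j
  · have := (h.partialOp.sub (h.mulOp_C i)).sub hE
    rw [if_pos hij]
    refine cast (congrArg (Records v _) ?_) this
    funext w
    change _ = (if i = j then lamFactor i * Ψ w + diffCoeff (Ψ w) else 0) - _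
    rw [if_pos hij]
    simp only [Pi.sub_apply, partialOp_eq, lamFactor]
    ring
  · have := (records_zero v).sub hE
    rw [if_neg hij]
    refine cast (congrArg (Records v _) ?_) this
    funext w
    change _ = (if i = j then lamFactor i * Ψ w + diffCoeff (Ψ w) else 0) - _
    rw [if_neg hij]
    rfl

end Capelli

end BetheCherednik

end

noncomputable section

namespace BetheCherednik

/-! ### Evaluation of the row determinant on a word without repeated letters -/

section CapelliInduction

variable {N : ℕ}

/-- The factor of row `i` in the term of `σ`. -/
def rowFactor (τ σ : Equiv.Perm (Fin N)) (i : Fin N) : DiffOp (PolyZL N) :=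
  (if σ i = i then lamFactor i else 0) - Polynomial.C (zPole (τ.symm i))

/-- The word obtained from `τ` by applying `σ` to the letters `≥ m`. -/
def partialWord (τ : Equiv.Perm (Fin N)) (m : ℕ) (σ : Equiv.Perm (Fin N)) (k : Fin N) : Fin N :=
  if (τ k : ℕ) < m then τ k else σ (τ k)

/-- `rowOp` as an additive endomorphism. -/
def rowEnd (i j : Fin N) : AddMonoid.End ((Fin N → Fin N) → DiffOp (PolyZL N)) := rowOp i j

/-- The composition of the first `m` rows in the term of `σ`. -/
def rowProd (m : ℕ) (σ : Equiv.Perm (Fin N)) :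
    AddMonoid.End ((Fin N → Fin N) → DiffOp (PolyZL N)) :=
  (((List.finRange N).take m).map fun i => rowEnd i (σ i)).prod

lemma rowProd_succ (m : Fin N) (σ : Equiv.Perm (Fin N)) (Ψ) :
    rowProd (m + 1) σ Ψ = rowProd m σ (rowOp m (σ m) Ψ) := by
  have : (List.finRange N).take (m + 1) = (List.finRange N).take m ++ [m] := by
    rw [List.take_succ_eq_append_getElem (by simp)]
    simp
  rw [rowProd, this, List.map_append, List.prod_append]
  rw [List.map_singleton, List.prod_singleton]
  rfl

lemma rowProd_congr (m : ℕ) {σ σ' : Equiv.Perm (Fin N)} (h : ∀ i : Fin N, (i : ℕ) < m → σ i = σ' i) :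
    rowProd m σ = rowProd m σ' := by
  rw [rowProd, rowProd]
  refine congrArg _ ?_
  refine List.map_congr_left fun i hi => ?_
  rw [h i]
  obtain ⟨n, hn, rfl⟩ := List.mem_take_iff_getElem.mp hi
  simp at hn ⊢
  omega

lemma diffCoeff_rowFactor (τ σ : Equiv.Perm (Fin N)) (i : Fin N) :
    diffCoeff (rowFactor τ σ i) = Polynomial.C (zPole (τ.symm i) ^ 2) := by
  rw [rowFactor, diffCoeff_sub, diffCoeff_C, zPole, uDeriv_poleSeries, map_neg, sub_neg_eq_add]
  split_ifs
  · rw [diffCoeff_lamFactor, zero_add]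
  · rw [diffCoeff_zero, zero_add]

/-- The product of the factors of the rows after `m`. -/
def tailProd (τ σ : Equiv.Perm (Fin N)) (m : ℕ) : DiffOp (PolyZL N) :=
  ∏ i ∈ Finset.univ.filter (fun i : Fin N => m ≤ i), rowFactor τ σ i

/-- A summand of the derivative of `tailProd`. -/
def tailTerm (τ σ : Equiv.Perm (Fin N)) (m : ℕ) (i : Fin N) : DiffOp (PolyZL N) :=
  Polynomial.C (zPole (τ.symm i) ^ 2) *
    ∏ j ∈ (Finset.univ.filter (fun i : Fin N => m ≤ i)).erase i, rowFactor τ σ j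

/-- Row `m` meets a word in which the rows after `m` have already acted. The main term comes from
the site where `τ` has the letter `m`. The corrections have two sources: `∂` hits a pole in the
factor of a later row `i`, possible only if `σ m = m`; or a later row has already created a letter
`m` at the site of `i`, that is `σ i = m`, and row `m` replaces it again. Both carry the square of
the same pole. -/
lemma rowOp_partial (τ σ : Equiv.Perm (Fin N)) (m : Fin N) :
    rowOp m (σ m) (Pi.single (partialWord τ (m + 1) σ) (tailProd τ σ (m + 1)))
      = Pi.single (partialWord τ m σ) (tailProd τ σ m)
        + ∑ i ∈ Finset.univ.filter (fun i : Fin N => (m : ℕ) + 1 ≤ i),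
          ((if σ m = m then Pi.single (partialWord τ m σ) (tailTerm τ σ (m + 1) i) else 0)
          + (if σ i = m then Pi.single (Function.update (partialWord τ (m + 1) σ) (τ.symm i) (σ m))
              (tailTerm τ σ (m + 1) i) else 0)) := by
  set s := Finset.univ.filter (fun i : Fin N => (m : ℕ) + 1 ≤ i) with hs
  have hms : m ∉ s := by simp [hs]
  have hins : Finset.univ.filter (fun i : Fin N => (m : ℕ) ≤ i) = insert m s := by
    ext i
    simp only [hs, Finset.mem_filter, Finset.mem_univ, true_and, Finset.mem_insert]
    rw [Fin.ext_iff]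
    omega
  have hw1 : σ m = m → partialWord τ (m + 1) σ = partialWord τ m σ := by
    intro h
    funext k
    unfold partialWord
    by_cases hk : τ k = m
    · simp [hk, h]
    · have : ((τ k : ℕ) < m + 1) ↔ ((τ k : ℕ) < m) := by
        have := fun h' => hk (Fin.ext h')
        omega
      simp only [this]
  have hw2 : Function.update (partialWord τ (m + 1) σ) (τ.symm m) (σ m) = partialWord τ m σ := by
    funext k
    by_cases hk : τ k = m
    · have : k = τ.symm m := by rw [← hk, Equiv.symm_apply_apply]
      subst this
      simp [partialWord]
    · have hk' : k ≠ τ.symm m := fun h => hk (by rw [h, Equiv.apply_symm_apply])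
      rw [Function.update_of_ne hk']
      unfold partialWord
      have : ((τ k : ℕ) < m + 1) ↔ ((τ k : ℕ) < m) := by
        have := fun h' => hk (Fin.ext h')
        omega
      simp only [this]
  have hprod : tailProd τ σ m = rowFactor τ σ m * tailProd τ σ (m + 1) := by
    rw [tailProd, tailProd, hins, Finset.prod_insert hms]
  have hdiff : diffCoeff (tailProd τ σ (m + 1)) = ∑ i ∈ s, tailTerm τ σ (m + 1) i := by
    rw [tailProd, diffCoeff_prod]
    refine Finset.sum_congr rfl fun i _ => ?_
    rw [diffCoeff_rowFactor]
    rfl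
  have hsum : (∑ k, if partialWord τ (m + 1) σ k = m then
      (Pi.single (Function.update (partialWord τ (m + 1) σ) k (σ m))
        (Polynomial.C (zPole k) * tailProd τ σ (m + 1)) :
          (Fin N → Fin N) → DiffOp (PolyZL N)) else 0)
      = Pi.single (partialWord τ m σ)
          (Polynomial.C (zPole (τ.symm m)) * tailProd τ σ (m + 1))
        - ∑ i ∈ s, if σ i = m then
          Pi.single (Function.update (partialWord τ (m + 1) σ) (τ.symm i) (σ m))
              (tailTerm τ σ (m + 1) i) else 0 := by
    rw [← Equiv.sum_comp τ.symm, ← Finset.sum_subset (Finset.subset_univ (insert m s)),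
      Finset.sum_insert hms, hw2, if_pos (by simp [partialWord]), sub_eq_add_neg,
      ← Finset.sum_neg_distrib]
    · congr 1
      refine Finset.sum_congr rfl fun i hi => ?_
      have hi' : ¬ ((i : ℕ) < m + 1) := by simpa [hs] using hi
      have : partialWord τ (m + 1) σ (τ.symm i) = σ i := by simp [partialWord, hi']
      rw [this]
      split_ifs with h
      -- Here `σ i = m < i`, so the factor of row `i` is only `-1/(u - z)`; its product with the new
      -- pole gives the square with a plus sign.
      · have hne : ¬ σ i = i := by
          rintro h'
          exact hi' (by rw [← h', h]; omega)
        rw [← Pi.single_neg]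
        congr 1
        rw [tailTerm, tailProd, ← Finset.mul_prod_erase _ _ hi, rowFactor, if_neg hne, map_pow]
        ring
      · simp
    · intro i _ hi
      rw [if_neg]
      simp only [hs, Finset.mem_insert, Finset.mem_filter, Finset.mem_univ, true_and, not_or] at hi
      have h1 : (i : ℕ) < m + 1 := by omega
      simp [partialWord, h1, hi.1]
  rw [rowOp_single, hsum, Finset.sum_add_distrib, hprod, rowFactor, hdiff]
  by_cases h : σ m = m
  · rw [if_pos h.symm, if_pos h, hw1 h]
    simp only [if_pos h]
    have : ∑ i ∈ s, (Pi.single (partialWord τ m σ) (tailTerm τ σ (m + 1) i) :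
        (Fin N → Fin N) → DiffOp (PolyZL N))
        = Pi.single (partialWord τ m σ) (∑ i ∈ s, tailTerm τ σ (m + 1) i) :=
      (map_sum (AddMonoidHom.single (fun _ => DiffOp (PolyZL N)) (partialWord τ m σ)) _ _).symm
    rw [this, sub_mul, Pi.single_sub, Pi.single_add]
    abel
  · rw [if_neg (Ne.symm h), if_neg h]
    simp only [if_neg h]
    rw [zero_sub (Polynomial.C (zPole (τ.symm m))), neg_mul (Polynomial.C (zPole (τ.symm m))),
      Pi.single_neg, zero_sub]
    simp only [neg_sub, Finset.sum_const_zero, zero_add]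
    abel

/-- The map `σ ↦ σ (m i)` exchanges the two kinds of corrections and reverses the sign. It does not
change `σ` on the rows before `m`, so the operators still to be applied agree, and the resulting
words and the remaining factors coincide as well. -/
lemma tail_cancel (τ : Equiv.Perm (Fin N)) (m i : Fin N) (hi : (m : ℕ) + 1 ≤ i) :
    ∑ σ : Equiv.Perm (Fin N), ((Equiv.Perm.sign σ : ℤˣ) : ℤ) • rowProd m σ
      ((if σ m = m then Pi.single (partialWord τ m σ) (tailTerm τ σ (m + 1) i) else 0)
          + (if σ i = m then Pi.single (Function.update (partialWord τ (m + 1) σ) (τ.symm i) (σ m))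
              (tailTerm τ σ (m + 1) i) else 0)) = 0 := by
  have hmi : m ≠ i := fun h => by rw [h] at hi; omega
  simp only [map_add, smul_add, Finset.sum_add_distrib]
  rw [add_eq_zero_iff_eq_neg, ← Equiv.sum_comp (Equiv.mulRight (Equiv.swap m i)),
    ← Finset.sum_neg_distrib]
  refine Finset.sum_congr rfl fun σ _ => ?_
  have h1 : (σ * Equiv.swap m i) m = σ i := by simp
  have h2 : ∀ j, j ≠ m → j ≠ i → (σ * Equiv.swap m i) j = σ j := fun j hj hj' => by
    rw [Equiv.Perm.mul_apply, Equiv.swap_apply_of_ne_of_ne hj hj']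
  rw [Equiv.coe_mulRight, h1, Equiv.Perm.sign_mul, Equiv.Perm.sign_swap hmi,
    rowProd_congr m (σ' := σ) (fun j hj => h2 j (fun h => by rw [h] at hj; omega)
      (fun h => by rw [h] at hj; omega)), mul_neg, mul_one, Units.val_neg, neg_smul]
  congr 3
  split_ifs with h
  · have e1 : partialWord τ m (σ * Equiv.swap m i)
        = Function.update (partialWord τ (m + 1) σ) (τ.symm i) (σ m) := by
      funext k
      by_cases hk : τ k = i
      · have : k = τ.symm i := by rw [← hk, Equiv.symm_apply_apply]
        subst this
        have : ¬ (i : ℕ) < m := by omega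
        simp [partialWord, this]
      · have hk' : k ≠ τ.symm i := fun h => hk (by rw [h, Equiv.apply_symm_apply])
        rw [Function.update_of_ne hk']
        unfold partialWord
        by_cases hk2 : τ k = m
        · simp [hk2, h]
        · have : ((τ k : ℕ) < m + 1) ↔ ((τ k : ℕ) < m) := by
            have := fun h' => hk2 (Fin.ext h')
            omega
          simp only [this, h2 _ hk2 hk]
    have e2 : tailTerm τ (σ * Equiv.swap m i) (m + 1) i = tailTerm τ σ (m + 1) i := by
      unfold tailTerm
      congr 1
      refine Finset.prod_congr rfl fun j hj => ?_
      simp only [Finset.mem_erase, Finset.mem_filter, Finset.mem_univ, true_and] at hj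
      unfold rowFactor
      rw [h2 j (fun h => by rw [h] at hj; omega) hj.1]
    rw [e1, e2]
  · rfl

/-- The row determinant applied to a basis vector of `𝒱₁`, one row at a time. -/
lemma rowProd_partial (τ : Equiv.Perm (Fin N)) (m : ℕ) (hm : m ≤ N) :
    ∑ σ : Equiv.Perm (Fin N), ((Equiv.Perm.sign σ : ℤˣ) : ℤ) •
        rowProd N σ (Pi.single (τ : Fin N → Fin N) 1)
      = ∑ σ : Equiv.Perm (Fin N), ((Equiv.Perm.sign σ : ℤˣ) : ℤ) •
        rowProd m σ (Pi.single (partialWord τ m σ) (tailProd τ σ m)) := by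
  induction hm using Nat.decreasingInduction with
  | self =>
    refine Finset.sum_congr rfl fun σ _ => ?_
    have h1 : tailProd τ σ N = 1 := by
      rw [tailProd, Finset.filter_false_of_mem, Finset.prod_empty]
      intro i _
      have := i.2
      omega
    have h2 : partialWord τ N σ = τ := by
      funext k
      simp [partialWord]
    rw [h1, h2]
  | of_succ m hm ih =>
    -- For each `σ` the difference of the two sides is the sum of the corrections of row `m`; after
    -- exchanging the sums, they cancel for each later row `i` separately.
    rw [ih, ← sub_eq_zero, ← Finset.sum_sub_distrib]
    have h1 : ∀ σ : Equiv.Perm (Fin N), ((Equiv.Perm.sign σ : ℤˣ) : ℤ) •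
        rowProd (m + 1) σ (Pi.single (partialWord τ (m + 1) σ) (tailProd τ σ (m + 1)))
          - ((Equiv.Perm.sign σ : ℤˣ) : ℤ) •
            rowProd m σ (Pi.single (partialWord τ m σ) (tailProd τ σ m))
        = ∑ i ∈ Finset.univ.filter (fun i : Fin N => m + 1 ≤ i),
          ((Equiv.Perm.sign σ : ℤˣ) : ℤ) • rowProd m σ
          ((if σ ⟨m, hm⟩ = ⟨m, hm⟩ then
            Pi.single (partialWord τ m σ) (tailTerm τ σ (m + 1) i) else 0)
          + (if σ i = ⟨m, hm⟩ then
              Pi.single (Function.update (partialWord τ (m + 1) σ) (τ.symm i) (σ ⟨m, hm⟩))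
              (tailTerm τ σ (m + 1) i) else 0)) := by
      intro σ
      have e1 := rowProd_succ ⟨m, hm⟩ σ
        (Pi.single (partialWord τ (m + 1) σ) (tailProd τ σ (m + 1)))
      have e2 := rowOp_partial τ σ ⟨m, hm⟩
      simp only at e1 e2
      rw [e1, e2, map_add, smul_add, add_sub_cancel_left, map_sum, Finset.smul_sum]
    rw [Finset.sum_congr rfl fun σ _ => h1 σ, Finset.sum_comm]
    refine Finset.sum_eq_zero fun i hi => ?_
    exact tail_cancel τ ⟨m, hm⟩ i (by simpa using hi)

/-- Once the rows down to `m = 0` have acted, no operator is left and the term of `σ` is a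
commutative product of factors attached to the word `σ ∘ τ`. -/
lemma records_rdet (τ : Equiv.Perm (Fin N)) :
    Records (wordVec (τ : Fin N → Fin N) ⊗ₜ 1) (universalOp N)
      (∑ σ : Equiv.Perm (Fin N), ((Equiv.Perm.sign σ : ℤˣ) : ℤ) •
        (Pi.single (fun k => σ (τ k)) (∏ i, rowFactor τ σ i) :
          (Fin N → Fin N) → DiffOp (PolyZL N))) := by
  have h0 : Records (wordVec (τ : Fin N → Fin N) ⊗ₜ 1) 1
      (Pi.single (τ : Fin N → Fin N) 1) := by
    intro n m
    rw [Polynomial.coeff_one]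
    have : (fun w => PowerSeries.coeff m (Polynomial.coeff
        ((Pi.single (τ : Fin N → Fin N) 1 : (Fin N → Fin N) → DiffOp (PolyZL N)) w) n))
        = Pi.single (τ : Fin N → Fin N) (if n = 0 ∧ m = 0 then 1 else 0) := by
      funext w
      by_cases hw : w = τ
      · subst hw
        rw [Pi.single_eq_same, Pi.single_eq_same, Polynomial.coeff_one]
        split_ifs <;> simp_all [PowerSeries.coeff_one]
      · simp [hw]
    rw [this, wordEquiv_single]
    split_ifs <;> simp_all [PowerSeries.coeff_one]
  have h1 : ∀ (σ : Equiv.Perm (Fin N)) (l : List (Fin N)),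
      Records (wordVec (τ : Fin N → Fin N) ⊗ₜ 1)
        ((l.map fun i => betheMatrix N i (σ i)).prod 1)
        ((l.map fun i => rowEnd i (σ i)).prod
          (Pi.single (τ : Fin N → Fin N) 1)) := by
    intro σ l
    induction l with
    | nil => exact h0
    | cons i l ih =>
      rw [List.map_cons, List.prod_cons, List.map_cons, List.prod_cons]
      exact ih.betheMatrix i (σ i)
  have h2 := rowProd_partial τ 0 (Nat.zero_le N)
  have h3 : ∀ σ : Equiv.Perm (Fin N),
      rowProd 0 σ (Pi.single (partialWord τ 0 σ) (tailProd τ σ 0))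
        = Pi.single (fun k => σ (τ k)) (∏ i, rowFactor τ σ i) := by
    intro σ
    have e : partialWord τ 0 σ = fun k => σ (τ k) := by
      funext k
      simp [partialWord]
    rw [e]
    simp [rowProd, tailProd]
  simp only [h3] at h2
  rw [← h2, universalOp, rdet, LinearMap.sum_apply]
  refine Records.sum _ fun σ => ?_
  rw [LinearMap.smul_apply, List.ofFn_eq_map, rowProd, List.take_of_length_le (by simp)]
  exact (h1 σ _).zsmul _

end CapelliInduction

end BetheCherednik

end

noncomputable section

namespace BetheCherednik

/-! ### The universal bivariate polynomials -/

section PairPoly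

open Polynomial

variable {R : Type*} [CommRing R]

/-- `f` is obtained from `g` by the substitution `u ↦ u⁻¹` in the inner variable, followed by
multiplication by `u^d`. -/
def InnerReflect (d : ℕ) (f g : R[X][X]) : Prop :=
  ∀ a, (g.coeff a).natDegree ≤ d ∧ f.coeff a = reflect d (g.coeff a)

lemma InnerReflect.sub {d : ℕ} {f g f' g' : R[X][X]} (h : InnerReflect d f g)
    (h' : InnerReflect d f' g') : InnerReflect d (f - f') (g - g') := by
  intro a
  refine ⟨?_, ?_⟩
  · rw [coeff_sub]
    exact (natDegree_sub_le _ _).trans (max_le (h a).1 (h' a).1)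
  · rw [coeff_sub, coeff_sub, (h a).2, (h' a).2, reflect_sub]

lemma innerReflect_zero (d : ℕ) : InnerReflect d (0 : R[X][X]) 0 := by
  intro a
  simp

lemma reflect_finset_sum {ι : Type*} (d : ℕ) (s : Finset ι) (f : ι → R[X]) :
    reflect d (∑ i ∈ s, f i) = ∑ i ∈ s, reflect d (f i) := by
  classical
  induction s using Finset.induction_on with
  | empty => simp
  | insert a s ha ih => rw [Finset.sum_insert ha, Finset.sum_insert ha, reflect_add, ih]

lemma InnerReflect.mul {d e : ℕ} {f g f' g' : R[X][X]} (h : InnerReflect d f g)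
    (h' : InnerReflect e f' g') : InnerReflect (d + e) (f * f') (g * g') := by
  intro a
  refine ⟨?_, ?_⟩
  · rw [coeff_mul]
    refine natDegree_sum_le_of_forall_le _ _ fun x _ => ?_
    exact natDegree_mul_le_of_le (h _).1 (h' _).1
  · rw [coeff_mul, coeff_mul, reflect_finset_sum]
    refine Finset.sum_congr rfl fun x _ => ?_
    rw [(h _).2, (h' _).2, reflect_mul _ _ (h _).1 (h' _).1]

lemma InnerReflect.prod {ι : Type*} (s : Finset ι) (d : ℕ) {f g : ι → R[X][X]}
    (h : ∀ i ∈ s, InnerReflect d (f i) (g i)) :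
    InnerReflect (s.card * d) (∏ i ∈ s, f i) (∏ i ∈ s, g i) := by
  classical
  induction s using Finset.induction_on with
  | empty =>
    intro a
    rw [Finset.prod_empty, Finset.prod_empty, coeff_one]
    split_ifs <;> simp
  | insert a s ha ih =>
    rw [Finset.prod_insert ha, Finset.prod_insert ha, Finset.card_insert_of_notMem ha, add_mul,
      one_mul, add_comm]
    exact (h a (Finset.mem_insert_self _ _)).mul
      (ih fun i hi => h i (Finset.mem_insert_of_mem hi))

lemma innerReflect_outer (α : R) : InnerReflect 0 (X - C (C α)) (X - C (C α)) := by
  refine InnerReflect.sub ?_ ?_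
  · intro a
    rw [coeff_X]
    split_ifs <;> simp
  · intro a
    rw [coeff_C]
    split_ifs <;> simp

lemma innerReflect_C {d : ℕ} {p q : R[X]} (hq : q.natDegree ≤ d) (h : p = reflect d q) :
    InnerReflect d (C p) (C q) := by
  intro a
  rw [coeff_C, coeff_C]
  split_ifs
  · exact ⟨hq, h⟩
  · simp

/-- A factor `(v - α)(u - β) - 1` or `-1`. -/
def pairFactor (b : Prop) [Decidable b] (α β : R) : R[X][X] :=
  (if b then (X - C (C α)) * C (X - C β) else 0) - 1

/-- A factor `(v - α)(1 - β u⁻¹) - u⁻¹` or `-u⁻¹`. -/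
def pairFactorInv (b : Prop) [Decidable b] (α β : R) : R[X][X] :=
  (if b then (X - C (C α)) * C (1 - C β * X) else 0) - C X

/-- Each factor has degree at most one in `u`, so dividing it by `u` and writing the result in `u⁻¹`
is a reflection of degree one. -/
lemma innerReflect_pairFactor (b : Prop) [Decidable b] (α β : R) :
    InnerReflect 1 (pairFactorInv b α β) (pairFactor b α β) := by
  have h1 : (X : R[X]) = reflect 1 1 := by
    rw [← C_1, reflect_C]; simp
  refine InnerReflect.sub ?_ (innerReflect_C (q := 1) (by simp) h1)
  split_ifs
  · have : (1 - C β * X : R[X]) = reflect 1 (X - C β) := by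
      rw [reflect_sub, reflect_C]
      congr 1
      · have := reflect_monomial (R := R) 1 1
        rw [pow_one] at this
        rw [this]; simp
      · simp
    exact (innerReflect_outer α).mul (innerReflect_C (natDegree_X_sub_C_le β) this)
  · exact innerReflect_zero 1

lemma coeff_swap (p : R[X][X]) (a b : ℕ) :
    ((Bivariate.swap p).coeff a).coeff b = (p.coeff b).coeff a := by
  induction p using Polynomial.induction_on' with
  | add p q hp hq => simp [hp, hq]
  | monomial n f =>
    induction f using Polynomial.induction_on' with
    | add p q hp hq => simp only [map_add, coeff_add, hp, hq]
    | monomial m r =>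
      rw [Bivariate.swap_monomial_monomial]
      simp only [coeff_monomial]
      by_cases h1 : m = a <;> by_cases h2 : n = b <;> simp [h1, h2, coeff_monomial]

lemma swap_pairFactor (b : Prop) [Decidable b] (α β : R) :
    Bivariate.swap (pairFactor b α β) = pairFactor b β α := by
  unfold pairFactor
  split_ifs
  · simp only [map_sub, map_mul, Bivariate.swap_Y, Bivariate.swap_C_C, Bivariate.swap_X, map_one]
    ring
  · simp

end PairPoly

end BetheCherednik

end

noncomputable section

namespace BetheCherednik

attribute [local instance 100] LieRing.ofAssociativeRing

/-! ### The module `𝒱₁` with its basis of permutations and the matrix of the universal Bethe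
polynomial -/

section PermModel

variable {N : ℕ}

/-- Extension by zero of a function on permutations to a function on words. -/
def permExt (N : ℕ) : (Equiv.Perm (Fin N) → PolyZL N) →ₗ[ℂ] ((Fin N → Fin N) → PolyZL N) where
  toFun m w := if h : Function.Bijective w then m (Equiv.ofBijective w h) else 0
  map_add' m m' := by
    funext w
    by_cases h : Function.Bijective w
    · simp only [dif_pos h, Pi.add_apply]
    · simp only [dif_neg h, Pi.add_apply, add_zero]
  map_smul' c m := by
    funext w
    by_cases h : Function.Bijective w
    · simp only [dif_pos h, Pi.smul_apply, RingHom.id_apply]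
    · simp only [dif_neg h, Pi.smul_apply, smul_zero]

lemma permExt_perm (m : Equiv.Perm (Fin N) → PolyZL N) (τ : Equiv.Perm (Fin N)) :
    permExt N m τ = m τ := by
  have : Equiv.ofBijective (τ : Fin N → Fin N) τ.bijective = τ := by ext; rfl
  exact (dif_pos τ.bijective).trans (congrArg m this)

lemma permExt_of_not_bijective (m : Equiv.Perm (Fin N) → PolyZL N) {w : Fin N → Fin N}
    (hw : ¬ Function.Bijective w) : permExt N m w = 0 :=
  dif_neg hw

lemma permExt_single (τ : Equiv.Perm (Fin N)) (p : PolyZL N) :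
    permExt N (Pi.single τ p) = Pi.single (τ : Fin N → Fin N) p := by
  funext w
  by_cases hw : Function.Bijective w
  · obtain ⟨ρ, rfl⟩ : ∃ ρ : Equiv.Perm (Fin N), w = ρ := ⟨Equiv.ofBijective w hw, rfl⟩
    rw [permExt_perm]
    by_cases h : ρ = τ
    · subst h; simp
    · rw [Pi.single_eq_of_ne h, Pi.single_eq_of_ne (fun h' => h (DFunLike.coe_injective h'))]
  · rw [permExt_of_not_bijective _ hw, Pi.single_eq_of_ne]
    rintro rfl
    exact hw τ.bijective

/-- The operator `e_{ii}` multiplies a word by the number of occurrences of the letter `i`. All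
these numbers are one exactly for bijective words; a word that is not bijective misses a letter, and
the weight condition for that letter kills its coordinate. -/
lemma mem_VOne_wordEquiv (φ : (Fin N → Fin N) → PolyZL N) :
    wordEquiv N φ ∈ VOne N ↔ ∀ w, ¬ Function.Bijective w → φ w = 0 := by
  have h1 : wordEquiv N φ ∈ VOne N ↔
      ∀ (i : Fin N) (w : Fin N → Fin N),
        ((Finset.univ.filter fun k => w k = i).card : PolyZL N) * φ w = φ w := by
    rw [mem_VOne_iff]
    refine forall_congr' fun i => ?_
    rw [action_eCur_wordEquiv, (wordEquiv N).injective.eq_iff, funext_iff]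
    refine forall_congr' fun w => ?_
    rw [Finset.natCast_card_filter, Finset.sum_mul]
    have : ∀ k, (if w k = i then MvPolynomial.X (Sum.inl k) ^ 0 * φ (Function.update w k i) else 0)
        = (if w k = i then 1 else 0) * φ w := by
      intro k
      split_ifs with h
      · rw [← h, Function.update_eq_self, pow_zero]
      · rw [zero_mul]
    simp only [this]
  rw [h1]
  constructor
  · intro h w hw
    by_contra h0
    apply hw
    rw [← Finite.surjective_iff_bijective]
    intro i
    have h2 := h i w
    by_contra hi
    push Not at hi
    rw [Finset.filter_false_of_mem (by simpa using hi)] at h2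
    simp at h2
    exact h0 h2.symm
  · intro h i w
    by_cases hw : Function.Bijective w
    · obtain ⟨k, rfl⟩ := hw.2 i
      have : (Finset.univ.filter fun l => w l = w k) = {k} := by
        ext l
        simp [hw.1.eq_iff]
      rw [this]
      simp
    · rw [h w hw, mul_zero]

/-- The basis of `𝒱₁` over `ℂ[z, λ]` indexed by permutations. -/
def permEquiv (N : ℕ) : (Equiv.Perm (Fin N) → PolyZL N) ≃ₗ[ℂ] VOne N :=
  LinearEquiv.ofBijective
    (((wordEquiv N).toLinearMap ∘ₗ permExt N).codRestrict (VOne N) fun m =>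
      (mem_VOne_wordEquiv _).mpr fun _ hw => permExt_of_not_bijective m hw) (by
    constructor
    · intro m m' h
      have h' := (wordEquiv N).injective (congrArg Subtype.val h)
      funext τ
      rw [← permExt_perm m, ← permExt_perm m']
      exact congrFun h' τ
    · rintro ⟨v, hv⟩
      obtain ⟨φ, rfl⟩ := (wordEquiv N).surjective v
      refine ⟨fun τ => φ τ, Subtype.ext ?_⟩
      refine congrArg (wordEquiv N) (funext fun w => ?_)
      by_cases hw : Function.Bijective w
      · obtain ⟨ρ, rfl⟩ : ∃ ρ : Equiv.Perm (Fin N), w = ρ := ⟨Equiv.ofBijective w hw, rfl⟩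
        rw [permExt_perm]
      · rw [permExt_of_not_bijective _ hw, (mem_VOne_wordEquiv φ).mp hv w hw])

lemma coe_permEquiv (m : Equiv.Perm (Fin N) → PolyZL N) :
    (permEquiv N m : VPoly N) = wordEquiv N (permExt N m) := rfl

lemma polyMulOne_permEquiv (p : PolyZL N) (m : Equiv.Perm (Fin N) → PolyZL N) :
    polyMulOne N p (permEquiv N m) = permEquiv N (p • m) := by
  refine Subtype.ext ?_
  change polyMul N p (wordEquiv N (permExt N m)) = wordEquiv N (permExt N (p • m))
  rw [polyMul_wordEquiv]
  refine congrArg _ (funext fun w => ?_)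
  by_cases hw : Function.Bijective w
  · obtain ⟨ρ, rfl⟩ : ∃ ρ : Equiv.Perm (Fin N), w = ρ := ⟨Equiv.ofBijective w hw, rfl⟩
    simp only [permExt_perm, Pi.smul_apply, smul_eq_mul]
  · simp only [permExt_of_not_bijective _ hw, mul_zero]

lemma commute_action_polyMul (x : UCurrent N) (p : PolyZL N) :
    Commute (action N x) (polyMul N p) := by
  have h : ∀ x : UniversalEnvelopingAlgebra ℂ (Current N) ⊗[ℂ] MvPolynomial (Fin N) ℂ,
      Commute (action N x) (polyMul N p) := by
    intro x
    induction x using TensorProduct.induction_on with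
    | zero =>
      exact (show Commute (action N (0 : UCurrent N)) _ by
        rw [map_zero]; exact Commute.zero_left _)
    | add x y hx hy =>
      exact (show Commute (action N ((show UCurrent N from x) + (show UCurrent N from y))) _ by
        rw [map_add]; exact hx.add_left hy)
    | tmul x q =>
      have : action N (x ⊗ₜ q : UniversalEnvelopingAlgebra ℂ (Current N) ⊗[ℂ] MvPolynomial (Fin N) ℂ)
          = UniversalEnvelopingAlgebra.lift ℂ (currentAction N) x
            * polyMul N (MvPolynomial.rename Sum.inr q) :=
        Algebra.TensorProduct.lift_tmul _ _ _ _ _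
      rw [this]
      refine (commute_liftAction x p).mul_left ?_
      rw [Commute, SemiconjBy, ← map_mul, ← map_mul, mul_comm]
  exact h x

lemma commute_betheRep_polyMulOne (b : betheAlgebra N) (p : PolyZL N) :
    Commute (betheRep N b) (polyMulOne N p) := by
  refine LinearMap.ext fun v => Subtype.ext ?_
  exact LinearMap.congr_fun (commute_action_polyMul (b : UCurrent N) p).eq v.1

/-- Operators on `𝒱₁` that are linear over `ℂ[z, λ]` are determined by their values on the basis
indexed by permutations. -/
lemma end_VOne_ext {T T' : Module.End ℂ (VOne N)} (hT : ∀ p, Commute T (polyMulOne N p))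
    (hT' : ∀ p, Commute T' (polyMulOne N p))
    (h : ∀ τ, T (permEquiv N (Pi.single τ 1)) = T' (permEquiv N (Pi.single τ 1))) : T = T' := by
  suffices T ∘ₗ (permEquiv N).toLinearMap = T' ∘ₗ (permEquiv N).toLinearMap by
    refine LinearMap.ext fun v => ?_
    obtain ⟨m, rfl⟩ := (permEquiv N).surjective v
    exact LinearMap.congr_fun this m
  refine LinearMap.pi_ext fun τ p => ?_
  have e : (Pi.single τ p : Equiv.Perm (Fin N) → PolyZL N) = p • Pi.single τ 1 := by
    rw [← Pi.single_smul, smul_eq_mul, mul_one]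
  have h1 := LinearMap.congr_fun (hT p).eq (permEquiv N (Pi.single τ 1))
  have h2 := LinearMap.congr_fun (hT' p).eq (permEquiv N (Pi.single τ 1))
  simp only [Module.End.mul_apply, polyMulOne_permEquiv] at h1 h2
  simp only [LinearMap.comp_apply, LinearEquiv.coe_coe, e]
  rw [h1, h2, h]

/-- The matrix entries of `D^B` on `𝒱₁`. -/
def betheEntry (τ ρ : Equiv.Perm (Fin N)) : DiffOp (PolyZL N) :=
  ((Equiv.Perm.sign (ρ * τ⁻¹) : ℤˣ) : ℤ) •
    ∏ k, ((if ρ k = τ k then lamFactor (τ k) else 0) - Polynomial.C (zPole k))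

/-- In the row determinant the term of `σ` leads from `τ` to `σ τ`. Substituting `σ = ρ τ⁻¹` and
indexing the rows by sites, `i = τ k`, turns the product over rows into the entry for `ρ`. -/
lemma action_B_permEquiv (τ : Equiv.Perm (Fin N)) (n m : ℕ) :
    action N (PowerSeries.coeff m ((universalOp N).coeff n)) (permEquiv N (Pi.single τ 1))
      = permEquiv N (fun ρ => PowerSeries.coeff m ((betheEntry τ ρ).coeff n)) := by
  rw [coe_permEquiv, coe_permEquiv, permExt_single, wordEquiv_single, records_rdet τ n m]
  refine congrArg _ (funext fun w => ?_)
  have hΨ : (∑ σ : Equiv.Perm (Fin N), ((Equiv.Perm.sign σ : ℤˣ) : ℤ) •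
        (Pi.single (fun k => σ (τ k)) (∏ i, rowFactor τ σ i) :
          (Fin N → Fin N) → DiffOp (PolyZL N)))
      = ∑ ρ : Equiv.Perm (Fin N), Pi.single (ρ : Fin N → Fin N) (betheEntry τ ρ) := by
    rw [← Equiv.sum_comp (Equiv.mulRight τ⁻¹)]
    refine Finset.sum_congr rfl fun ρ _ => ?_
    rw [Equiv.coe_mulRight, ← Pi.single_smul, betheEntry]
    have e : (fun k => (ρ * τ⁻¹) (τ k)) = (ρ : Fin N → Fin N) := by funext k; simp
    rw [e]
    congr 2
    rw [← Equiv.prod_comp τ]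
    refine Finset.prod_congr rfl fun k _ => ?_
    simp [rowFactor]
  rw [hΨ, Finset.sum_apply]
  by_cases hw : Function.Bijective w
  · obtain ⟨ρ, rfl⟩ : ∃ ρ : Equiv.Perm (Fin N), w = ρ := ⟨Equiv.ofBijective w hw, rfl⟩
    rw [permExt_perm, Finset.sum_eq_single ρ]
    · rw [Pi.single_eq_same]
    · intro ρ' _ h
      rw [Pi.single_eq_of_ne (fun h' => h (DFunLike.coe_injective h').symm)]
    · simp
  · rw [permExt_of_not_bijective _ hw, Finset.sum_eq_zero]
    · simp
    · intro ρ _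
      rw [Pi.single_eq_of_ne]
      rintro rfl
      exact hw ρ.bijective

lemma BBar_permEquiv (j : Finset.Icc 1 N) (n : ℕ) (τ : Equiv.Perm (Fin N)) :
    BBar j n (permEquiv N (Pi.single τ 1))
      = permEquiv N (fun ρ => PowerSeries.coeff n ((betheEntry τ ρ).coeff (N - j))) :=
  Subtype.ext (action_B_permEquiv τ (N - j) n)

lemma commute_BBar_polyMulOne (j : Finset.Icc 1 N) (n : ℕ) (p : PolyZL N) :
    Commute (BBar j n) (polyMulOne N p) := commute_betheRep_polyMulOne _ p

lemma natDegree_lamFactor_le (i : Fin N) : (lamFactor i).natDegree ≤ 1 :=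
  Polynomial.natDegree_X_sub_C_le _

lemma natDegree_entryFactor_le (τ ρ : Equiv.Perm (Fin N)) (k : Fin N) :
    ((if ρ k = τ k then lamFactor (τ k) else 0) - Polynomial.C (zPole k)).natDegree ≤ 1 := by
  rw [Polynomial.natDegree_sub_C]
  split_ifs
  · exact natDegree_lamFactor_le _
  · simp

lemma betheEntry_coeff_top (τ ρ : Equiv.Perm (Fin N)) :
    (betheEntry τ ρ).coeff N = if ρ = τ then 1 else 0 := by
  rw [betheEntry, Polynomial.coeff_smul]
  have h := Polynomial.coeff_prod_of_natDegree_le (s := Finset.univ)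
    (fun k => (if ρ k = τ k then lamFactor (τ k) else 0) - Polynomial.C (zPole k)) 1
    fun k _ => natDegree_entryFactor_le τ ρ k
  rw [Finset.card_univ, Fintype.card_fin, mul_one] at h
  rw [h]
  have h1 : ∀ k, ((if ρ k = τ k then lamFactor (τ k) else 0) - Polynomial.C (zPole k)).coeff 1
      = if ρ k = τ k then 1 else 0 := by
    intro k
    rw [Polynomial.coeff_sub, Polynomial.coeff_C_succ, sub_zero]
    split_ifs
    · simp [lamFactor, Polynomial.coeff_X_one]
    · simp
  simp only [h1]
  split_ifs with hρ
  · subst hρ; simp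
  · obtain ⟨k, hk⟩ : ∃ k, ρ k ≠ τ k := by
      by_contra hne
      push Not at hne
      exact hρ (Equiv.ext hne)
    rw [Finset.prod_eq_zero (Finset.mem_univ k) (if_neg hk), smul_zero]

/-- Two different permutations differ in at least two places. An off-diagonal entry therefore has
degree at most `N - 2` in `∂`, and only the diagonal contributes here, by Vieta's formula. -/
lemma betheEntry_coeff_next (hN : 1 ≤ N) (τ ρ : Equiv.Perm (Fin N)) :
    (betheEntry τ ρ).coeff (N - 1) = if ρ = τ then
      -∑ k, (PowerSeries.C (MvPolynomial.X (Sum.inr (τ k))) + zPole k) else 0 := by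
  rw [betheEntry, Polynomial.coeff_smul]
  split_ifs with hρ
  · subst hρ
    have : ∀ k, (if ρ k = ρ k then lamFactor (ρ k) else 0) - Polynomial.C (zPole k)
        = Polynomial.X - Polynomial.C (PowerSeries.C (MvPolynomial.X (Sum.inr (ρ k))) + zPole k) := by
      intro k
      rw [if_pos rfl, lamFactor, map_add]
      ring
    rw [Finset.prod_congr rfl fun k _ => this k]
    have h := Polynomial.prod_X_sub_C_coeff_card_pred (Finset.univ : Finset (Fin N))
      (fun k => PowerSeries.C (MvPolynomial.X (Sum.inr (ρ k))) + zPole k) (by simpa [Nat.pos_iff_ne_zero] using Nat.one_le_iff_ne_zero.mp hN)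
    rw [Finset.card_univ, Fintype.card_fin] at h
    rw [h]
    simp
  · obtain ⟨k, hk⟩ : ∃ k, ρ k ≠ τ k := by
      by_contra hne
      push Not at hne
      exact hρ (Equiv.ext hne)
    -- If `k` were the only place of disagreement, the site where `ρ` takes the value `τ k` would
    -- contradict injectivity.
    obtain ⟨l, hl, hlk⟩ : ∃ l, ρ l ≠ τ l ∧ l ≠ k := by
      by_contra hne
      push Not at hne
      obtain ⟨l, hl⟩ := ρ.surjective (τ k)
      by_cases h1 : ρ l = τ l
      · exact hk (by rw [h1] at hl; rw [← τ.injective hl, h1])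
      · exact h1 (by rw [hl, hne l h1])
    have hmem : l ∈ Finset.univ.erase k := Finset.mem_erase.mpr ⟨hlk, Finset.mem_univ _⟩
    rw [Polynomial.coeff_eq_zero_of_natDegree_lt, smul_zero]
    rw [← Finset.mul_prod_erase _ _ (Finset.mem_univ k), ← Finset.mul_prod_erase _ _ hmem,
      if_neg hk, if_neg hl, zero_sub, zero_sub]
    have hc : ((Finset.univ.erase k).erase l).card = N - 2 := by
      rw [Finset.card_erase_of_mem hmem, Finset.card_erase_of_mem (Finset.mem_univ k)]
      simp
      omega
    have hN2 : 2 ≤ N := by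
      have := k.2; have := l.2
      have : (l : ℕ) ≠ k := fun h => hlk (Fin.ext h)
      omega
    have hd := Polynomial.natDegree_prod_le ((Finset.univ.erase k).erase l)
      (fun k => (if ρ k = τ k then lamFactor (τ k) else 0) - Polynomial.C (zPole k))
    have hd2 := hd.trans (Finset.sum_le_card_nsmul _ _ 1 fun k _ => natDegree_entryFactor_le τ ρ k)
    rw [hc, smul_eq_mul, mul_one] at hd2
    have := Polynomial.natDegree_C_mul_le (-zPole k) (Polynomial.C (-zPole l) *
      ∏ x ∈ (Finset.univ.erase k).erase l,
        ((if ρ x = τ x then lamFactor (τ x) else 0) - Polynomial.C (zPole x)))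
    have := Polynomial.natDegree_C_mul_le (-zPole l) (
      ∏ x ∈ (Finset.univ.erase k).erase l,
        ((if ρ x = τ x then lamFactor (τ x) else 0) - Polynomial.C (zPole x)))
    rw [← Polynomial.C_neg, ← Polynomial.C_neg]
    omega

/-- `∏ₖ (1 - z_k u⁻¹)`. -/
def zSeries (N : ℕ) : PowerSeries (PolyZL N) :=
  ∏ k : Fin N, (1 - PowerSeries.C (MvPolynomial.X (Sum.inl k)) * PowerSeries.X)

/-- The matrix entries of the universal Bethe polynomial on `𝒱₁`. -/
def betheCoeff (τ ρ : Equiv.Perm (Fin N)) (a b : ℕ) : PolyZL N :=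
  ((Equiv.Perm.sign (ρ * τ⁻¹) : ℤˣ) : ℤ) •
    ((∏ k, pairFactor (ρ k = τ k) (MvPolynomial.X (Sum.inr (τ k)) : PolyZL N)
      (MvPolynomial.X (Sum.inl k))).coeff a).coeff b

/-- Each `1 - z_k u⁻¹` clears one pole and leaves `(v - λ)(1 - z_k u⁻¹) - u⁻¹` or `-u⁻¹`, which is
`u⁻¹` times a polynomial factor. The product is thus `u⁻ᴺ` times a polynomial of degree at most `N`
in `u`, and the coefficient of `u⁻ⁱ` is read off at `u^{N-i}`. -/
lemma zSeries_mul_betheEntry (τ ρ : Equiv.Perm (Fin N)) (a i : ℕ) :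
    PowerSeries.coeff i (zSeries N * (betheEntry τ ρ).coeff a)
      = if i ≤ N then betheCoeff τ ρ a (N - i) else 0 := by
  have h1 : Polynomial.C (zSeries N) * betheEntry τ ρ = ((Equiv.Perm.sign (ρ * τ⁻¹) : ℤˣ) : ℤ) •
      Polynomial.map Polynomial.coeToPowerSeries.ringHom
        (∏ k, pairFactorInv (ρ k = τ k) (MvPolynomial.X (Sum.inr (τ k)) : PolyZL N)
          (MvPolynomial.X (Sum.inl k))) := by
    rw [betheEntry, mul_smul_comm, Polynomial.map_prod, zSeries, map_prod,
      ← Finset.prod_mul_distrib]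
    congr 1
    refine Finset.prod_congr rfl fun k _ => ?_
    have e1 : Polynomial.C (1 - PowerSeries.C (MvPolynomial.X (Sum.inl k) : PolyZL N)
        * PowerSeries.X) * Polynomial.C (zPole k) = Polynomial.C PowerSeries.X := by
      rw [← Polynomial.C_mul, zPole, one_sub_mul_poleSeries]
    rw [mul_sub, e1, pairFactorInv]
    split_ifs
    · simp [lamFactor, Polynomial.coeToPowerSeries.ringHom_apply]
      ring
    · simp [Polynomial.coeToPowerSeries.ringHom_apply]
  have h2 : zSeries N * (betheEntry τ ρ).coeff a
      = (Polynomial.C (zSeries N) * betheEntry τ ρ).coeff a := by rw [Polynomial.coeff_C_mul]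
  have h3 := InnerReflect.prod Finset.univ 1 (fun k _ => innerReflect_pairFactor (ρ k = τ k)
    (MvPolynomial.X (Sum.inr (τ k)) : PolyZL N) (MvPolynomial.X (Sum.inl k))) a
  rw [Finset.card_univ, Fintype.card_fin, mul_one] at h3
  rw [h2, h1, Polynomial.coeff_smul, Polynomial.coeff_map, map_zsmul,
    Polynomial.coeToPowerSeries.ringHom_apply, Polynomial.coeff_coe, h3.2, Polynomial.coeff_reflect,
    betheCoeff]
  split_ifs with hi
  · rw [Polynomial.revAt_le hi]
  -- Beyond `N` the reflection leaves the exponent unchanged, and the coefficient vanishes by the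
  -- degree bound in `h3`.
  · rw [Polynomial.revAt_eq_self_of_lt (by omega), Polynomial.coeff_eq_zero_of_natDegree_lt,
      smul_zero]
    omega

end PermModel

end BetheCherednik

end

noncomputable section

namespace BetheCherednik

/-! ### The elements `b̄_{ij}` lie in the image of the Bethe algebra and generate it -/

section Generators

variable {N : ℕ}

/-- The coefficients of `D^B` on `𝒱₁`, as power series in `u⁻¹`. -/
def betheSeries (N j : ℕ) : PowerSeries (Module.End ℂ (VOne N)) :=
  if h : j ∈ Finset.Icc 1 N then PowerSeries.mk (BBar ⟨j, h⟩) else 1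

lemma bethePoly_coeff {j : ℕ} (hj : j ≤ N) :
    (bethePoly N).coeff (N - j)
      = PowerSeries.map (polyMulOne N : PolyZL N →+* Module.End ℂ (VOne N)) (zSeries N)
        * betheSeries N j := by
  rw [bethePoly, Polynomial.coeff_C_mul]
  congr 1
  rw [Polynomial.coeff_add, Polynomial.coeff_X_pow, Polynomial.finsetSum_coeff]
  simp only [Polynomial.coeff_C_mul, Polynomial.coeff_X_pow]
  unfold betheSeries
  split_ifs with h1 h2 h2
  · have := Finset.mem_Icc.mp h2
    omega
  · rw [Finset.sum_eq_zero, add_zero]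
    intro i _
    have := Finset.mem_Icc.mp i.2
    rw [if_neg (by omega), mul_zero]
  · rw [zero_add, Finset.sum_eq_single ⟨j, h2⟩, if_pos rfl, mul_one]
    · intro i _ hi
      have := Finset.mem_Icc.mp i.2
      have hne : (i : ℕ) ≠ j := fun h => hi (Subtype.ext h)
      rw [if_neg (by omega), mul_zero]
    · simp
  · exfalso
    rw [Finset.mem_Icc] at h2
    omega

lemma coeff_betheSeries_permEquiv {j : ℕ} (hj : j ≤ N) (n : ℕ) (τ : Equiv.Perm (Fin N)) :
    PowerSeries.coeff n (betheSeries N j) (permEquiv N (Pi.single τ 1))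
      = permEquiv N (fun ρ => PowerSeries.coeff n ((betheEntry τ ρ).coeff (N - j))) := by
  unfold betheSeries
  split_ifs with h
  · rw [PowerSeries.coeff_mk, BBar_permEquiv]
  · have hj0 : j = 0 := by
      rw [Finset.mem_Icc] at h
      omega
    subst hj0
    simp only [Nat.sub_zero, betheEntry_coeff_top]
    have : (fun ρ : Equiv.Perm (Fin N) => PowerSeries.coeff n
        (if ρ = τ then (1 : PowerSeries (PolyZL N)) else 0))
        = if n = 0 then Pi.single τ 1 else 0 := by
      funext ρ
      by_cases h1 : ρ = τ
      · subst h1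
        rw [if_pos rfl, PowerSeries.coeff_one]
        split_ifs <;> simp
      · rw [if_neg h1]
        split_ifs <;> simp [h1]
    rw [this, PowerSeries.coeff_one]
    split_ifs <;> simp

lemma commute_coeff_betheSeries (j n : ℕ) (p : PolyZL N) :
    Commute (PowerSeries.coeff n (betheSeries N j)) (polyMulOne N p) := by
  unfold betheSeries
  split_ifs with h
  · rw [PowerSeries.coeff_mk]
    exact commute_BBar_polyMulOne _ _ p
  · rw [PowerSeries.coeff_one]
    split_ifs
    · exact Commute.one_left _
    · exact Commute.zero_left _

lemma commute_polyMulOne (p q : PolyZL N) : Commute (polyMulOne N p) (polyMulOne N q) := by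
  rw [Commute, SemiconjBy, ← map_mul, ← map_mul, mul_comm]

/-- The coefficient of `u^{-n} v^{N-j}` in the universal Bethe polynomial, for all `n`. -/
def betheCoeffOp (N n j : ℕ) : Module.End ℂ (VOne N) :=
  PowerSeries.coeff n (PowerSeries.map (polyMulOne N : PolyZL N →+* Module.End ℂ (VOne N))
    (zSeries N) * betheSeries N j)

lemma betheCoeffOp_eq (n j : ℕ) : betheCoeffOp N n j = ∑ p ∈ Finset.HasAntidiagonal.antidiagonal n,
    polyMulOne N (PowerSeries.coeff p.1 (zSeries N)) * PowerSeries.coeff p.2 (betheSeries N j) := by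
  rw [betheCoeffOp, PowerSeries.coeff_mul]
  rfl

lemma bBar_eq (i j : Fin (N + 1)) : bBar N i j = betheCoeffOp N i j := by
  rw [bBar, bethePoly_coeff (Nat.lt_succ_iff.mp j.2), betheCoeffOp]

lemma commute_betheCoeffOp (n j : ℕ) (p : PolyZL N) :
    Commute (betheCoeffOp N n j) (polyMulOne N p) := by
  rw [betheCoeffOp_eq]
  exact Commute.sum_left _ _ _ fun x _ =>
    (commute_polyMulOne _ _).mul_left (commute_coeff_betheSeries _ _ _)

lemma betheCoeffOp_permEquiv {j : ℕ} (hj : j ≤ N) (n : ℕ) (τ : Equiv.Perm (Fin N)) :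
    betheCoeffOp N n j (permEquiv N (Pi.single τ 1))
      = permEquiv N fun ρ => if n ≤ N then betheCoeff τ ρ (N - j) (N - n) else 0 := by
  simp only [← zSeries_mul_betheEntry, betheCoeffOp_eq, LinearMap.sum_apply, Module.End.mul_apply,
    coeff_betheSeries_permEquiv hj, polyMulOne_permEquiv, PowerSeries.coeff_mul]
  rw [← map_sum]
  congr 1
  funext ρ
  rw [Finset.sum_apply]
  rfl

lemma betheCoeffOp_eq_zero {j : ℕ} (hj : j ≤ N) {n : ℕ} (hn : N < n) : betheCoeffOp N n j = 0 := by
  refine end_VOne_ext (commute_betheCoeffOp n j) (fun p => Commute.zero_left _) fun τ => ?_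
  rw [betheCoeffOp_permEquiv hj, LinearMap.zero_apply, ← map_zero (permEquiv N)]
  congr 1
  funext ρ
  rw [if_neg (by omega)]
  rfl

lemma bBar_permEquiv (i j : Fin (N + 1)) (τ : Equiv.Perm (Fin N)) :
    bBar N i j (permEquiv N (Pi.single τ 1))
      = permEquiv N fun ρ => betheCoeff τ ρ (N - j) (N - i) := by
  rw [bBar_eq, betheCoeffOp_permEquiv (Nat.lt_succ_iff.mp j.2)]
  simp only [if_pos (Nat.lt_succ_iff.mp i.2)]

lemma commute_bBar (i j : Fin (N + 1)) (p : PolyZL N) :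
    Commute (bBar N i j) (polyMulOne N p) := by
  rw [bBar_eq]
  exact commute_betheCoeffOp _ _ p

lemma betheImage_eq_adjoin : betheImage N = Algebra.adjoin ℂ
    {T | ∃ (j : Finset.Icc 1 N) (n : ℕ), T = BBar j n} := by
  have h : (⊤ : Subalgebra ℂ (betheAlgebra N)) = Algebra.adjoin ℂ
      ((fun b : betheAlgebra N => (b : UCurrent N)) ⁻¹'
        {b | ∃ i j : ℕ, 1 ≤ i ∧ i ≤ N ∧ b = B i j}) :=
    (Algebra.adjoin_adjoin_coe_preimage (R := ℂ)).symm
  rw [betheImage, ← Algebra.map_top, h, AlgHom.map_adjoin]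
  congr 1
  ext T
  constructor
  · rintro ⟨⟨b, hb⟩, ⟨i, j, h1, h2, rfl⟩, rfl⟩
    exact ⟨⟨i, Finset.mem_Icc.mpr ⟨h1, h2⟩⟩, j, rfl⟩
  · rintro ⟨j, n, rfl⟩
    exact ⟨_, ⟨j, n, (Finset.mem_Icc.mp j.2).1, (Finset.mem_Icc.mp j.2).2, rfl⟩, rfl⟩

lemma BBar_mem_betheImage (j : Finset.Icc 1 N) (n : ℕ) : BBar j n ∈ betheImage N := ⟨_, rfl⟩

lemma coeff_betheSeries_mem (j n : ℕ) : PowerSeries.coeff n (betheSeries N j) ∈ betheImage N := by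
  unfold betheSeries
  split_ifs with h
  · rw [PowerSeries.coeff_mk]
    exact BBar_mem_betheImage _ n
  · rw [PowerSeries.coeff_one]
    split_ifs
    · exact one_mem _
    · exact zero_mem _

/-- The operators `B̄_{1,j}` are scalar: their generating series is `-∑_k (λ_k + 1/(u - z_k))`. The
coefficient of `u^{-n-1}` is free of `λ` and equals minus the `n`-th power sum of the `z_k`. -/
lemma psum_mem_betheImage (hN : 1 ≤ N) (n : ℕ) :
    polyMulOne N (MvPolynomial.rename Sum.inl (MvPolynomial.psum (Fin N) ℂ n)) ∈ betheImage N := by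
  have h : polyMulOne N (MvPolynomial.rename Sum.inl (MvPolynomial.psum (Fin N) ℂ n))
      = (-1 : ℂ) • PowerSeries.coeff (n + 1) (betheSeries N 1) := by
    refine end_VOne_ext (commute_polyMulOne _)
      (fun p => (commute_coeff_betheSeries _ _ p).smul_left _) fun τ => ?_
    rw [LinearMap.smul_apply, coeff_betheSeries_permEquiv hN, polyMulOne_permEquiv, ← map_smul]
    refine congrArg _ (funext fun ρ => ?_)
    simp only [Pi.smul_apply, betheEntry_coeff_next hN, neg_smul, one_smul]
    by_cases h1 : ρ = τ
    · subst h1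
      rw [if_pos rfl, Pi.single_eq_same, map_neg, neg_neg, map_sum, smul_eq_mul, mul_one,
        MvPolynomial.psum, map_sum]
      refine Finset.sum_congr rfl fun k _ => ?_
      rw [map_add, PowerSeries.coeff_C, if_neg (by omega), zero_add, zPole, poleSeries,
        PowerSeries.coeff_mk]
      simp
    · rw [if_neg h1, Pi.single_eq_of_ne h1]
      simp
  rw [h]
  exact Subalgebra.smul_mem _ (coeff_betheSeries_mem _ _) _

/-- Newton's identities express `n e_n` through power sums and lower elementary symmetric
polynomials, and `n` is invertible in `ℂ`. For `N = 0` there is no operator `B̄_{1,j}`, but then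
`e_n = 0` for `n > 0`. -/
lemma esymm_mem_betheImage (n : ℕ) :
    polyMulOne N (MvPolynomial.rename Sum.inl (MvPolynomial.esymm (Fin N) ℂ n)) ∈ betheImage N := by
  let S : Subalgebra ℂ (MvPolynomial (Fin N) ℂ) :=
    (betheImage N).comap ((polyMulOne N).comp (MvPolynomial.rename Sum.inl))
  change MvPolynomial.esymm (Fin N) ℂ n ∈ S
  induction n using Nat.strong_induction_on with
  | _ n ih =>
    rcases Nat.eq_zero_or_pos n with rfl | hn
    · rw [MvPolynomial.esymm_zero]; exact one_mem _
    rcases Nat.eq_zero_or_pos N with rfl | hN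
    · have : MvPolynomial.esymm (Fin 0) ℂ n = 0 := by
        rw [MvPolynomial.esymm, Finset.powersetCard_eq_empty.mpr (by simpa using hn),
          Finset.sum_empty]
      rw [this]; exact zero_mem _
    have h := MvPolynomial.mul_esymm_eq_sum (Fin N) ℂ n
    have hn' : (n : ℂ) ≠ 0 := by exact_mod_cast hn.ne'
    have h2 : MvPolynomial.esymm (Fin N) ℂ n
        = (n : ℂ)⁻¹ • ((n : MvPolynomial (Fin N) ℂ) * MvPolynomial.esymm (Fin N) ℂ n) := by
      rw [← nsmul_eq_mul, ← Nat.cast_smul_eq_nsmul ℂ, smul_smul, inv_mul_cancel₀ hn', one_smul]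
    rw [h2, h]
    refine S.smul_mem (mul_mem (pow_mem (neg_mem (one_mem _)) _) (sum_mem fun a ha => ?_)) _
    rw [Finset.mem_filter] at ha
    exact mul_mem (mul_mem (pow_mem (neg_mem (one_mem _)) _) (ih _ ha.2))
      (psum_mem_betheImage hN a.2)

lemma coeff_zSeries (n : ℕ) : PowerSeries.coeff n (zSeries N)
    = (-1) ^ n * MvPolynomial.rename Sum.inl (MvPolynomial.esymm (Fin N) ℂ n) := by
  have h := Finset.prod_one_add (s := (Finset.univ : Finset (Fin N)))
    (f := fun k => -(PowerSeries.C (MvPolynomial.X (Sum.inl k) : PolyZL N) * PowerSeries.X))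
  have h2 : zSeries N = ∏ k : Fin N,
      (1 + -(PowerSeries.C (MvPolynomial.X (Sum.inl k) : PolyZL N) * PowerSeries.X)) := by
    simp only [zSeries, sub_eq_add_neg]
  have h3 : ∀ t : Finset (Fin N),
      ∏ k ∈ t, -(PowerSeries.C (MvPolynomial.X (Sum.inl k) : PolyZL N) * PowerSeries.X)
        = PowerSeries.C ((-1) ^ t.card * ∏ k ∈ t, MvPolynomial.X (Sum.inl k))
          * PowerSeries.X ^ t.card := by
    intro t
    rw [Finset.prod_neg, Finset.prod_mul_distrib, Finset.prod_const, map_mul, map_prod]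
    simp [mul_assoc]
  rw [h2, h, map_sum, MvPolynomial.esymm, map_sum, Finset.mul_sum, Finset.powersetCard_eq_filter,
    Finset.sum_filter]
  refine Finset.sum_congr rfl fun t _ => ?_
  rw [h3, PowerSeries.coeff_C_mul, PowerSeries.coeff_X_pow]
  by_cases h4 : t.card = n
  · rw [if_pos h4.symm, if_pos h4, h4, mul_one, map_prod]
    simp
  · rw [if_neg (Ne.symm h4), if_neg h4, mul_zero]

lemma zSeries_mem_betheImage (n : ℕ) :
    polyMulOne N (PowerSeries.coeff n (zSeries N)) ∈ betheImage N := by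
  have h : PowerSeries.coeff n (zSeries N)
      = MvPolynomial.rename Sum.inl (((-1) ^ n : ℂ) • MvPolynomial.esymm (Fin N) ℂ n) := by
    rw [coeff_zSeries, map_smul, Algebra.smul_def]
    simp
  rw [h, map_smul, map_smul]
  exact Subalgebra.smul_mem _ (esymm_mem_betheImage n) _

lemma betheCoeffOp_mem (n j : ℕ) : betheCoeffOp N n j ∈ betheImage N := by
  rw [betheCoeffOp_eq]
  exact sum_mem fun p _ => mul_mem (zSeries_mem_betheImage _) (coeff_betheSeries_mem _ _)

lemma bBar_mem (i j : Fin (N + 1)) : bBar N i j ∈ betheImage N := by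
  rw [bBar_eq]
  exact betheCoeffOp_mem _ _

lemma add_add_neg_one_smul {W : Type*} [AddCommMonoid W] [Module ℂ W] (x s : W) :
    x + s + (-1 : ℂ) • s = x := by
  have : s + (-1 : ℂ) • s = 0 := by
    calc s + (-1 : ℂ) • s = (1 : ℂ) • s + (-1 : ℂ) • s := by rw [one_smul]
      _ = 0 := by rw [← add_smul]; simp
  rw [add_assoc, this, add_zero]

/-- The Bethe algebra on `𝒱₁` is generated by the coefficients of the universal Bethe polynomial. -/
lemma betheImage_eq_adjoin_bBar :
    betheImage N = Algebra.adjoin ℂ (Set.range fun p : Fin (N + 1) × Fin (N + 1) =>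
      bBar N p.1 p.2) := by
  set S := Algebra.adjoin ℂ (Set.range fun p : Fin (N + 1) × Fin (N + 1) => bBar N p.1 p.2) with hS
  refine le_antisymm ?_ (Algebra.adjoin_le ?_)
  · have h1 : ∀ n j : ℕ, j ≤ N → betheCoeffOp N n j ∈ S := by
      intro n j hj
      by_cases hn : n ≤ N
      · refine Algebra.subset_adjoin ⟨(⟨n, by omega⟩, ⟨j, by omega⟩), ?_⟩
        exact bBar_eq _ _
      · rw [betheCoeffOp_eq_zero hj (by omega)]
        exact zero_mem _
    -- The coefficient of `v^N` in the universal Bethe polynomial is `∏ (1 - z_k u⁻¹)` itself.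
    have h2 : ∀ n, polyMulOne N (PowerSeries.coeff n (zSeries N)) ∈ S := by
      intro n
      have h3 : betheCoeffOp N n 0 = polyMulOne N (PowerSeries.coeff n (zSeries N)) := by
        rw [betheCoeffOp, betheSeries, dif_neg (by simp), mul_one]
        rfl
      rw [← h3]
      exact h1 n 0 (Nat.zero_le _)
    -- Division by `∏ (1 - z_k u⁻¹)`: its constant coefficient is `1`, so the coefficients of the
    -- quotient are found recursively.
    have h4 : ∀ j, j ≤ N → ∀ n, PowerSeries.coeff n (betheSeries N j) ∈ S := by
      intro j hj n
      induction n using Nat.strong_induction_on with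
      | _ n ih =>
        have h5 := betheCoeffOp_eq (N := N) n j
        have h0 : (0, n) ∈ Finset.HasAntidiagonal.antidiagonal n := by simp
        rw [← Finset.add_sum_erase _ _ h0] at h5
        have h6 : PowerSeries.coeff 0 (zSeries N) = 1 := by
          rw [coeff_zSeries]; simp
        simp only [h6, map_one, one_mul] at h5
        rw [← add_add_neg_one_smul (PowerSeries.coeff n (betheSeries N j)), ← h5]
        refine add_mem (h1 n j hj) (S.smul_mem (sum_mem fun p hp => mul_mem (h2 _) (ih _ ?_)) _)
        rw [Finset.mem_erase, Finset.HasAntidiagonal.mem_antidiagonal] at hp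
        rcases Nat.eq_zero_or_pos p.1 with h | h
        · exact absurd (Prod.ext h (by simp; omega)) hp.1
        · omega
    rw [betheImage_eq_adjoin]
    refine Algebra.adjoin_le ?_
    rintro _ ⟨j, n, rfl⟩
    have := h4 j (Finset.mem_Icc.mp j.2).2 n
    rw [betheSeries, dif_pos j.2, PowerSeries.coeff_mk] at this
    exact this
  · rintro _ ⟨p, rfl⟩
    exact bBar_mem _ _

end Generators

end BetheCherednik

end

noncomputable section

namespace BetheCherednik

/-! ### Polynomials in commuting elements of an algebra -/

section PolyHom

variable {R : Type*} [Ring R] [Algebra ℂ R] {n : ℕ}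

/-- Evaluation of polynomials at a commuting family of elements. -/
def polyHom (g : Fin n → R) (hg : ∀ i j, g i * g j = g j * g i) :
    MvPolynomial (Fin n) ℂ →ₐ[ℂ] R :=
  -- Evaluation of polynomials needs a commutative target; the subalgebra generated by the commuting
  -- elements is one.
  letI : CommRing (Algebra.adjoin ℂ (Set.range g)) :=
    { (inferInstance : Ring (Algebra.adjoin ℂ (Set.range g))) with
      mul_comm := (Algebra.isMulCommutative_adjoin ℂ (s := Set.range g) (by
        rintro _ ⟨i, rfl⟩ _ ⟨j, rfl⟩; exact hg i j)).is_comm.comm }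
  (Algebra.adjoin ℂ (Set.range g)).val.comp
    (MvPolynomial.aeval fun i => ⟨g i, Algebra.subset_adjoin ⟨i, rfl⟩⟩)

lemma polyHom_X (g : Fin n → R) (hg) (i : Fin n) : polyHom g hg (MvPolynomial.X i) = g i := by
  simp [polyHom]

lemma polyHom_monomial (g : Fin n → R) (hg) (m : Fin n →₀ ℕ) :
    polyHom g hg (MvPolynomial.monomial m 1) = (List.ofFn fun i => g i ^ m i).prod := by
  have h1 : (MvPolynomial.monomial m 1 : MvPolynomial (Fin n) ℂ)
      = (List.ofFn fun i => MvPolynomial.X i ^ m i).prod := by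
    rw [List.prod_ofFn, MvPolynomial.monomial_eq, map_one, one_mul,
      Finsupp.prod_fintype _ _ (fun i => pow_zero _)]
  rw [h1, map_list_prod, List.map_ofFn]
  congr 2
  funext i
  simp [polyHom_X]

end PolyHom

/-! ### The relations of the Cherednik algebra -/

section Relations

variable {N : ℕ}

lemma xH_mul_comm (i j : Fin N) : (xH i * xH j : Cherednik N) = xH j * xH i := by
  by_cases h : i = j
  · rw [h]
  · have := RingQuot.mkAlgHom_rel ℂ (CherednikRel.x_comm i j h)
    rw [map_sub, map_mul, map_mul, map_zero, sub_eq_zero] at this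
    exact this

lemma yH_mul_comm (i j : Fin N) : (yH i * yH j : Cherednik N) = yH j * yH i := by
  by_cases h : i = j
  · rw [h]
  · have := RingQuot.mkAlgHom_rel ℂ (CherednikRel.y_comm i j h)
    rw [map_sub, map_mul, map_mul, map_zero, sub_eq_zero] at this
    exact this

lemma sH_mul_xH (i j k : Fin N) : (sH i j * xH k : Cherednik N) = xH (Equiv.swap i j k) * sH i j := by
  by_cases h : i = j
  · subst h; simp [sH_self]
  by_cases hki : k = i
  · subst hki
    rw [Equiv.swap_apply_left, sH, dif_pos h, xH, xH, ← map_mul, ← map_mul]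
    exact RingQuot.mkAlgHom_rel ℂ (CherednikRel.s_x k j h)
  by_cases hkj : k = j
  · subst hkj
    rw [Equiv.swap_apply_right, sH_symm, sH, dif_pos (Ne.symm h), xH, xH, ← map_mul, ← map_mul]
    exact RingQuot.mkAlgHom_rel ℂ (CherednikRel.s_x k i (Ne.symm h))
  · rw [Equiv.swap_apply_of_ne_of_ne hki hkj, sH, dif_pos h]
    have := RingQuot.mkAlgHom_rel ℂ (CherednikRel.s_x_comm i j k h hki hkj)
    rw [map_sub, map_mul, map_mul, map_zero, sub_eq_zero] at this
    exact this

lemma sH_mul_yH (i j k : Fin N) : (sH i j * yH k : Cherednik N) = yH (Equiv.swap i j k) * sH i j := by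
  by_cases h : i = j
  · subst h; simp [sH_self]
  by_cases hki : k = i
  · subst hki
    rw [Equiv.swap_apply_left, sH, dif_pos h, yH, yH, ← map_mul, ← map_mul]
    exact RingQuot.mkAlgHom_rel ℂ (CherednikRel.s_y k j h)
  by_cases hkj : k = j
  · subst hkj
    rw [Equiv.swap_apply_right, sH_symm, sH, dif_pos (Ne.symm h), yH, yH, ← map_mul, ← map_mul]
    exact RingQuot.mkAlgHom_rel ℂ (CherednikRel.s_y k i (Ne.symm h))
  · rw [Equiv.swap_apply_of_ne_of_ne hki hkj, sH, dif_pos h]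
    have := RingQuot.mkAlgHom_rel ℂ (CherednikRel.s_y_comm i j k h hki hkj)
    rw [map_sub, map_mul, map_mul, map_zero, sub_eq_zero] at this
    exact this

lemma permH_mul_xH (σ : Equiv.Perm (Fin N)) (k : Fin N) :
    permH N σ * xH k = xH (σ k) * permH N σ := by
  induction σ using Equiv.Perm.swap_induction_on generalizing k with
  | one => simp
  | swap_mul f a b _ ih =>
    rw [map_mul, mul_assoc, ih, ← mul_assoc, permH_swap, sH_mul_xH, mul_assoc]
    rfl

lemma permH_mul_yH (σ : Equiv.Perm (Fin N)) (k : Fin N) :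
    permH N σ * yH k = yH (σ k) * permH N σ := by
  induction σ using Equiv.Perm.swap_induction_on generalizing k with
  | one => simp
  | swap_mul f a b _ ih =>
    rw [map_mul, mul_assoc, ih, ← mul_assoc, permH_swap, sH_mul_yH, mul_assoc]
    rfl

lemma xH_mul_yH (i j : Fin N) (h : i ≠ j) :
    (xH i * yH j : Cherednik N) = yH j * xH i + permH N (Equiv.swap i j) := by
  have := RingQuot.mkAlgHom_rel ℂ (CherednikRel.x_y i j h)
  rw [map_sub, map_mul, map_mul, sub_eq_iff_eq_add'] at this
  rw [permH_swap, sH, dif_pos h]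
  exact this

lemma xH_mul_yH_self (i : Fin N) : (xH i * yH i : Cherednik N)
    = yH i * xH i - ∑ a ∈ Finset.univ.erase i, permH N (Equiv.swap i a) := by
  have := RingQuot.mkAlgHom_rel ℂ (CherednikRel.x_y_self i)
  rw [map_sub, map_mul, map_mul, sub_eq_iff_eq_add', map_neg, map_sum, ← sub_eq_add_neg] at this
  refine this.trans ?_
  congr 1
  rw [Finset.sum_subtype (Finset.univ.erase i) (p := fun a => a ≠ i) (by simp)
    (fun a => permH N (Equiv.swap i a))]
  refine Finset.sum_congr rfl fun a _ => ?_
  rw [permH_swap, sH, dif_pos a.2.symm]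

/-- An induction principle for the Cherednik algebra. -/
lemma cherednik_induction {P : Cherednik N → Prop} (hx : ∀ i, P (xH i)) (hy : ∀ i, P (yH i))
    (hs : ∀ i j, P (sH i j)) (hc : ∀ r : ℂ, P (algebraMap ℂ _ r))
    (hadd : ∀ a b, P a → P b → P (a + b)) (hmul : ∀ a b, P a → P b → P (a * b))
    (h : Cherednik N) : P h := by
  obtain ⟨a, rfl⟩ := RingQuot.mkAlgHom_surjective ℂ (CherednikRel N) h
  induction a using FreeAlgebra.induction with
  | grade0 r => rw [AlgHom.commutes]; exact hc r
  | grade1 g =>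
    cases g with
    | x i => exact hx i
    | y i => exact hy i
    | s j k hjk =>
      have := hs j k
      rw [sH, dif_pos hjk] at this
      exact this
  | mul a b ha hb => rw [map_mul]; exact hmul _ _ ha hb
  | add a b ha hb => rw [map_add]; exact hadd _ _ ha hb

open MulOpposite in
/-- The antiautomorphism of `H_N` that exchanges `x_i` and `y_i` and fixes the `s_{ij}`. -/
def antiFlip (N : ℕ) : Cherednik N →ₐ[ℂ] (Cherednik N)ᵐᵒᵖ :=
  RingQuot.liftAlgHom ℂ ⟨FreeAlgebra.lift ℂ fun g : Gen N =>
    match g with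
    | .x i => op (yH i)
    | .y i => op (xH i)
    | .s j k _ => op (sH j k), by
  intro a b hab
  have lx : ∀ i, FreeAlgebra.lift ℂ (fun g : Gen N =>
    match g with
    | .x i => op (yH i)
    | .y i => op (xH i)
    | .s j k _ => op (sH j k)) (Free.x i) = op (yH i) := fun i => FreeAlgebra.lift_ι_apply _ _
  have ly : ∀ i, FreeAlgebra.lift ℂ (fun g : Gen N =>
    match g with
    | .x i => op (yH i)
    | .y i => op (xH i)
    | .s j k _ => op (sH j k)) (Free.y i) = op (xH i) := fun i => FreeAlgebra.lift_ι_apply _ _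
  have ls : ∀ j k h, FreeAlgebra.lift ℂ (fun g : Gen N =>
    match g with
    | .x i => op (yH i)
    | .y i => op (xH i)
    | .s j k _ => op (sH j k)) (Free.s j k h) = op (sH j k) :=
    fun j k h => FreeAlgebra.lift_ι_apply _ _
  cases hab with
  | s_symm i j h => rw [ls, ls, sH_symm]
  | s_sq i j h => rw [map_mul, ls, ← op_mul, sH_sq, map_one, op_one]
  | s_braid i j k hij hjk hik =>
    rw [map_mul, map_mul, ls, ls, ls, ← op_mul, ← op_mul, sH_symm i j,
      sH_braid hij.symm hik hjk]
  | s_comm i j k l hij hkl hik hil hjk hjl =>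
    rw [map_mul, map_mul, ls, ls, ← op_mul, ← op_mul, sH_comm hij hkl hik hil hjk hjl]
  | x_comm i j h =>
    rw [map_sub, map_mul, map_mul, lx, lx, ← op_mul, ← op_mul, yH_mul_comm, sub_self, map_zero]
  | y_comm i j h =>
    rw [map_sub, map_mul, map_mul, ly, ly, ← op_mul, ← op_mul, xH_mul_comm, sub_self, map_zero]
  | s_x i j h =>
    rw [map_mul, map_mul, ls, lx, lx, ← op_mul, ← op_mul, sH_mul_yH, Equiv.swap_apply_right]
  | s_y i j h =>
    rw [map_mul, map_mul, ls, ly, ly, ← op_mul, ← op_mul, sH_mul_xH, Equiv.swap_apply_right]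
  | s_x_comm i j k h hki hkj =>
    rw [map_sub, map_mul, map_mul, ls, lx, ← op_mul, ← op_mul, sH_mul_yH,
      Equiv.swap_apply_of_ne_of_ne hki hkj, sub_self, map_zero]
  | s_y_comm i j k h hki hkj =>
    rw [map_sub, map_mul, map_mul, ls, ly, ← op_mul, ← op_mul, sH_mul_xH,
      Equiv.swap_apply_of_ne_of_ne hki hkj, sub_self, map_zero]
  | x_y i j h =>
    rw [map_sub, map_mul, map_mul, ls, lx, ly, ← op_mul, ← op_mul, ← op_sub,
      xH_mul_yH j i h.symm, permH_swap, add_sub_cancel_left, sH_symm]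
  | x_y_self i =>
    rw [map_sub, map_mul, map_mul, lx, ly, ← op_mul, ← op_mul, ← op_sub, map_neg, map_sum,
      xH_mul_yH_self]
    simp only [ls]
    rw [sub_sub_cancel_left, op_neg, Finset.op_sum]
    refine congrArg Neg.neg ?_
    simp only [permH_swap]
    exact Finset.sum_subtype (F := inferInstance) (Finset.univ.erase i) (p := fun a => a ≠ i)
      (by simp) (fun a => op (sH i a))⟩

lemma antiFlip_xH (i : Fin N) : antiFlip N (xH i) = MulOpposite.op (yH i) := by
  rw [xH, antiFlip, RingQuot.liftAlgHom_mkAlgHom_apply]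
  exact FreeAlgebra.lift_ι_apply _ _

lemma antiFlip_yH (i : Fin N) : antiFlip N (yH i) = MulOpposite.op (xH i) := by
  rw [yH, antiFlip, RingQuot.liftAlgHom_mkAlgHom_apply]
  exact FreeAlgebra.lift_ι_apply _ _

lemma antiFlip_sH (i j : Fin N) : antiFlip N (sH i j) = MulOpposite.op (sH i j) := by
  by_cases h : i = j
  · subst h; rw [sH_self, map_one, MulOpposite.op_one]
  · have : antiFlip N (sH i j) = antiFlip N (RingQuot.mkAlgHom ℂ (CherednikRel N) (Free.s i j h)) := by
      rw [sH, dif_pos h]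
    rw [this, antiFlip, RingQuot.liftAlgHom_mkAlgHom_apply]
    exact FreeAlgebra.lift_ι_apply _ _

lemma antiFlip_permH (σ : Equiv.Perm (Fin N)) :
    antiFlip N (permH N σ) = MulOpposite.op (permH N σ⁻¹) := by
  induction σ using Equiv.Perm.swap_induction_on with
  | one => simp
  | swap_mul f a b _ ih =>
    rw [map_mul, map_mul, ih, permH_swap, antiFlip_sH, ← MulOpposite.op_mul, mul_inv_rev,
      Equiv.swap_inv, map_mul, permH_swap]

end Relations

end BetheCherednik

end

noncomputable section

namespace BetheCherednik

lemma mapDomain_inl_add_mapDomain_inr {α β : Type*} (m : α ⊕ β →₀ ℕ) :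
    Finsupp.mapDomain Sum.inl (m.comapDomain Sum.inl Sum.inl_injective.injOn)
      + Finsupp.mapDomain Sum.inr (m.comapDomain Sum.inr Sum.inr_injective.injOn) = m := by
  ext k
  rw [Finsupp.add_apply]
  cases k with
  | inl k =>
    rw [Finsupp.mapDomain_apply Sum.inl_injective, Finsupp.mapDomain_of_notMem_range _ _ (by simp)]
    simp
  | inr k =>
    rw [Finsupp.mapDomain_apply Sum.inr_injective, Finsupp.mapDomain_of_notMem_range _ _ (by simp)]
    simp

open MvPolynomial in
/-- An induction principle for polynomials in two families of variables. -/
lemma polySum_induction {N : ℕ} {P : MvPolynomial (Fin N ⊕ Fin N) ℂ → Prop}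
    (hadd : ∀ f g, P f → P g → P (f + g))
    (hmon : ∀ (a b : Fin N →₀ ℕ) (c : ℂ),
      P (rename Sum.inl (monomial a c) * rename Sum.inr (monomial b 1)))
    (f : MvPolynomial (Fin N ⊕ Fin N) ℂ) : P f := by
  refine MvPolynomial.induction_on' f (fun m c => ?_) (fun p q => hadd p q)
  have h := hmon (m.comapDomain Sum.inl Sum.inl_injective.injOn)
    (m.comapDomain Sum.inr Sum.inr_injective.injOn) c
  rwa [rename_monomial, rename_monomial, monomial_mul, mul_one,
    mapDomain_inl_add_mapDomain_inr] at h

/-! ### Normal ordering, the degree filtration, and the spanning half of the PBW theorem -/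

section NormalOrder

open MvPolynomial

variable {N : ℕ}

/-- `ℂ[x] → H_N`. -/
def xPoly (N : ℕ) : MvPolynomial (Fin N) ℂ →ₐ[ℂ] Cherednik N := polyHom xH xH_mul_comm

/-- `ℂ[y] → H_N`. -/
def yPoly (N : ℕ) : MvPolynomial (Fin N) ℂ →ₐ[ℂ] Cherednik N := polyHom yH yH_mul_comm

lemma xPoly_X (i : Fin N) : xPoly N (X i) = xH i := polyHom_X _ _ i

lemma yPoly_X (i : Fin N) : yPoly N (X i) = yH i := polyHom_X _ _ i

/-- The `x_i` commute among themselves and so do the `y_i`; only the order between the two families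
matters. This form of normal ordering does not refer to monomials. -/
lemma normalOrder_rename (p q : MvPolynomial (Fin N) ℂ) :
    normalOrder N (rename Sum.inl p * rename Sum.inr q) = xPoly N p * yPoly N q := by
  induction p using MvPolynomial.induction_on' with
  | add p p' hp hp' => simp only [map_add, add_mul, hp, hp']
  | monomial a c =>
    induction q using MvPolynomial.induction_on' with
    | add q q' hq hq' => simp only [map_add, mul_add, hq, hq']
    | monomial b d =>
      have h1 : ∀ (m : Fin N →₀ ℕ) (c : ℂ), monomial m c = c • (monomial m 1) := by
        intro m c; rw [smul_monomial, smul_eq_mul, mul_one]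
      rw [h1 a, h1 b]
      simp only [map_smul, smul_mul_assoc, mul_smul_comm]
      congr 2
      rw [rename_monomial, rename_monomial, monomial_mul, mul_one, xPoly, yPoly, polyHom_monomial,
        polyHom_monomial]
      have h2 := (MvPolynomial.basisMonomials (Fin N ⊕ Fin N) ℂ).constr_basis ℂ (fun m =>
        ((List.ofFn fun i => xH i ^ m (Sum.inl i)).prod
          * (List.ofFn fun i => yH i ^ m (Sum.inr i)).prod : Cherednik N))
          (Finsupp.mapDomain Sum.inl a + Finsupp.mapDomain Sum.inr b)
      rw [coe_basisMonomials] at h2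
      refine h2.trans ?_
      congr 3
      · funext i
        rw [Finsupp.add_apply, Finsupp.mapDomain_apply Sum.inl_injective,
          Finsupp.mapDomain_of_notMem_range _ _ (by simp), add_zero]
      · funext i
        rw [Finsupp.add_apply, Finsupp.mapDomain_apply Sum.inr_injective,
          Finsupp.mapDomain_of_notMem_range _ _ (by simp), zero_add]

lemma normalOrder_inl (p : MvPolynomial (Fin N) ℂ) :
    normalOrder N (rename Sum.inl p) = xPoly N p := by
  have := normalOrder_rename p 1
  rwa [map_one, map_one, mul_one, mul_one] at this

lemma normalOrder_inr (q : MvPolynomial (Fin N) ℂ) :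
    normalOrder N (rename Sum.inr q) = yPoly N q := by
  have := normalOrder_rename 1 q
  rwa [map_one, map_one, one_mul, one_mul] at this

lemma normalOrder_one : normalOrder N 1 = 1 := by
  have h := normalOrder_inl (N := N) 1
  rwa [map_one (xPoly N),
    show (rename Sum.inl 1 : PolyXY N) = 1 from map_one (rename Sum.inl)] at h

/-- Normal ordering is not multiplicative, but it does respect polynomials in `x` on the left and,
symmetrically, polynomials in `y` on the right. -/
lemma normalOrder_inl_mul (p : MvPolynomial (Fin N) ℂ) (f : PolyXY N) :
    normalOrder N (rename Sum.inl p * f) = xPoly N p * normalOrder N f := by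
  induction f using polySum_induction with
  | hadd f g hf hg => rw [mul_add, map_add, hf, hg, map_add, mul_add]
  | hmon a b c => rw [← mul_assoc, ← map_mul, normalOrder_rename, normalOrder_rename, map_mul, mul_assoc]

lemma normalOrder_mul_inr (q : MvPolynomial (Fin N) ℂ) (f : PolyXY N) :
    normalOrder N (f * rename Sum.inr q) = normalOrder N f * yPoly N q := by
  induction f using polySum_induction with
  | hadd f g hf hg => rw [add_mul, map_add, hf, hg, map_add, add_mul]
  | hmon a b c => rw [mul_assoc, ← map_mul, normalOrder_rename, normalOrder_rename, map_mul, mul_assoc]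

lemma normalOrder_X_mul (i : Fin N) (f : PolyXY N) :
    normalOrder N (X (Sum.inl i) * f) = xH i * normalOrder N f := by
  rw [← rename_X (R := ℂ) Sum.inl i, normalOrder_inl_mul, xPoly_X]

lemma normalOrder_mul_X (i : Fin N) (f : PolyXY N) :
    normalOrder N (f * X (Sum.inr i)) = normalOrder N f * yH i := by
  rw [← rename_X (R := ℂ) Sum.inr i, normalOrder_mul_inr, yPoly_X]

lemma permH_mul_xPoly (σ : Equiv.Perm (Fin N)) (p : MvPolynomial (Fin N) ℂ) :
    permH N σ * xPoly N p = xPoly N (rename σ p) * permH N σ := by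
  induction p using MvPolynomial.induction_on with
  | C r => simp [Algebra.commutes, ← algebraMap_eq]
  | add p q hp hq => rw [map_add, mul_add, hp, hq, map_add, map_add, add_mul]
  | mul_X p i hp =>
    rw [map_mul, xPoly_X, ← mul_assoc, hp, mul_assoc, permH_mul_xH, map_mul, map_mul, rename_X,
      xPoly_X, mul_assoc]

lemma permH_mul_yPoly (σ : Equiv.Perm (Fin N)) (p : MvPolynomial (Fin N) ℂ) :
    permH N σ * yPoly N p = yPoly N (rename σ p) * permH N σ := by
  induction p using MvPolynomial.induction_on with
  | C r => simp [Algebra.commutes, ← algebraMap_eq]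
  | add p q hp hq => rw [map_add, mul_add, hp, hq, map_add, map_add, add_mul]
  | mul_X p i hp =>
    rw [map_mul, yPoly_X, ← mul_assoc, hp, mul_assoc, permH_mul_yH, map_mul, map_mul, rename_X,
      yPoly_X, mul_assoc]

/-- The diagonal action of a permutation on `ℂ[x, y]`. -/
def diagPerm (σ : Equiv.Perm (Fin N)) : PolyXY N →ₐ[ℂ] PolyXY N := rename (Sum.map σ σ)

lemma diagPerm_inl (σ : Equiv.Perm (Fin N)) (p : MvPolynomial (Fin N) ℂ) :
    diagPerm σ (rename Sum.inl p) = rename Sum.inl (rename σ p) := by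
  rw [diagPerm, rename_rename, rename_rename]
  rfl

lemma diagPerm_inr (σ : Equiv.Perm (Fin N)) (p : MvPolynomial (Fin N) ℂ) :
    diagPerm σ (rename Sum.inr p) = rename Sum.inr (rename σ p) := by
  rw [diagPerm, rename_rename, rename_rename]
  rfl

lemma permH_mul_normalOrder (σ : Equiv.Perm (Fin N)) (f : PolyXY N) :
    permH N σ * normalOrder N f = normalOrder N (diagPerm σ f) * permH N σ := by
  induction f using polySum_induction with
  | hadd f g hf hg => simp only [map_add, mul_add, add_mul, hf, hg]
  | hmon a b c =>
    rw [normalOrder_rename, ← mul_assoc, permH_mul_xPoly, mul_assoc, permH_mul_yPoly, map_mul,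
      diagPerm_inl, diagPerm_inr, normalOrder_rename, mul_assoc]

lemma antiFlip_xPoly (p : MvPolynomial (Fin N) ℂ) :
    antiFlip N (xPoly N p) = MulOpposite.op (yPoly N p) := by
  induction p using MvPolynomial.induction_on with
  | C r => simp [← algebraMap_eq, MulOpposite.algebraMap_apply]
  | add p q hp hq => simp only [map_add, hp, hq, MulOpposite.op_add]
  | mul_X p i hp =>
    rw [map_mul, map_mul, xPoly_X, hp, antiFlip_xH, ← MulOpposite.op_mul, mul_comm p, map_mul,
      yPoly_X]

lemma antiFlip_yPoly (p : MvPolynomial (Fin N) ℂ) :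
    antiFlip N (yPoly N p) = MulOpposite.op (xPoly N p) := by
  induction p using MvPolynomial.induction_on with
  | C r => simp [← algebraMap_eq, MulOpposite.algebraMap_apply]
  | add p q hp hq => simp only [map_add, hp, hq, MulOpposite.op_add]
  | mul_X p i hp =>
    rw [map_mul, map_mul, yPoly_X, hp, antiFlip_yH, ← MulOpposite.op_mul, mul_comm p, map_mul,
      xPoly_X]

lemma antiFlip_normalOrder (f : PolyXY N) :
    antiFlip N (normalOrder N f) = MulOpposite.op (normalOrder N (rename Sum.swap f)) := by
  induction f using polySum_induction with
  | hadd f g hf hg => simp only [map_add, hf, hg, MulOpposite.op_add]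
  | hmon a b c =>
    rw [normalOrder_rename, map_mul, antiFlip_xPoly, antiFlip_yPoly, ← MulOpposite.op_mul, map_mul,
      rename_rename, rename_rename, mul_comm (rename (Sum.swap ∘ Sum.inl) _)]
    exact congrArg _ (normalOrder_rename _ _).symm

/-! ### The degree filtration -/

/-- Polynomials of degree less than `n`. -/
def ltDeg (N n : ℕ) : Submodule ℂ (PolyXY N) where
  carrier := {f | ∀ m : Fin N ⊕ Fin N →₀ ℕ, n ≤ m.degree → coeff m f = 0}
  add_mem' hf hg m hm := by rw [coeff_add, hf m hm, hg m hm, add_zero]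
  zero_mem' m _ := coeff_zero m
  smul_mem' c f hf m hm := by rw [coeff_smul, hf m hm, smul_zero]

lemma monomial_mem_ltDeg {n : ℕ} {m : Fin N ⊕ Fin N →₀ ℕ} (hm : m.degree < n) (c : ℂ) :
    monomial m c ∈ ltDeg N n := by
  intro m' hm'
  rw [coeff_monomial, if_neg]
  rintro rfl
  omega

lemma ltDeg_mono {n n' : ℕ} (h : n ≤ n') : ltDeg N n ≤ ltDeg N n' :=
  fun _ hf m hm => hf m (h.trans hm)

/-- An induction principle for polynomials of bounded degree. -/
lemma ltDeg_induction {n : ℕ} {P : PolyXY N → Prop} (h0 : P 0)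
    (hadd : ∀ f g, P f → P g → P (f + g))
    (hmon : ∀ (m : Fin N ⊕ Fin N →₀ ℕ) (c : ℂ), m.degree < n → P (monomial m c))
    {f : PolyXY N} (hf : f ∈ ltDeg N n) : P f := by
  rw [f.as_sum]
  refine Finset.sum_induction _ P hadd h0 fun m hm => hmon m _ ?_
  by_contra h
  exact (mem_support_iff.mp hm) (hf m (not_lt.mp h))

lemma mul_mem_ltDeg {d e : ℕ} {f g : PolyXY N} (hf : f ∈ ltDeg N (d + 1)) (hg : g ∈ ltDeg N e) :
    f * g ∈ ltDeg N (d + e) := by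
  refine ltDeg_induction (P := fun f => f * g ∈ ltDeg N (d + e)) (by simp [zero_mem])
    (fun f f' h h' => by rw [add_mul]; exact add_mem h h') (fun m c hm => ?_) hf
  refine ltDeg_induction (P := fun g => monomial m c * g ∈ ltDeg N (d + e)) (by simp [zero_mem])
    (fun f f' h h' => by rw [mul_add]; exact add_mem h h') (fun m' c' hm' => ?_) hg
  rw [monomial_mul]
  refine monomial_mem_ltDeg ?_ _
  rw [map_add]
  omega

lemma X_mem_ltDeg (i : Fin N ⊕ Fin N) : (X i : PolyXY N) ∈ ltDeg N 2 :=
  monomial_mem_ltDeg (by simp) 1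

lemma X_mul_mem_ltDeg {n : ℕ} (i : Fin N ⊕ Fin N) {f : PolyXY N} (hf : f ∈ ltDeg N n) :
    X i * f ∈ ltDeg N (n + 1) := by
  rw [add_comm n]
  exact mul_mem_ltDeg (X_mem_ltDeg i) hf

lemma one_mem_ltDeg : (1 : PolyXY N) ∈ ltDeg N 1 :=
  monomial_mem_ltDeg (by simp) 1

lemma rename_mem_ltDeg {n : ℕ} (e : Fin N ⊕ Fin N → Fin N ⊕ Fin N) {f : PolyXY N}
    (hf : f ∈ ltDeg N n) : rename e f ∈ ltDeg N n := by
  refine ltDeg_induction (P := fun f => rename e f ∈ ltDeg N n) (by simp [zero_mem])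
    (fun f f' h h' => by rw [map_add]; exact add_mem h h') (fun m c hm => ?_) hf
  rw [rename_monomial]
  exact monomial_mem_ltDeg (by rwa [Finsupp.degree_mapDomain]) c

/-- The linear map `(f_σ)_σ ↦ ∑_σ :f_σ: σ`. -/
def pbw (N : ℕ) : (Equiv.Perm (Fin N) → PolyXY N) →ₗ[ℂ] Cherednik N :=
  ∑ σ, (LinearMap.mulRight ℂ (permH N σ)) ∘ₗ normalOrder N ∘ₗ LinearMap.proj σ

lemma pbw_apply (g : Equiv.Perm (Fin N) → PolyXY N) :
    pbw N g = ∑ σ, normalOrder N (g σ) * permH N σ := by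
  simp [pbw, LinearMap.sum_apply]

lemma pbw_single (σ : Equiv.Perm (Fin N)) (f : PolyXY N) :
    pbw N (Pi.single σ f) = normalOrder N f * permH N σ := by
  rw [pbw_apply, Finset.sum_eq_single σ]
  · rw [Pi.single_eq_same]
  · intro ρ _ h
    rw [Pi.single_eq_of_ne h, map_zero, zero_mul]
  · simp

/-- The degree filtration of `H_N`, with both `x_i` and `y_i` of degree one. -/
def ltFil (N n : ℕ) : Submodule ℂ (Cherednik N) :=
  Submodule.map (pbw N) (Submodule.pi Set.univ fun _ => ltDeg N n)

lemma pbw_mem_ltFil {n : ℕ} {g : Equiv.Perm (Fin N) → PolyXY N} (hg : ∀ σ, g σ ∈ ltDeg N n) :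
    pbw N g ∈ ltFil N n :=
  ⟨g, fun σ _ => hg σ, rfl⟩

lemma mem_ltFil {n : ℕ} {f : PolyXY N} (hf : f ∈ ltDeg N n) (σ : Equiv.Perm (Fin N)) :
    normalOrder N f * permH N σ ∈ ltFil N n := by
  rw [← pbw_single]
  refine pbw_mem_ltFil fun ρ => ?_
  by_cases h : ρ = σ
  · subst h; rwa [Pi.single_eq_same]
  · rw [Pi.single_eq_of_ne h]; exact zero_mem _

lemma normalOrder_mem_ltFil {n : ℕ} {f : PolyXY N} (hf : f ∈ ltDeg N n) :
    normalOrder N f ∈ ltFil N n := by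
  have := mem_ltFil hf 1
  rwa [map_one, mul_one] at this

lemma ltFil_mono {n n' : ℕ} (h : n ≤ n') : ltFil N n ≤ ltFil N n' :=
  Submodule.map_mono (Submodule.pi_mono fun _ _ => ltDeg_mono h)

/-- An induction principle for the degree filtration. -/
lemma ltFil_induction {n : ℕ} {P : Cherednik N → Prop} (h0 : P 0)
    (hadd : ∀ f g, P f → P g → P (f + g))
    (hmon : ∀ f ∈ ltDeg N n, ∀ σ, P (normalOrder N f * permH N σ)) {h : Cherednik N}
    (hh : h ∈ ltFil N n) : P h := by
  obtain ⟨g, hg, rfl⟩ := hh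
  rw [pbw_apply]
  exact Finset.sum_induction _ P hadd h0 fun σ _ => hmon _ (hg σ trivial) σ

lemma ltFil_mul_permH {n : ℕ} {h : Cherednik N} (hh : h ∈ ltFil N n) (σ : Equiv.Perm (Fin N)) :
    h * permH N σ ∈ ltFil N n := by
  refine ltFil_induction (P := fun h => h * permH N σ ∈ ltFil N n) (by simp [zero_mem])
    (fun f g hf hg => by rw [add_mul]; exact add_mem hf hg) (fun f hf ρ => ?_) hh
  rw [mul_assoc, ← map_mul]
  exact mem_ltFil hf _

lemma permH_mul_ltFil {n : ℕ} {h : Cherednik N} (hh : h ∈ ltFil N n) (σ : Equiv.Perm (Fin N)) :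
    permH N σ * h ∈ ltFil N n := by
  refine ltFil_induction (P := fun h => permH N σ * h ∈ ltFil N n) (by simp [zero_mem])
    (fun f g hf hg => by rw [mul_add]; exact add_mem hf hg) (fun f hf ρ => ?_) hh
  rw [← mul_assoc, permH_mul_normalOrder, mul_assoc, ← map_mul]
  exact mem_ltFil (rename_mem_ltDeg _ hf) _

lemma xH_mul_ltFil {n : ℕ} {h : Cherednik N} (hh : h ∈ ltFil N n) (i : Fin N) :
    xH i * h ∈ ltFil N (n + 1) := by
  refine ltFil_induction (P := fun h => xH i * h ∈ ltFil N (n + 1)) (by simp [zero_mem])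
    (fun f g hf hg => by rw [mul_add]; exact add_mem hf hg) (fun f hf ρ => ?_) hh
  rw [← mul_assoc, ← normalOrder_X_mul]
  exact mem_ltFil (X_mul_mem_ltDeg _ hf) _

/-- Commutators of `y_i` and `x_k` preserve the filtration. -/
lemma yH_mul_xH_mul_sub {n : ℕ} {h : Cherednik N} (hh : h ∈ ltFil N n) (i k : Fin N) :
    yH i * (xH k * h) - xH k * (yH i * h) ∈ ltFil N n := by
  by_cases hik : k = i
  · subst hik
    have : yH k * (xH k * h) - xH k * (yH k * h)
        = ∑ a ∈ Finset.univ.erase k, permH N (Equiv.swap k a) * h := by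
      rw [← mul_assoc, ← mul_assoc, xH_mul_yH_self, sub_mul, ← Finset.sum_mul]
      abel
    rw [this]
    exact sum_mem fun a _ => permH_mul_ltFil hh _
  · have : yH i * (xH k * h) - xH k * (yH i * h) = -(permH N (Equiv.swap k i) * h) := by
      rw [← mul_assoc, ← mul_assoc, xH_mul_yH k i hik, add_mul]
      abel
    rw [this]
    exact neg_mem (permH_mul_ltFil hh _)

/-- Induction on monomials that splits off first the `x`-variables and then the `y`-variables. -/
lemma monomial_induction {P : ℕ → PolyXY N → Prop} (hone : P 0 1)
    (hy : ∀ d i q, rename Sum.inr q ∈ ltDeg N (d + 1) → P d (rename Sum.inr q) →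
      P (d + 1) (X (Sum.inr i) * rename Sum.inr q))
    (hx : ∀ d i f, f ∈ ltDeg N (d + 1) → P d f → P (d + 1) (X (Sum.inl i) * f))
    (m : Fin N ⊕ Fin N →₀ ℕ) : P m.degree (monomial m 1) := by
  obtain ⟨d, hd⟩ : ∃ d, m.degree = d := ⟨_, rfl⟩
  have split : ∀ (m : Fin N ⊕ Fin N →₀ ℕ) (k : Fin N ⊕ Fin N), m k ≠ 0 →
      m = Finsupp.single k 1 + (m - Finsupp.single k 1) := by
    intro m k hk
    rw [add_tsub_cancel_of_le]
    rwa [Finsupp.single_le_iff, Nat.one_le_iff_ne_zero]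
  have hmul : ∀ (m : Fin N ⊕ Fin N →₀ ℕ) (k : Fin N ⊕ Fin N),
      (monomial (Finsupp.single k 1 + m) 1 : PolyXY N) = X k * monomial m 1 := by
    intro m k
    rw [X, monomial_mul, one_mul]
  rw [hd]
  induction d generalizing m with
  | zero =>
    have : m = 0 := by rwa [Finsupp.degree_eq_zero_iff] at hd
    rw [this]
    exact hone
  | succ d ih =>
    by_cases hex : ∃ k, m (Sum.inl k) ≠ 0
    · obtain ⟨k, hk⟩ := hex
      have h := split m _ hk
      set m' := m - Finsupp.single (Sum.inl k) 1
      have hd' : m'.degree = d := by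
        rw [h, map_add, Finsupp.degree_single] at hd
        omega
      rw [h, hmul]
      exact hx d k _ (monomial_mem_ltDeg (by omega) 1) (ih m' hd')
    · push Not at hex
      obtain ⟨k, hk⟩ : ∃ k, m (Sum.inr k) ≠ 0 := by
        by_contra hne
        push Not at hne
        have : m = 0 := by
          ext k
          cases k with
          | inl k => exact hex k
          | inr k => exact hne k
        rw [this, map_zero] at hd
        omega
      have h := split m _ hk
      set m' := m - Finsupp.single (Sum.inr k) 1
      have hd' : m'.degree = d := by
        rw [h, map_add, Finsupp.degree_single] at hd
        omega
      have hm' : (monomial m' 1 : PolyXY N) = rename Sum.inr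
          (monomial (m'.comapDomain Sum.inr Sum.inr_injective.injOn) 1) := by
        have e : m'.comapDomain Sum.inl Sum.inl_injective.injOn = 0 := by
          ext l
          have := hex l
          rw [h, Finsupp.add_apply] at this
          rw [Finsupp.comapDomain_apply, Finsupp.zero_apply]
          omega
        have e2 := mapDomain_inl_add_mapDomain_inr m'
        rw [e, Finsupp.mapDomain_zero, zero_add] at e2
        rw [rename_monomial, e2]
      rw [h, hmul]
      have h1 := ih m' hd'
      have h2 : (monomial m' 1 : PolyXY N) ∈ ltDeg N (d + 1) := monomial_mem_ltDeg (by omega) 1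
      rw [hm'] at h1 h2 ⊢
      exact hy d k _ h2 h1

/-- Moving `y_i` to the right through the `x_k` produces only commutators, which are combinations of
permutations and have degree zero. Once only `y`'s are left, there is no error. -/
lemma yH_mul_normalOrder_sub {n : ℕ} {f : PolyXY N} (hf : f ∈ ltDeg N n) (i : Fin N) :
    yH i * normalOrder N f - normalOrder N (X (Sum.inr i) * f) ∈ ltFil N n := by
  have key : ∀ m : Fin N ⊕ Fin N →₀ ℕ, yH i * normalOrder N (monomial m 1)
      - normalOrder N (X (Sum.inr i) * monomial m 1) ∈ ltFil N (m.degree + 1) := by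
    refine monomial_induction (P := fun d f => yH i * normalOrder N f
      - normalOrder N (X (Sum.inr i) * f) ∈ ltFil N (d + 1)) ?_ ?_ ?_
    · have h := normalOrder_mul_X i (1 : PolyXY N)
      rw [one_mul, normalOrder_one, one_mul] at h
      rw [normalOrder_one, mul_one, mul_one, h, sub_self]
      exact zero_mem _
    · intro d k q _ _
      have h : ∀ q : MvPolynomial (Fin N) ℂ, yH i * normalOrder N (rename Sum.inr q)
          - normalOrder N (X (Sum.inr i) * rename Sum.inr q) = 0 := by
        intro q
        rw [← rename_X (R := ℂ) Sum.inr i, ← map_mul, normalOrder_inr, normalOrder_inr, map_mul,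
          yPoly_X, sub_self]
      have e : (X (Sum.inr k) * rename Sum.inr q : PolyXY N) = rename Sum.inr (X k * q) := by
        rw [map_mul, rename_X]
      rw [e, h]
      exact zero_mem _
    · intro d k f hf ih
      have e : yH i * normalOrder N (X (Sum.inl k) * f)
            - normalOrder N (X (Sum.inr i) * (X (Sum.inl k) * f))
          = (yH i * (xH k * normalOrder N f) - xH k * (yH i * normalOrder N f))
            + xH k * (yH i * normalOrder N f - normalOrder N (X (Sum.inr i) * f)) := by
        rw [mul_left_comm (X (Sum.inr i) : PolyXY N), normalOrder_X_mul, normalOrder_X_mul, mul_sub]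
        abel
      rw [e]
      exact add_mem (ltFil_mono (by omega) (yH_mul_xH_mul_sub (normalOrder_mem_ltFil hf) i k))
        (xH_mul_ltFil ih k)
  refine ltDeg_induction (P := fun f => yH i * normalOrder N f
      - normalOrder N (X (Sum.inr i) * f) ∈ ltFil N n) (by simp [zero_mem]) (fun f g h h' => ?_)
      (fun m c hm => ?_) hf
  · have := add_mem h h'
    rw [mul_add, map_add, map_add, mul_add]
    convert this using 1
    abel
  · have : (monomial m c : PolyXY N) = c • monomial m 1 := by
      rw [smul_monomial, smul_eq_mul, mul_one]
    rw [this, mul_smul_comm, map_smul, map_smul, mul_smul_comm]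
    have h := Submodule.smul_mem _ c (ltFil_mono hm (key m))
    rwa [smul_sub] at h

lemma yH_mul_ltFil {n : ℕ} {h : Cherednik N} (hh : h ∈ ltFil N n) (i : Fin N) :
    yH i * h ∈ ltFil N (n + 1) := by
  refine ltFil_induction (P := fun h => yH i * h ∈ ltFil N (n + 1)) (by simp [zero_mem])
    (fun f g hf hg => by rw [mul_add]; exact add_mem hf hg) (fun f hf ρ => ?_) hh
  have h1 := add_mem (ltFil_mono (Nat.le_succ n) (yH_mul_normalOrder_sub hf i))
    (normalOrder_mem_ltFil (X_mul_mem_ltDeg (Sum.inr i) hf))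
  rw [sub_add_cancel] at h1
  rw [← mul_assoc]
  exact ltFil_mul_permH h1 ρ

/-- Left multiplication by a generator raises the filtration by at most one, so left multiplication
by any element raises it by a bounded amount. Applying this to `1` puts the element itself into the
filtration, which means that the elements `:f: σ` span. -/
lemma exists_mem_ltFil (h : Cherednik N) : ∃ n, h ∈ ltFil N n := by
  have key : ∀ n, ∃ m, ∀ f ∈ ltFil N n, h * f ∈ ltFil N m := by
    induction h using cherednik_induction with
    | hx i => exact fun n => ⟨n + 1, fun f hf => xH_mul_ltFil hf i⟩
    | hy i => exact fun n => ⟨n + 1, fun f hf => yH_mul_ltFil hf i⟩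
    | hs i j => exact fun n => ⟨n, fun f hf => by rw [← permH_swap]; exact permH_mul_ltFil hf _⟩
    | hc r =>
      exact fun n => ⟨n, fun f hf => by
        rw [← Algebra.smul_def]; exact Submodule.smul_mem _ _ hf⟩
    | hadd a b ha hb =>
      intro n
      obtain ⟨m, hm⟩ := ha n
      obtain ⟨m', hm'⟩ := hb n
      refine ⟨max m m', fun f hf => ?_⟩
      rw [add_mul]
      exact add_mem (ltFil_mono (le_max_left _ _) (hm f hf)) (ltFil_mono (le_max_right _ _) (hm' f hf))
    | hmul a b ha hb =>
      intro n
      obtain ⟨m, hm⟩ := hb n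
      obtain ⟨m', hm'⟩ := ha m
      exact ⟨m', fun f hf => by rw [mul_assoc]; exact hm' _ (hm f hf)⟩
  obtain ⟨m, hm⟩ := key 1
  refine ⟨m, ?_⟩
  have := hm 1 (by rw [← normalOrder_one]; exact normalOrder_mem_ltFil one_mem_ltDeg)
  rwa [mul_one] at this

lemma pbw_surjective : Function.Surjective (pbw N) := by
  intro h
  obtain ⟨n, g, -, rfl⟩ := exists_mem_ltFil h
  exact ⟨g, rfl⟩

/-- Normal ordering is multiplicative up to terms of lower degree. -/
lemma normalOrder_mul_sub {d e : ℕ} {f g : PolyXY N} (hf : f ∈ ltDeg N (d + 1))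
    (hg : g ∈ ltDeg N (e + 1)) :
    normalOrder N f * normalOrder N g - normalOrder N (f * g) ∈ ltFil N (d + e) := by
  have key : ∀ m : Fin N ⊕ Fin N →₀ ℕ, normalOrder N (monomial m 1) * normalOrder N g
      - normalOrder N (monomial m 1 * g) ∈ ltFil N (m.degree + e) := by
    refine monomial_induction (P := fun d f => normalOrder N f * normalOrder N g
      - normalOrder N (f * g) ∈ ltFil N (d + e)) ?_ ?_ ?_
    · rw [normalOrder_one, one_mul, one_mul, sub_self]
      exact zero_mem _
    · intro d k q hq ih
      have e1 : normalOrder N (X (Sum.inr k) * rename Sum.inr q) * normalOrder N g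
            - normalOrder N (X (Sum.inr k) * rename Sum.inr q * g)
          = yH k * (normalOrder N (rename Sum.inr q) * normalOrder N g
              - normalOrder N (rename Sum.inr q * g))
            + (yH k * normalOrder N (rename Sum.inr q * g)
              - normalOrder N (X (Sum.inr k) * (rename Sum.inr q * g))) := by
        have e2 : normalOrder N (X (Sum.inr k) * rename Sum.inr q)
            = yH k * normalOrder N (rename Sum.inr q) := by
          rw [← rename_X (R := ℂ) Sum.inr k, ← map_mul, normalOrder_inr, normalOrder_inr, map_mul,
            yPoly_X]
        rw [e2, mul_sub, mul_assoc, mul_assoc]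
        abel
      -- The error splits into `y_k` times the error for the shorter monomial and the error of
      -- moving `y_k` into the ordered product.
      rw [e1, add_right_comm]
      refine add_mem (yH_mul_ltFil ih k) ?_
      have := mul_mem_ltDeg hq hg
      exact yH_mul_normalOrder_sub this k
    · intro d k f hf ih
      have e1 : normalOrder N (X (Sum.inl k) * f) * normalOrder N g
            - normalOrder N (X (Sum.inl k) * f * g)
          = xH k * (normalOrder N f * normalOrder N g - normalOrder N (f * g)) := by
        rw [mul_assoc (X (Sum.inl k) : PolyXY N), normalOrder_X_mul, normalOrder_X_mul, mul_sub,
          mul_assoc]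
      rw [e1, add_right_comm]
      exact xH_mul_ltFil ih k
  refine ltDeg_induction (P := fun f => normalOrder N f * normalOrder N g
      - normalOrder N (f * g) ∈ ltFil N (d + e)) (by simp [zero_mem]) (fun f f' h h' => ?_)
      (fun m c hm => ?_) hf
  · have := add_mem h h'
    rw [map_add, add_mul, add_mul, map_add]
    convert this using 1
    abel
  · have : (monomial m c : PolyXY N) = c • monomial m 1 := by
      rw [smul_monomial, smul_eq_mul, mul_one]
    rw [this, map_smul, smul_mul_assoc, smul_mul_assoc, map_smul]
    have h : _ ∈ ltFil N (d + e) := Submodule.smul_mem _ c (ltFil_mono (by omega) (key m))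
    rwa [smul_sub] at h

lemma ltFil_mul_ltFil {d e : ℕ} {h h' : Cherednik N} (hh : h ∈ ltFil N (d + 1))
    (hh' : h' ∈ ltFil N (e + 1)) : h * h' ∈ ltFil N (d + e + 1) := by
  refine ltFil_induction (P := fun h => h * h' ∈ ltFil N (d + e + 1)) (by simp [zero_mem])
    (fun f g hf hg => by rw [add_mul]; exact add_mem hf hg) (fun f hf σ => ?_) hh
  refine ltFil_induction (P := fun h' => normalOrder N f * permH N σ * h' ∈ ltFil N (d + e + 1))
    (by simp [zero_mem]) (fun f g hf hg => by rw [mul_add]; exact add_mem hf hg)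
    (fun g hg ρ => ?_) hh'
  have e1 : normalOrder N f * permH N σ * (normalOrder N g * permH N ρ)
      = normalOrder N f * normalOrder N (diagPerm σ g) * permH N (σ * ρ) := by
    rw [map_mul, mul_assoc, ← mul_assoc (permH N σ), permH_mul_normalOrder]
    simp only [mul_assoc]
  rw [e1]
  refine ltFil_mul_permH ?_ _
  have hg' : diagPerm σ g ∈ ltDeg N (e + 1) := rename_mem_ltDeg _ hg
  have := add_mem (ltFil_mono (Nat.le_succ _) (normalOrder_mul_sub hf hg'))
    (normalOrder_mem_ltFil (n := d + (e + 1)) (mul_mem_ltDeg hf hg'))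
  rwa [sub_add_cancel] at this

end NormalOrder

end BetheCherednik

end

noncomputable section

namespace BetheCherednik

open MvPolynomial hiding funext

/-! ### Divided differences -/

section DividedDifference

variable {N : ℕ}

/-- A permutation acts on `ℂ[z, λ]` by permuting the `z_k`. -/
def zPerm (σ : Equiv.Perm (Fin N)) : PolyZL N →ₐ[ℂ] PolyZL N := rename (Sum.map σ id)

lemma zPerm_inl (σ : Equiv.Perm (Fin N)) (k : Fin N) :
    zPerm σ (X (Sum.inl k)) = X (Sum.inl (σ k)) := rename_X _ _

lemma zPerm_inr (σ : Equiv.Perm (Fin N)) (k : Fin N) :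
    zPerm σ (X (Sum.inr k)) = X (Sum.inr k) := rename_X _ _

lemma zPerm_one (f : PolyZL N) : zPerm 1 f = f := by
  have : Sum.map (1 : Equiv.Perm (Fin N)) (id : Fin N → Fin N) = id := by
    funext k; cases k <;> rfl
  rw [zPerm, this, rename_id_apply]

lemma zPerm_mul (σ ρ : Equiv.Perm (Fin N)) (f : PolyZL N) :
    zPerm (σ * ρ) f = zPerm σ (zPerm ρ f) := by
  rw [zPerm, zPerm, zPerm, rename_rename]
  congr 2
  funext k; cases k <;> rfl

/-- `z_i - z_j`. -/
def zDiff (i j : Fin N) : PolyZL N := X (Sum.inl i) - X (Sum.inl j)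

lemma zDiff_ne_zero {i j : Fin N} (h : i ≠ j) : zDiff i j ≠ 0 := by
  rw [zDiff, sub_ne_zero]
  exact fun e => h (Sum.inl_injective (X_injective e))

lemma zPerm_zDiff (σ : Equiv.Perm (Fin N)) (i j : Fin N) :
    zPerm σ (zDiff i j) = zDiff (σ i) (σ j) := by
  rw [zDiff, map_sub, zPerm_inl, zPerm_inl, zDiff]

/-- The claim is clear for constants and variables, and `fg - s(fg) = (f - sf) g + sf (g - sg)`
carries it over to products. -/
lemma zDiff_dvd (i j : Fin N) (f : PolyZL N) :
    zDiff i j ∣ f - zPerm (Equiv.swap i j) f := by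
  induction f using MvPolynomial.induction_on with
  | C r => simp [zPerm]
  | add p q hp hq =>
    have := dvd_add hp hq
    rw [map_add]
    convert this using 1
    ring
  | mul_X p k hp =>
    have h : zDiff i j ∣ X k - zPerm (Equiv.swap i j) (X k) := by
      cases k with
      | inr k => rw [zPerm_inr, sub_self]; exact dvd_zero _
      | inl k =>
        rw [zPerm_inl]
        by_cases hi : k = i
        · subst hi; rw [Equiv.swap_apply_left]; exact dvd_rfl
        · by_cases hj : k = j
          · subst hj
            rw [Equiv.swap_apply_right]
            exact ⟨-1, by rw [zDiff]; ring⟩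
          · rw [Equiv.swap_apply_of_ne_of_ne hi hj, sub_self]; exact dvd_zero _
    have := dvd_add (dvd_mul_of_dvd_left hp (X k))
      (dvd_mul_of_dvd_right h (zPerm (Equiv.swap i j) p))
    rw [map_mul]
    convert this using 1
    ring

/-- The divided difference `(f - s_{ij} f) / (z_i - z_j)`; zero if `i = j`. -/
def divDiff (i j : Fin N) : PolyZL N →ₗ[ℂ] PolyZL N :=
  if h : i = j then 0 else
  -- The quotient is unique because `z_i - z_j` is a nonzero element of a domain; linearity is
  -- checked after multiplying by it.
  { toFun := fun f => (zDiff_dvd i j f).choose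
    map_add' := fun f g => by
      refine mul_left_cancel₀ (zDiff_ne_zero h) ?_
      rw [mul_add, ← (zDiff_dvd i j (f + g)).choose_spec, ← (zDiff_dvd i j f).choose_spec,
        ← (zDiff_dvd i j g).choose_spec, map_add]
      ring
    map_smul' := fun c f => by
      refine mul_left_cancel₀ (zDiff_ne_zero h) ?_
      rw [RingHom.id_apply, mul_smul_comm, ← (zDiff_dvd i j (c • f)).choose_spec,
        ← (zDiff_dvd i j f).choose_spec, map_smul, smul_sub] }

lemma divDiff_self (i : Fin N) : divDiff i i = 0 := dif_pos rfl

lemma zDiff_mul_divDiff (i j : Fin N) (f : PolyZL N) :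
    zDiff i j * divDiff i j f = f - zPerm (Equiv.swap i j) f := by
  by_cases h : i = j
  · subst h
    rw [divDiff_self, LinearMap.zero_apply, mul_zero, Equiv.swap_self]
    exact (sub_eq_zero.mpr (zPerm_one f).symm).symm
  · rw [divDiff, dif_neg h]
    exact (zDiff_dvd i j f).choose_spec.symm

lemma divDiff_eq_of {i j : Fin N} (h : i ≠ j) {f g : PolyZL N}
    (e : zDiff i j * g = f - zPerm (Equiv.swap i j) f) : divDiff i j f = g :=
  mul_left_cancel₀ (zDiff_ne_zero h) ((zDiff_mul_divDiff i j f).trans e.symm)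

lemma divDiff_eq_zero {i j : Fin N} {f : PolyZL N} (e : zPerm (Equiv.swap i j) f = f) :
    divDiff i j f = 0 := by
  by_cases h : i = j
  · subst h; rw [divDiff_self]; rfl
  · exact divDiff_eq_of h (by rw [e, mul_zero, sub_self])

lemma divDiff_symm (i j : Fin N) (f : PolyZL N) : divDiff i j f = -divDiff j i f := by
  by_cases h : i = j
  · subst h; simp [divDiff_self]
  · refine divDiff_eq_of h ?_
    have := zDiff_mul_divDiff j i f
    rw [Equiv.swap_comm, ← this, zDiff, zDiff]
    ring

lemma divDiff_mul (i j : Fin N) (g f : PolyZL N) :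
    divDiff i j (g * f) = g * divDiff i j f + divDiff i j g * zPerm (Equiv.swap i j) f := by
  by_cases h : i = j
  · subst h; simp [divDiff_self]
  · refine divDiff_eq_of h ?_
    have e1 := zDiff_mul_divDiff i j f
    have e2 := zDiff_mul_divDiff i j g
    rw [map_mul]
    linear_combination g * e1 + zPerm (Equiv.swap i j) f * e2

lemma divDiff_lam_mul (i j k : Fin N) (f : PolyZL N) :
    divDiff i j (X (Sum.inr k) * f) = X (Sum.inr k) * divDiff i j f := by
  rw [divDiff_mul, divDiff_eq_zero (zPerm_inr _ k), zero_mul, add_zero]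

lemma zPerm_divDiff (σ : Equiv.Perm (Fin N)) (i j : Fin N) (f : PolyZL N) :
    zPerm σ (divDiff i j f) = divDiff (σ i) (σ j) (zPerm σ f) := by
  by_cases h : i = j
  · subst h; simp [divDiff_self]
  · refine (divDiff_eq_of (fun e => h (σ.injective e)) ?_).symm
    rw [← zPerm_zDiff, ← map_mul, zDiff_mul_divDiff, map_sub, ← zPerm_mul, ← zPerm_mul,
      Equiv.mul_swap_eq_swap_mul]

lemma divDiff_z_left {i j : Fin N} (h : i ≠ j) : divDiff i j (X (Sum.inl i)) = 1 :=
  divDiff_eq_of h (by rw [zPerm_inl, Equiv.swap_apply_left, mul_one]; rfl)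

lemma divDiff_z_right {i j : Fin N} (h : i ≠ j) : divDiff i j (X (Sum.inl j)) = -1 :=
  divDiff_eq_of h (by rw [zPerm_inl, Equiv.swap_apply_right, zDiff]; ring)

lemma divDiff_z_of_ne {i j k : Fin N} (hi : k ≠ i) (hj : k ≠ j) :
    divDiff i j (X (Sum.inl k)) = 0 :=
  divDiff_eq_zero (by rw [zPerm_inl, Equiv.swap_apply_of_ne_of_ne hi hj])

/-- The pairs `{i, a}` and `{j, b}` are disjoint, so the transpositions commute and each fixes the
denominator of the other. -/
lemma divDiff_comm {i j a b : Fin N} (hij : i ≠ j) (hib : i ≠ b) (haj : a ≠ j) (hab : a ≠ b)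
    (f : PolyZL N) : divDiff i a (divDiff j b f) = divDiff j b (divDiff i a f) := by
  by_cases h1 : i = a
  · subst h1; simp [divDiff_self]
  by_cases h2 : j = b
  · subst h2; simp [divDiff_self]
  refine divDiff_eq_of h1 ?_
  refine mul_left_cancel₀ (zDiff_ne_zero h2) ?_
  have e1 := zDiff_mul_divDiff j b (divDiff i a f)
  have e2 := zDiff_mul_divDiff i a f
  have e3 := zDiff_mul_divDiff j b f
  have e4 := congrArg (zPerm (Equiv.swap i a)) e3
  have e5 := congrArg (zPerm (Equiv.swap j b)) e2
  rw [map_mul, map_sub, zPerm_zDiff, Equiv.swap_apply_of_ne_of_ne hij.symm haj.symm,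
    Equiv.swap_apply_of_ne_of_ne hib.symm hab.symm] at e4
  rw [map_mul, map_sub, zPerm_zDiff, Equiv.swap_apply_of_ne_of_ne hij hib,
    Equiv.swap_apply_of_ne_of_ne haj hab] at e5
  have e6 : zPerm (Equiv.swap i a) (zPerm (Equiv.swap j b) f)
      = zPerm (Equiv.swap j b) (zPerm (Equiv.swap i a) f) := by
    rw [← zPerm_mul, ← zPerm_mul, Equiv.mul_swap_eq_swap_mul,
      Equiv.swap_apply_of_ne_of_ne hij.symm haj.symm,
      Equiv.swap_apply_of_ne_of_ne hib.symm hab.symm]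
  linear_combination zDiff i a * e1 + e2 - e5 - e3 + e4 - e6

/-- The three-term relation for divided differences. -/
lemma divDiff_three {i j a : Fin N} (hij : i ≠ j) (hia : i ≠ a) (hja : j ≠ a) (f : PolyZL N) :
    divDiff i a (divDiff j a f)
      = divDiff j a (divDiff i j f) + divDiff j i (divDiff i a f) := by
  have h := mul_ne_zero (mul_ne_zero (zDiff_ne_zero hia) (zDiff_ne_zero hja))
    (zDiff_ne_zero hij.symm)
  refine mul_left_cancel₀ h ?_
  have a1 := zDiff_mul_divDiff j a f
  have a2 := congrArg (zPerm (Equiv.swap i a)) a1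
  have a3 := zDiff_mul_divDiff i a (divDiff j a f)
  have b1 := zDiff_mul_divDiff i j f
  have b2 := congrArg (zPerm (Equiv.swap j a)) b1
  have b3 := zDiff_mul_divDiff j a (divDiff i j f)
  have c1 := zDiff_mul_divDiff i a f
  have c2 := congrArg (zPerm (Equiv.swap j i)) c1
  have c3 := zDiff_mul_divDiff j i (divDiff i a f)
  rw [map_mul, map_sub, zPerm_zDiff, Equiv.swap_apply_of_ne_of_ne hij.symm hja,
    Equiv.swap_apply_right, ← zPerm_mul] at a2
  rw [map_mul, map_sub, zPerm_zDiff, Equiv.swap_apply_of_ne_of_ne hij hia,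
    Equiv.swap_apply_left, ← zPerm_mul] at b2
  rw [map_mul, map_sub, zPerm_zDiff, Equiv.swap_apply_of_ne_of_ne hja.symm hia.symm,
    Equiv.swap_apply_right, ← zPerm_mul] at c2
  -- The three products of transpositions are one and the same 3-cycle. Once they are identified,
  -- clearing denominators leaves a polynomial identity.
  have p1 : Equiv.swap i a * Equiv.swap j a = Equiv.swap j a * Equiv.swap i j := by
    rw [Equiv.mul_swap_eq_swap_mul (Equiv.swap j a), Equiv.swap_apply_of_ne_of_ne hij hia,
      Equiv.swap_apply_left]
  have p2 : Equiv.swap j i * Equiv.swap i a = Equiv.swap j a * Equiv.swap i j := by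
    rw [Equiv.mul_swap_eq_swap_mul (Equiv.swap j i), Equiv.swap_apply_right,
      Equiv.swap_apply_of_ne_of_ne hja.symm hia.symm, Equiv.swap_comm j i]
  rw [p1] at a2
  rw [p2] at c2
  rw [Equiv.swap_comm j i] at c2 c3
  simp only [zDiff] at *
  set z1 : PolyZL N := X (Sum.inl i)
  set z2 : PolyZL N := X (Sum.inl j)
  set z3 : PolyZL N := X (Sum.inl a)
  linear_combination (z2 - z3) * (z2 - z1) * a3 + (z2 - z1) * a1 - (z2 - z3) * a2
    - (z1 - z3) * (z2 - z1) * b3 + (z1 - z3) * b1 + (z2 - z1) * b2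
    - (z1 - z3) * (z2 - z3) * c3 - (z2 - z3) * c1 + (z1 - z3) * c2

end DividedDifference

/-! ### The polynomial representation -/

section Rep

variable {N : ℕ}

/-- The space of functions on permutations with polynomial values. -/
abbrev PermMod (N : ℕ) : Type := Equiv.Perm (Fin N) → PolyZL N

/-- Multiplication by `z_k`. -/
def zOp (k : Fin N) : Module.End ℂ (PermMod N) :=
  LinearMap.pi fun τ => LinearMap.mulLeft ℂ (X (Sum.inl k)) ∘ₗ LinearMap.proj τ

/-- The action of permutations. -/
def permOp : Equiv.Perm (Fin N) →* Module.End ℂ (PermMod N) where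
  toFun σ := LinearMap.pi fun τ => (zPerm σ).toLinearMap ∘ₗ LinearMap.proj (τ * σ)
  map_one' := LinearMap.ext fun m => funext fun τ => by
    change zPerm 1 (m (τ * 1)) = m τ
    rw [zPerm_one, mul_one]
  map_mul' σ ρ := LinearMap.ext fun m => funext fun τ => by
    change zPerm (σ * ρ) (m (τ * (σ * ρ))) = zPerm σ (zPerm ρ (m (τ * σ * ρ)))
    rw [zPerm_mul, mul_assoc]

/-- The diagonal part of the action of `y_j`. -/
def lamOp (j : Fin N) : Module.End ℂ (PermMod N) :=
  LinearMap.pi fun τ => LinearMap.mulLeft ℂ (X (Sum.inr (τ j))) ∘ₗ LinearMap.proj τ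

/-- The divided difference part of the action of `y_j`. -/
def divOp (j a : Fin N) : Module.End ℂ (PermMod N) :=
  LinearMap.pi fun τ => divDiff j a ∘ₗ LinearMap.proj (τ * Equiv.swap j a)

/-- The action of `y_j`. -/
def dunklOp (j : Fin N) : Module.End ℂ (PermMod N) := lamOp j + ∑ a, divOp j a

lemma permOp_apply (σ : Equiv.Perm (Fin N)) (m : PermMod N) (τ) :
    permOp σ m τ = zPerm σ (m (τ * σ)) := rfl

lemma lamOp_apply (j : Fin N) (m : PermMod N) (τ) : lamOp j m τ = X (Sum.inr (τ j)) * m τ := rfl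

lemma divOp_apply (j a : Fin N) (m : PermMod N) (τ) :
    divOp j a m τ = divDiff j a (m (τ * Equiv.swap j a)) := rfl

lemma dunklOp_apply (j : Fin N) (m : PermMod N) (τ) : dunklOp j m τ
    = X (Sum.inr (τ j)) * m τ + ∑ a, divDiff j a (m (τ * Equiv.swap j a)) := by
  rw [dunklOp, LinearMap.add_apply, LinearMap.sum_apply, Pi.add_apply, Finset.sum_apply]
  rfl

lemma zOp_comm (i j : Fin N) : zOp i * zOp j = zOp j * zOp i :=
  LinearMap.ext fun _ => funext fun _ => mul_left_comm _ _ _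

lemma permOp_mul_zOp (σ : Equiv.Perm (Fin N)) (k : Fin N) :
    permOp σ * zOp k = zOp (σ k) * permOp σ := by
  refine LinearMap.ext fun m => funext fun τ => ?_
  change zPerm σ (X (Sum.inl k) * m (τ * σ)) = X (Sum.inl (σ k)) * zPerm σ (m (τ * σ))
  rw [map_mul, zPerm_inl]

lemma permOp_mul_dunklOp (σ : Equiv.Perm (Fin N)) (k : Fin N) :
    permOp σ * dunklOp k = dunklOp (σ k) * permOp σ := by
  refine LinearMap.ext fun m => funext fun τ => ?_
  rw [Module.End.mul_apply, Module.End.mul_apply, permOp_apply, dunklOp_apply, dunklOp_apply,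
    map_add, map_mul, zPerm_inr, permOp_apply, map_sum, Equiv.Perm.mul_apply]
  congr 1
  rw [← Equiv.sum_comp σ fun a => divDiff (σ k) a _]
  refine Finset.sum_congr rfl fun a _ => ?_
  rw [permOp_apply, zPerm_divDiff, mul_assoc, mul_assoc, Equiv.mul_swap_eq_swap_mul]

lemma zOp_mul_divOp {i j a : Fin N} (hi : i ≠ j) (ha : i ≠ a) :
    zOp i * divOp j a = divOp j a * zOp i := by
  refine LinearMap.ext fun m => funext fun τ => ?_
  change X (Sum.inl i) * divDiff j a _ = divDiff j a (X (Sum.inl i) * _)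
  rw [divDiff_mul, divDiff_z_of_ne hi ha, zero_mul, add_zero]

lemma zOp_mul_divOp_right {i j : Fin N} (h : i ≠ j) :
    zOp i * divOp j i = divOp j i * zOp i + permOp (Equiv.swap i j) := by
  refine LinearMap.ext fun m => funext fun τ => ?_
  change X (Sum.inl i) * divDiff j i (m (τ * Equiv.swap j i))
    = divDiff j i (X (Sum.inl i) * m (τ * Equiv.swap j i))
      + zPerm (Equiv.swap i j) (m (τ * Equiv.swap i j))
  rw [divDiff_mul, divDiff_z_right h.symm, Equiv.swap_comm i j]
  ring

lemma zOp_mul_divOp_left {j a : Fin N} (h : a ≠ j) :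
    zOp j * divOp j a = divOp j a * zOp j - permOp (Equiv.swap j a) := by
  refine LinearMap.ext fun m => funext fun τ => ?_
  change X (Sum.inl j) * divDiff j a (m (τ * Equiv.swap j a))
    = divDiff j a (X (Sum.inl j) * m (τ * Equiv.swap j a))
      - zPerm (Equiv.swap j a) (m (τ * Equiv.swap j a))
  rw [divDiff_mul, divDiff_z_left h.symm]
  ring

lemma divOp_self (i : Fin N) : divOp i i = 0 := by
  refine LinearMap.ext fun m => funext fun τ => ?_
  rw [divOp_apply, divDiff_self]
  rfl

lemma zOp_mul_lamOp (i j : Fin N) : zOp i * lamOp j = lamOp j * zOp i :=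
  LinearMap.ext fun _ => funext fun _ => mul_left_comm _ _ _

/-- By the Leibniz rule `z_i` commutes with every divided difference in `j, a` for `a ≠ i`; the
single exception `a = i` contributes the transposition. -/
lemma zOp_mul_dunklOp {i j : Fin N} (h : i ≠ j) :
    zOp i * dunklOp j = dunklOp j * zOp i + permOp (Equiv.swap i j) := by
  rw [dunklOp, mul_add, add_mul, zOp_mul_lamOp, Finset.mul_sum, Finset.sum_mul,
    ← Finset.add_sum_erase _ _ (Finset.mem_univ i), ← Finset.add_sum_erase _ _ (Finset.mem_univ i),
    zOp_mul_divOp_right h,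
    Finset.sum_congr rfl fun a ha => zOp_mul_divOp h (Finset.ne_of_mem_erase ha).symm]
  abel

lemma zOp_mul_dunklOp_self (i : Fin N) : zOp i * dunklOp i = dunklOp i * zOp i
    - ∑ a ∈ Finset.univ.erase i, permOp (Equiv.swap i a) := by
  rw [dunklOp, mul_add, add_mul, zOp_mul_lamOp, Finset.mul_sum, Finset.sum_mul,
    ← Finset.add_sum_erase _ _ (Finset.mem_univ i), ← Finset.add_sum_erase _ _ (Finset.mem_univ i),
    Finset.sum_congr rfl fun a ha => zOp_mul_divOp_left (Finset.ne_of_mem_erase ha),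
    Finset.sum_sub_distrib, divOp_self, mul_zero, zero_mul]
  abel

/-- A criterion for commutativity of Dunkl operators. -/
lemma add_sum_comm {R : Type*} [Ring R] (L : Fin N → R) (Q : Fin N → Fin N → R) {i j : Fin N}
    (hij : i ≠ j) (hL : L i * L j = L j * L i) (hself : ∀ a, Q a a = 0)
    (hLQ : ∀ i j a, i ≠ j → a ≠ i → L i * Q j a = Q j a * L i)
    (hLQ' : L i * Q j i - Q j i * L i = L j * Q i j - Q i j * L j)
    (hQ : ∀ i j a b, i ≠ j → i ≠ b → a ≠ j → a ≠ b → Q i a * Q j b = Q j b * Q i a)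
    (hQ' : Q i j * Q j i = Q j i * Q i j)
    (h3 : ∀ a, a ≠ i → a ≠ j → Q i a * Q j a - Q j a * Q i a
      + (Q i j * Q j a - Q j a * Q i j) + (Q i a * Q j i - Q j i * Q i a) = 0) :
    (L i + ∑ a, Q i a) * (L j + ∑ a, Q j a) = (L j + ∑ a, Q j a) * (L i + ∑ a, Q i a) := by
  have e1 : ∀ i j : Fin N, i ≠ j →
      L i * (∑ a, Q j a) - (∑ a, Q j a) * L i = L i * Q j i - Q j i * L i := by
    intro i j hij
    rw [Finset.mul_sum, Finset.sum_mul, ← Finset.sum_sub_distrib, Finset.sum_eq_single i]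
    · intro a _ ha
      rw [hLQ i j a hij ha, sub_self]
    · simp
  have e2 : (∑ a, Q i a) * (∑ b, Q j b) - (∑ b, Q j b) * (∑ a, Q i a) = 0 := by
    -- For different `i` and `j`, the operators `Q i a` and `Q j b` can fail to commute only if `a =
    -- b`, `a = j` or `b = i`. Collecting these three cases by the remaining free index gives the
    -- three-term hypothesis.
    have key : ∀ a b, Q i a * Q j b - Q j b * Q i a
        = (if a = b then Q i a * Q j a - Q j a * Q i a else 0)
          + (if a = j then Q i j * Q j b - Q j b * Q i j else 0)
          + (if b = i then Q i a * Q j i - Q j i * Q i a else 0) := by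
      intro a b
      by_cases h1 : a = i
      · subst h1
        by_cases h2 : b = a
        · subst h2; simp [hself, hij]
        · simp [hself, hij, h2]
      by_cases h2 : b = j
      · subst h2
        by_cases h3 : a = b
        · subst h3; simp [hself, hij.symm]
        · simp [hself, hij.symm, h3]
      by_cases h4 : a = j
      · subst h4
        by_cases h5 : b = i
        · subst h5
          rw [hQ']; simp [h1]
        · simp [Ne.symm h2, h5]
      by_cases h5 : b = i
      · subst h5; simp [h1, h4]
      by_cases h6 : a = b
      · subst h6; simp [h4, h5]
      · rw [hQ i j a b hij (Ne.symm h5) h4 h6]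
        simp [h4, h5, h6]
    rw [Finset.sum_mul_sum, Finset.sum_mul_sum, Finset.sum_comm (s := Finset.univ)
      (f := fun b a => Q j b * Q i a), ← Finset.sum_sub_distrib]
    have e0 : ∑ a, (∑ b, Q i a * Q j b - ∑ b, Q j b * Q i a) = ∑ a, ∑ b,
        ((if a = b then Q i a * Q j a - Q j a * Q i a else 0)
          + (if a = j then Q i j * Q j b - Q j b * Q i j else 0)
          + (if b = i then Q i a * Q j i - Q j i * Q i a else 0)) :=
      Finset.sum_congr rfl fun a _ => by
        rw [← Finset.sum_sub_distrib]
        exact Finset.sum_congr rfl fun b _ => key a b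
    rw [e0]
    simp only [Finset.sum_add_distrib]
    have s1 : ∑ a, ∑ b, (if a = b then Q i a * Q j a - Q j a * Q i a else 0)
        = ∑ a, (Q i a * Q j a - Q j a * Q i a) := by simp
    have s2 : ∑ a, ∑ b, (if a = j then Q i j * Q j b - Q j b * Q i j else 0)
        = ∑ b, (Q i j * Q j b - Q j b * Q i j) := by
      rw [Finset.sum_comm]
      simp
    have s3 : ∑ a, ∑ b, (if b = i then Q i a * Q j i - Q j i * Q i a else 0)
        = ∑ a, (Q i a * Q j i - Q j i * Q i a) := by simp
    rw [s1, s2, s3, ← Finset.sum_add_distrib, ← Finset.sum_add_distrib]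
    refine Finset.sum_eq_zero fun a _ => ?_
    by_cases h1 : a = i
    · subst h1; rw [hself, hQ']; simp
    by_cases h2 : a = j
    · subst h2; rw [hself, hQ']; simp
    exact h3 a h1 h2
  have e3 := e1 i j hij
  have e4 := e1 j i hij.symm
  rw [← sub_eq_zero]
  have : (L i + ∑ a, Q i a) * (L j + ∑ a, Q j a) - (L j + ∑ a, Q j a) * (L i + ∑ a, Q i a)
      = (L i * L j - L j * L i) + (L i * (∑ a, Q j a) - (∑ a, Q j a) * L i)
        - (L j * (∑ a, Q i a) - (∑ a, Q i a) * L j)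
        + ((∑ a, Q i a) * (∑ b, Q j b) - (∑ b, Q j b) * (∑ a, Q i a)) := by
    noncomm_ring
  rw [this, e2, e3, e4, hL, hLQ']
  abel

lemma divOp_mul_apply (i a j b : Fin N) (m : PermMod N) (τ) :
    (divOp i a * divOp j b) m τ
      = divDiff i a (divDiff j b (m (τ * (Equiv.swap i a * Equiv.swap j b)))) := by
  rw [← mul_assoc]
  rfl

/-- The mixed terms of `λ` and divided differences cancel because divided differences are
antisymmetric in their indices. The remaining commutators cancel by the three-term relation. -/
lemma dunklOp_comm (i j : Fin N) : dunklOp i * dunklOp j = dunklOp j * dunklOp i := by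
  by_cases hij : i = j
  · rw [hij]
  refine add_sum_comm (R := Module.End ℂ (PermMod N)) lamOp divOp hij ?_ divOp_self ?_ ?_ ?_ ?_ ?_
  · exact LinearMap.ext fun _ => funext fun _ => mul_left_comm _ _ _
  · intro i j a hij ha
    refine LinearMap.ext fun m => funext fun τ => ?_
    rw [Module.End.mul_apply, Module.End.mul_apply, lamOp_apply, divOp_apply, divOp_apply,
      lamOp_apply, divDiff_lam_mul, Equiv.Perm.mul_apply,
      Equiv.swap_apply_of_ne_of_ne hij (Ne.symm ha)]
  · have : ∀ i j : Fin N, ∀ m : PermMod N, ∀ τ, (lamOp i * divOp j i - divOp j i * lamOp i) m τ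
        = (X (Sum.inr (τ i)) - X (Sum.inr (τ j))) * divDiff j i (m (τ * Equiv.swap j i)) := by
      intro i j m τ
      rw [LinearMap.sub_apply, Pi.sub_apply, Module.End.mul_apply, Module.End.mul_apply,
        lamOp_apply, divOp_apply, divOp_apply, lamOp_apply, divDiff_lam_mul, Equiv.Perm.mul_apply,
        Equiv.swap_apply_right, sub_mul]
    refine LinearMap.ext fun m => funext fun τ => ?_
    rw [this, this, divDiff_symm, Equiv.swap_comm]
    ring
  · intro i j a b hij hib haj hab
    refine LinearMap.ext fun m => funext fun τ => ?_
    rw [divOp_mul_apply, divOp_mul_apply, divDiff_comm hij hib haj hab,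
      Equiv.mul_swap_eq_swap_mul (Equiv.swap i a),
      Equiv.swap_apply_of_ne_of_ne hij.symm haj.symm,
      Equiv.swap_apply_of_ne_of_ne hib.symm hab.symm]
  · refine LinearMap.ext fun m => funext fun τ => ?_
    rw [divOp_mul_apply, divOp_mul_apply, Equiv.swap_comm j i, divDiff_symm j i (divDiff i j _),
      divDiff_symm j i, map_neg]
  · intro a hai haj
    refine LinearMap.ext fun m => funext fun τ => ?_
    simp only [LinearMap.add_apply, LinearMap.sub_apply, Pi.add_apply, Pi.sub_apply,
      divOp_mul_apply, LinearMap.zero_apply, Pi.zero_apply]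
    have p1 : Equiv.swap i a * Equiv.swap j a = Equiv.swap j a * Equiv.swap i j := by
      rw [Equiv.mul_swap_eq_swap_mul (Equiv.swap j a), Equiv.swap_apply_of_ne_of_ne hij hai.symm,
        Equiv.swap_apply_left]
    have p2 : Equiv.swap j i * Equiv.swap i a = Equiv.swap j a * Equiv.swap i j := by
      rw [Equiv.mul_swap_eq_swap_mul (Equiv.swap j i), Equiv.swap_apply_right,
        Equiv.swap_apply_of_ne_of_ne haj hai, Equiv.swap_comm j i]
    have q1 : Equiv.swap j a * Equiv.swap i a = Equiv.swap i a * Equiv.swap j i := by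
      rw [Equiv.mul_swap_eq_swap_mul (Equiv.swap i a),
        Equiv.swap_apply_of_ne_of_ne (Ne.symm hij) haj.symm, Equiv.swap_apply_left]
    have q2 : Equiv.swap i j * Equiv.swap j a = Equiv.swap i a * Equiv.swap j i := by
      rw [Equiv.mul_swap_eq_swap_mul (Equiv.swap i j), Equiv.swap_apply_right,
        Equiv.swap_apply_of_ne_of_ne hai haj, Equiv.swap_comm j i]
    -- All six products now involve one of two mutually inverse 3-cycles, and each of the two groups
    -- is an instance of the three-term relation.
    rw [p1, p2, q1, q2]
    have t1 := divDiff_three hij hai.symm haj.symm (m (τ * (Equiv.swap j a * Equiv.swap i j)))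
    have t2 := divDiff_three (Ne.symm hij) haj.symm hai.symm
      (m (τ * (Equiv.swap i a * Equiv.swap j i)))
    linear_combination t1 - t2

lemma dunkl_rel {a b : FreeAlgebra ℂ (Gen N)} (h : CherednikRel N a b) :
    FreeAlgebra.lift ℂ (fun g : Gen N => match g with
      | .x i => zOp i
      | .y i => dunklOp i
      | .s j k _ => permOp (Equiv.swap j k)) a
    = FreeAlgebra.lift ℂ (fun g : Gen N => match g with
      | .x i => zOp i
      | .y i => dunklOp i
      | .s j k _ => permOp (Equiv.swap j k)) b := by
  set φ := FreeAlgebra.lift ℂ (fun g : Gen N => match g with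
      | .x i => zOp i
      | .y i => dunklOp i
      | .s j k _ => permOp (Equiv.swap j k))
  have lx : ∀ i, φ (Free.x i) = zOp i := fun i => FreeAlgebra.lift_ι_apply _ _
  have ly : ∀ i, φ (Free.y i) = dunklOp i := fun i => FreeAlgebra.lift_ι_apply _ _
  have ls : ∀ j k h, φ (Free.s j k h) = permOp (Equiv.swap j k) :=
    fun j k h => FreeAlgebra.lift_ι_apply _ _
  cases h with
  | s_symm i j h => rw [ls, ls, Equiv.swap_comm]
  | s_sq i j h => rw [map_mul, ls, ← map_mul, Equiv.swap_mul_self, map_one, map_one]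
  | s_braid i j k hij hjk hik =>
    rw [map_mul, map_mul, ls, ls, ls, ← map_mul, ← map_mul,
      Equiv.mul_swap_eq_swap_mul (Equiv.swap i j), Equiv.swap_apply_right,
      Equiv.swap_apply_of_ne_of_ne hik.symm hjk.symm]
  | s_comm i j k l hij hkl hik hil hjk hjl =>
    rw [map_mul, map_mul, ls, ls, ← map_mul, ← map_mul,
      Equiv.mul_swap_eq_swap_mul (Equiv.swap i j), Equiv.swap_apply_of_ne_of_ne hik.symm hjk.symm,
      Equiv.swap_apply_of_ne_of_ne hil.symm hjl.symm]
  | x_comm i j h => rw [map_sub, map_mul, map_mul, lx, lx, zOp_comm, sub_self, map_zero]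
  | y_comm i j h => rw [map_sub, map_mul, map_mul, ly, ly, dunklOp_comm, sub_self, map_zero]
  | s_x i j h => rw [map_mul, map_mul, ls, lx, lx, permOp_mul_zOp, Equiv.swap_apply_left]
  | s_y i j h => rw [map_mul, map_mul, ls, ly, ly, permOp_mul_dunklOp, Equiv.swap_apply_left]
  | s_x_comm i j k h hki hkj =>
    rw [map_sub, map_mul, map_mul, ls, lx, permOp_mul_zOp, Equiv.swap_apply_of_ne_of_ne hki hkj,
      sub_self, map_zero]
  | s_y_comm i j k h hki hkj =>
    rw [map_sub, map_mul, map_mul, ls, ly, permOp_mul_dunklOp,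
      Equiv.swap_apply_of_ne_of_ne hki hkj, sub_self, map_zero]
  | x_y i j h =>
    rw [map_sub, map_mul, map_mul, ls, lx, ly, zOp_mul_dunklOp h, add_sub_cancel_left]
  | x_y_self i =>
    rw [map_sub, map_mul, map_mul, lx, ly, map_neg, map_sum, zOp_mul_dunklOp_self,
      sub_sub_cancel_left]
    simp only [ls]
    congr 1
    exact Finset.sum_subtype (F := inferInstance) (Finset.univ.erase i) (p := fun a => a ≠ i)
      (by simp) (fun a => permOp (Equiv.swap i a))

/-- The representation of `H_N` by Dunkl operators. -/
def dunklRep (N : ℕ) : Cherednik N →ₐ[ℂ] Module.End ℂ (PermMod N) :=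
  RingQuot.liftAlgHom ℂ ⟨FreeAlgebra.lift ℂ fun g : Gen N => match g with
      | .x i => zOp i
      | .y i => dunklOp i
      | .s j k _ => permOp (Equiv.swap j k), fun _ _ h => dunkl_rel h⟩

lemma dunklRep_xH (i : Fin N) : dunklRep N (xH i) = zOp i := by
  rw [xH, dunklRep, RingQuot.liftAlgHom_mkAlgHom_apply]
  exact FreeAlgebra.lift_ι_apply _ _

lemma dunklRep_yH (i : Fin N) : dunklRep N (yH i) = dunklOp i := by
  rw [yH, dunklRep, RingQuot.liftAlgHom_mkAlgHom_apply]
  exact FreeAlgebra.lift_ι_apply _ _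

lemma dunklRep_sH (i j : Fin N) : dunklRep N (sH i j) = permOp (Equiv.swap i j) := by
  by_cases h : i = j
  · subst h; rw [sH_self, map_one, Equiv.swap_self]; exact (map_one permOp).symm
  · rw [sH, dif_pos h, dunklRep, RingQuot.liftAlgHom_mkAlgHom_apply]
    exact FreeAlgebra.lift_ι_apply _ _

lemma dunklRep_permH (σ : Equiv.Perm (Fin N)) : dunklRep N (permH N σ) = permOp σ := by
  induction σ using Equiv.Perm.swap_induction_on with
  | one => simp
  | swap_mul f a b _ ih => rw [map_mul, map_mul, ih, permH_swap, dunklRep_sH, map_mul]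

lemma dunklRep_xPoly (p : MvPolynomial (Fin N) ℂ) (m : PermMod N) :
    dunklRep N (xPoly N p) m = (rename Sum.inl p : PolyZL N) • m := by
  induction p using MvPolynomial.induction_on generalizing m with
  | C r =>
    rw [← algebraMap_eq, AlgHom.commutes, AlgHom.commutes, AlgHom.commutes]
    funext τ
    rw [Module.algebraMap_end_apply]
    exact Algebra.smul_def r (m τ)
  | add p q hp hq => rw [map_add, map_add, LinearMap.add_apply, hp, hq, map_add, add_smul]
  | mul_X p i hp =>
    rw [map_mul, map_mul, Module.End.mul_apply, hp, xPoly_X, dunklRep_xH, map_mul, mul_smul,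
      rename_X]
    rfl

/-- A divided difference kills functions that are free of `z`, so on such functions only the
diagonal part of `y_j` survives. -/
lemma dunklOp_single (j : Fin N) (τ : Equiv.Perm (Fin N)) (q : MvPolynomial (Fin N) ℂ) :
    dunklOp j (Pi.single τ (rename Sum.inr q))
      = Pi.single τ (X (Sum.inr (τ j)) * rename Sum.inr q) := by
  have hz : ∀ σ : Equiv.Perm (Fin N), zPerm σ (rename Sum.inr q) = rename Sum.inr q := by
    intro σ
    rw [zPerm, rename_rename]
    rfl
  funext ρ
  rw [dunklOp_apply, Finset.sum_eq_zero, add_zero]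
  · by_cases h : ρ = τ
    · subst h; rw [Pi.single_eq_same, Pi.single_eq_same]
    · rw [Pi.single_eq_of_ne h, Pi.single_eq_of_ne h, mul_zero]
  · intro a _
    refine divDiff_eq_zero ?_
    by_cases h : ρ * Equiv.swap j a = τ
    · rw [h, Pi.single_eq_same, hz]
    · rw [Pi.single_eq_of_ne h, map_zero]

lemma dunklRep_yPoly_single (q : MvPolynomial (Fin N) ℂ) (τ : Equiv.Perm (Fin N)) :
    dunklRep N (yPoly N q) (Pi.single τ 1) = Pi.single τ (rename Sum.inr (rename τ q)) := by
  induction q using MvPolynomial.induction_on with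
  | C r =>
    rw [← algebraMap_eq, AlgHom.commutes, AlgHom.commutes, AlgHom.commutes, AlgHom.commutes,
      Module.algebraMap_end_apply, ← Pi.single_smul, Algebra.smul_def, mul_one]
  | add p q hp hq =>
    rw [map_add, map_add, LinearMap.add_apply, hp, hq, map_add, map_add, Pi.single_add]
  | mul_X p i hp =>
    rw [mul_comm, map_mul, map_mul, Module.End.mul_apply, hp, yPoly_X, dunklRep_yH,
      dunklOp_single, map_mul, map_mul, rename_X, rename_X]

/-- In a normally ordered product the `y`'s act first, while the value is still free of `z`, and
hence diagonally; afterwards the `x`'s multiply. So `:f:` acts on a basis vector by multiplication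
by `f(z, λ_τ)`. -/
lemma dunklRep_normalOrder_single (f : PolyXY N) (τ : Equiv.Perm (Fin N)) :
    dunklRep N (normalOrder N f) (Pi.single τ 1) = Pi.single τ (rename (Sum.map id τ) f) := by
  induction f using polySum_induction with
  | hadd f g hf hg =>
    rw [map_add, map_add, LinearMap.add_apply, hf, hg, map_add, Pi.single_add]
  | hmon a b c =>
    rw [normalOrder_rename, map_mul, Module.End.mul_apply, dunklRep_yPoly_single, dunklRep_xPoly,
      ← Pi.single_smul, smul_eq_mul, map_mul, rename_rename, rename_rename, rename_rename]
    rfl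

lemma permOp_single (σ ρ : Equiv.Perm (Fin N)) :
    permOp σ (Pi.single ρ 1) = Pi.single (ρ * σ⁻¹) 1 := by
  funext τ
  rw [permOp_apply]
  by_cases h : τ = ρ * σ⁻¹
  · subst h; rw [inv_mul_cancel_right, Pi.single_eq_same, Pi.single_eq_same, map_one]
  · rw [Pi.single_eq_of_ne h, Pi.single_eq_of_ne, map_zero]
    rintro rfl
    exact h (mul_inv_cancel_right _ _).symm

lemma dunklRep_single (f : PolyXY N) (σ ρ : Equiv.Perm (Fin N)) :
    dunklRep N (normalOrder N f * permH N σ) (Pi.single ρ 1)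
      = Pi.single (ρ * σ⁻¹) (rename (Sum.map id (ρ * σ⁻¹ : Equiv.Perm (Fin N))) f) := by
  rw [map_mul, Module.End.mul_apply, dunklRep_permH, permOp_single, dunklRep_normalOrder_single]

lemma dunklRep_pbw (g : Equiv.Perm (Fin N) → PolyXY N) (σ : Equiv.Perm (Fin N)) :
    dunklRep N (pbw N g) (Pi.single 1 1) σ⁻¹
      = rename (Sum.map id (σ⁻¹ : Equiv.Perm (Fin N))) (g σ) := by
  rw [pbw_apply, map_sum, LinearMap.sum_apply, Finset.sum_apply, Finset.sum_eq_single σ]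
  · rw [dunklRep_single, one_mul, Pi.single_eq_same]
  · intro ρ _ h
    rw [dunklRep_single, one_mul, Pi.single_eq_of_ne]
    exact fun e => h (inv_injective e).symm
  · simp

/-- Applied to the basis vector of the identity, the different `σ` land on different basis vectors,
and the coefficient found there is `f_σ` up to a renaming of variables. -/
lemma pbw_injective : Function.Injective (pbw N) := by
  rw [← LinearMap.ker_eq_bot, LinearMap.ker_eq_bot']
  intro g hg
  funext σ
  have h := dunklRep_pbw g σ
  rw [hg, map_zero, LinearMap.zero_apply, Pi.zero_apply] at h
  refine rename_injective (Sum.map id (σ⁻¹ : Equiv.Perm (Fin N)))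
    (Sum.map_injective.mpr ⟨Function.injective_id, σ⁻¹.injective⟩) ?_
  rw [Pi.zero_apply, map_zero]
  exact h.symm

lemma dunklRep_injective : Function.Injective (dunklRep N) := by
  rw [injective_iff_map_eq_zero]
  intro h hh
  obtain ⟨g, rfl⟩ := pbw_surjective h
  have : g = 0 := by
    funext σ
    have h := dunklRep_pbw g σ
    rw [hh, LinearMap.zero_apply, Pi.zero_apply] at h
    refine rename_injective (Sum.map id (σ⁻¹ : Equiv.Perm (Fin N)))
      (Sum.map_injective.mpr ⟨Function.injective_id, σ⁻¹.injective⟩) ?_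
    rw [Pi.zero_apply, map_zero]
    exact h.symm
  rw [this, map_zero]

/-- Permutations and divided differences involve only the `z`, so they are linear over `ℂ[λ]`; the
diagonal part of `y_j` is itself a multiplication. -/
lemma dunklRep_lam_smul (h : Cherednik N) (k : Fin N) (m : PermMod N) :
    dunklRep N h ((X (Sum.inr k) : PolyZL N) • m) = (X (Sum.inr k) : PolyZL N) • dunklRep N h m := by
  induction h using cherednik_induction generalizing m with
  | hx i =>
    rw [dunklRep_xH]
    exact funext fun τ => mul_left_comm _ _ _
  | hy i =>
    rw [dunklRep_yH]
    funext τ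
    rw [Pi.smul_apply, dunklOp_apply, dunklOp_apply, smul_add, Finset.smul_sum]
    simp only [Pi.smul_apply, smul_eq_mul, divDiff_lam_mul]
    rw [mul_left_comm]
  | hs i j =>
    rw [dunklRep_sH]
    funext τ
    rw [Pi.smul_apply, permOp_apply, permOp_apply, Pi.smul_apply, smul_eq_mul, smul_eq_mul, map_mul,
      zPerm_inr]
  | hc r =>
    rw [AlgHom.commutes, Module.algebraMap_end_apply, Module.algebraMap_end_apply, smul_comm]
  | hadd a b ha hb => rw [map_add, LinearMap.add_apply, LinearMap.add_apply, ha, hb, smul_add]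
  | hmul a b ha hb => rw [map_mul, Module.End.mul_apply, Module.End.mul_apply, hb, ha]

/-- Central elements act by operators that are linear over `ℂ[z, λ]`. -/
lemma dunklRep_smul_of_commute {c : Cherednik N} (hc : ∀ i, c * xH i = xH i * c) (p : PolyZL N)
    (m : PermMod N) : dunklRep N c (p • m) = p • dunklRep N c m := by
  induction p using MvPolynomial.induction_on generalizing m with
  | C r =>
    rw [← algebraMap_eq]
    simp only [algebraMap_smul, map_smul]
  | add p q hp hq => rw [add_smul, map_add, hp, hq, add_smul]
  | mul_X p i hp =>
    rw [mul_smul, hp, mul_smul]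
    congr 1
    cases i with
    | inr k => exact dunklRep_lam_smul c k m
    | inl k =>
      have := LinearMap.congr_fun (congrArg (dunklRep N) (hc k)) m
      rw [map_mul, map_mul, dunklRep_xH, Module.End.mul_apply, Module.End.mul_apply] at this
      exact this

end Rep

end BetheCherednik

end

noncomputable section

namespace BetheCherednik

/-! ### Systems of elements that satisfy the relations of the Cherednik algebra -/

/-- Elements of an algebra that satisfy the relations of `H_N`. -/
structure CherednikSystem (N : ℕ) (R : Type*) [Ring R] where
  x : Fin N → R
  y : Fin N → R
  perm : Equiv.Perm (Fin N) →* R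
  x_comm : ∀ i j, x i * x j = x j * x i
  y_comm : ∀ i j, y i * y j = y j * y i
  perm_x : ∀ σ k, perm σ * x k = x (σ k) * perm σ
  perm_y : ∀ σ k, perm σ * y k = y (σ k) * perm σ
  x_y : ∀ i j, i ≠ j → x i * y j = y j * x i + perm (Equiv.swap i j)
  x_y_self : ∀ i, x i * y i = y i * x i - ∑ a ∈ Finset.univ.erase i, perm (Equiv.swap i a)

namespace CherednikSystem

variable {N : ℕ} {R : Type*} [Ring R] (S : CherednikSystem N R)

/-- `∑ (-1)^σ σ` over the permutations `σ` of `C`. -/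
def antisym (C : Finset (Fin N)) : R :=
  ∑ σ ∈ Finset.univ.filter (fun σ : Equiv.Perm (Fin N) => ∀ i, i ∉ C → σ i = i),
    ((Equiv.Perm.sign σ : ℤˣ) : ℤ) • S.perm σ

lemma antisym_comm {C : Finset (Fin N)} {r : R}
    (h : ∀ σ : Equiv.Perm (Fin N), (∀ i, i ∉ C → σ i = i) → S.perm σ * r = r * S.perm σ) :
    S.antisym C * r = r * S.antisym C := by
  rw [antisym, Finset.sum_mul, Finset.mul_sum]
  refine Finset.sum_congr rfl fun σ hσ => ?_
  rw [smul_mul_assoc, h σ (Finset.mem_filter.mp hσ).2, mul_smul_comm]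

lemma antisym_comm_sum {C : Finset (Fin N)} (f : Fin N → R)
    (h : ∀ σ : Equiv.Perm (Fin N), (∀ i, i ∉ C → σ i = i) → ∀ a,
      S.perm σ * f a = f (σ a) * S.perm σ) :
    S.antisym C * ∑ a ∈ C, f a = (∑ a ∈ C, f a) * S.antisym C := by
  refine S.antisym_comm fun σ hσ => ?_
  have hmem : ∀ a, σ a ∈ C ↔ a ∈ C := by
    intro a
    by_cases ha : a ∈ C
    · refine iff_of_true ?_ ha
      by_contra h'
      exact h' ((σ.injective (hσ _ h')).symm ▸ ha)
    · rw [hσ a ha]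
  rw [Finset.mul_sum, Finset.sum_mul]
  refine Finset.sum_equiv σ (fun a => (hmem a).symm) fun a _ => h σ hσ a

/-- Coset decomposition: a permutation of `C ∪ {k}` is uniquely `(k a) σ'` with `a` the image of `k`
and `σ'` a permutation of `C`. -/
lemma antisym_insert {k : Fin N} {C : Finset (Fin N)} (hk : k ∉ C) :
    S.antisym (insert k C)
      = S.antisym C - (∑ a ∈ C, S.perm (Equiv.swap k a)) * S.antisym C := by
  have h1 : S.antisym (insert k C) = ∑ a ∈ insert k C,
      ∑ σ ∈ Finset.univ.filter (fun σ : Equiv.Perm (Fin N) => ∀ i, i ∉ C → σ i = i),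
        ((Equiv.Perm.sign (Equiv.swap k a * σ) : ℤˣ) : ℤ) • S.perm (Equiv.swap k a * σ) := by
    rw [antisym, ← Finset.sum_product']
    refine Finset.sum_bij' (fun σ _ => (σ k, Equiv.swap k (σ k) * σ))
      (fun p _ => Equiv.swap k p.1 * p.2) ?_ ?_ ?_ ?_ ?_
    · intro σ hσ
      have hσ' := (Finset.mem_filter.mp hσ).2
      rw [Finset.mem_product, Finset.mem_filter]
      refine ⟨?_, Finset.mem_univ _, fun i hi => ?_⟩
      · by_contra h
        have h2 : σ k = k := σ.injective (hσ' (σ k) h)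
        rw [h2] at h
        exact h (Finset.mem_insert_self _ _)
      · rw [Equiv.Perm.mul_apply]
        by_cases hik : i = k
        · rw [hik, Equiv.swap_apply_right]
        · have h2 : σ i = i := hσ' i (by simp [hik, hi])
          rw [h2, Equiv.swap_apply_of_ne_of_ne hik]
          intro h3
          exact hik (σ.injective (h2.trans h3))
    · intro p hp
      rw [Finset.mem_product, Finset.mem_filter] at hp
      rw [Finset.mem_filter]
      refine ⟨Finset.mem_univ _, fun i hi => ?_⟩
      rw [Finset.mem_insert, not_or] at hi
      rw [Equiv.Perm.mul_apply, hp.2.2 i hi.2, Equiv.swap_apply_of_ne_of_ne hi.1]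
      intro h
      have := hp.1
      rw [← h, Finset.mem_insert] at this
      exact this.elim hi.1 hi.2
    · intro σ _
      exact Equiv.swap_mul_self_mul _ _ _
    · intro p hp
      rw [Finset.mem_product, Finset.mem_filter] at hp
      have h1 : (Equiv.swap k p.1 * p.2) k = p.1 := by
        rw [Equiv.Perm.mul_apply, hp.2.2 k hk, Equiv.swap_apply_left]
      refine Prod.ext h1 ?_
      change Equiv.swap k ((Equiv.swap k p.1 * p.2) k) * (Equiv.swap k p.1 * p.2) = p.2
      rw [h1]
      exact Equiv.swap_mul_self_mul _ _ _
    · intro σ _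
      rw [Equiv.swap_mul_self_mul]
  rw [h1, Finset.sum_insert hk, Finset.sum_mul, sub_eq_add_neg, ← Finset.sum_neg_distrib]
  refine congrArg₂ (· + ·) ?_ (Finset.sum_congr rfl fun a ha => ?_)
  · rw [Equiv.swap_self, antisym]
    exact Finset.sum_congr rfl fun σ _ => by rw [← Equiv.Perm.one_def, one_mul]
  · rw [antisym, Finset.mul_sum, ← Finset.sum_neg_distrib]
    refine Finset.sum_congr rfl fun σ _ => ?_
    rw [Equiv.Perm.sign_mul, Equiv.Perm.sign_swap fun e : k = a => hk (e ▸ ha), map_mul,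
      mul_smul_comm, neg_one_mul, Units.val_neg, neg_smul]

/-- The sums over `a ∈ C` are invariant under conjugation by the permutations of `C`, so they pass
through the antisymmetrizer. In between, `(k a) x_k = x_a (k a)`. -/
lemma antisym_insert_mul_x {k : Fin N} {C : Finset (Fin N)} (hk : k ∉ C) :
    S.antisym (insert k C) * S.x k = S.x k * S.antisym C
      - (∑ a ∈ C, S.x a * S.perm (Equiv.swap k a)) * S.antisym C := by
  have hconj : ∀ σ : Equiv.Perm (Fin N), (∀ i, i ∉ C → σ i = i) → ∀ a,
      S.perm σ * S.perm (Equiv.swap k a) = S.perm (Equiv.swap k (σ a)) * S.perm σ := by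
    intro σ hσ a
    rw [← map_mul, ← map_mul, Equiv.mul_swap_eq_swap_mul, hσ k hk]
  rw [S.antisym_insert hk, ← S.antisym_comm_sum (fun a => S.perm (Equiv.swap k a)) hconj,
    ← S.antisym_comm_sum (fun a => S.x a * S.perm (Equiv.swap k a)) fun σ hσ a => by
      rw [← mul_assoc, S.perm_x, mul_assoc, hconj σ hσ, mul_assoc],
    sub_mul, S.antisym_comm fun σ hσ => by rw [S.perm_x, hσ k hk], mul_assoc, Finset.sum_mul]
  congr 2
  refine Finset.sum_congr rfl fun a _ => ?_
  rw [S.perm_x, Equiv.swap_apply_left]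

lemma swap_identity {i a k : Fin N} (hka : k ≠ a) (hik : i ≠ k) :
    S.perm (Equiv.swap a i) * S.perm (Equiv.swap k a)
      = S.perm (Equiv.swap k i) * S.perm (Equiv.swap i a) := by
  rw [← map_mul, ← map_mul, Equiv.mul_swap_eq_swap_mul (Equiv.swap a i), Equiv.swap_apply_left,
    Equiv.swap_apply_of_ne_of_ne hka hik.symm, Equiv.swap_comm a i]

variable [Algebra ℂ R]

/-- `∏_{i ∈ B} x_i`. -/
def xProd (B : Finset (Fin N)) : R := polyHom S.x S.x_comm (∏ i ∈ B, MvPolynomial.X i)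

/-- `∏_{i ∈ B} y_i`. -/
def yProd (B : Finset (Fin N)) : R := polyHom S.y S.y_comm (∏ i ∈ B, MvPolynomial.X i)

lemma xProd_empty : S.xProd ∅ = 1 := by rw [xProd, Finset.prod_empty, map_one]

lemma yProd_empty : S.yProd ∅ = 1 := by rw [yProd, Finset.prod_empty, map_one]

lemma xProd_insert {k : Fin N} {B : Finset (Fin N)} (h : k ∉ B) :
    S.xProd (insert k B) = S.x k * S.xProd B := by
  rw [xProd, Finset.prod_insert h, map_mul, polyHom_X, xProd]

lemma xProd_insert' {k : Fin N} {B : Finset (Fin N)} (h : k ∉ B) :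
    S.xProd (insert k B) = S.xProd B * S.x k := by
  rw [xProd, Finset.prod_insert h, mul_comm, map_mul, polyHom_X, xProd]

lemma yProd_insert {k : Fin N} {B : Finset (Fin N)} (h : k ∉ B) :
    S.yProd (insert k B) = S.y k * S.yProd B := by
  rw [yProd, Finset.prod_insert h, map_mul, polyHom_X, yProd]

lemma yProd_insert' {k : Fin N} {B : Finset (Fin N)} (h : k ∉ B) :
    S.yProd (insert k B) = S.yProd B * S.y k := by
  rw [yProd, Finset.prod_insert h, mul_comm, map_mul, polyHom_X, yProd]

lemma x_mul_xProd (k : Fin N) (B : Finset (Fin N)) : S.x k * S.xProd B = S.xProd B * S.x k := by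
  rw [xProd, ← polyHom_X S.x S.x_comm k, ← map_mul, mul_comm, map_mul]

lemma perm_mul_yProd {σ : Equiv.Perm (Fin N)} {B : Finset (Fin N)} (h : ∀ i ∈ B, σ i = i) :
    S.perm σ * S.yProd B = S.yProd B * S.perm σ := by
  induction B using Finset.induction_on with
  | empty => rw [yProd_empty, mul_one, one_mul]
  | insert k B hk ih =>
    rw [S.yProd_insert hk, ← mul_assoc, S.perm_y, h k (Finset.mem_insert_self _ _), mul_assoc,
      ih fun i hi => h i (Finset.mem_insert_of_mem hi), mul_assoc]

lemma swap_mul_yProd {k i : Fin N} {B : Finset (Fin N)} (hk : k ∉ B) (hi : i ∉ B) :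
    S.perm (Equiv.swap k i) * S.yProd B = S.yProd B * S.perm (Equiv.swap k i) :=
  S.perm_mul_yProd fun _ hj => Equiv.swap_apply_of_ne_of_ne (ne_of_mem_of_not_mem hj hk)
    (ne_of_mem_of_not_mem hj hi)

/-- Passing `y_i` leaves the transposition `(k i)` in its place. This commutes with the other
factors, since their indices avoid both `k` and `i`. -/
lemma x_mul_yProd {k : Fin N} {B : Finset (Fin N)} (hk : k ∉ B) :
    S.x k * S.yProd B
      = S.yProd B * S.x k + ∑ i ∈ B, S.yProd (B.erase i) * S.perm (Equiv.swap k i) := by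
  induction B using Finset.induction_on with
  | empty => rw [yProd_empty, mul_one, one_mul, Finset.sum_empty, add_zero]
  | insert j B hj ih =>
    have hkj : k ≠ j := fun e => hk (e ▸ Finset.mem_insert_self _ _)
    have hkB : k ∉ B := fun h => hk (Finset.mem_insert_of_mem h)
    have e : ∀ i ∈ B, S.yProd ((insert j B).erase i) = S.y j * S.yProd (B.erase i) := by
      intro i hi
      rw [Finset.erase_insert_of_ne (ne_of_mem_of_not_mem hi hj).symm,
        S.yProd_insert fun h => hj (Finset.mem_of_mem_erase h)]
    rw [Finset.sum_insert hj, Finset.erase_insert hj,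
      Finset.sum_congr rfl fun i hi => by rw [e i hi, mul_assoc], ← Finset.mul_sum,
      S.yProd_insert hj, ← mul_assoc, S.x_y k j hkj, add_mul, mul_assoc, ih hkB,
      S.swap_mul_yProd hkB hj, mul_add, ← mul_assoc]
    abel

/-- The commutator of `x_k` with `y_k` gives all transpositions `(k a)`. Those with `a ∈ B` cancel
against the commutators of `x_k` with the `y_a`, because `(k a)` turns `y_a` into `y_k`. -/
lemma x_mul_yProd_insert {k : Fin N} {B : Finset (Fin N)} (hk : k ∉ B) :
    S.x k * S.yProd (insert k B) = S.yProd (insert k B) * S.x k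
      - S.yProd B * ∑ a ∈ Finset.univ.erase k \ B, S.perm (Equiv.swap k a) := by
  have h1 : ∑ a ∈ Finset.univ.erase k, S.perm (Equiv.swap k a) * S.yProd B
      = S.yProd B * (∑ a ∈ Finset.univ.erase k \ B, S.perm (Equiv.swap k a))
        + S.y k * ∑ i ∈ B, S.yProd (B.erase i) * S.perm (Equiv.swap k i) := by
    have hB : B ⊆ Finset.univ.erase k := fun i hi =>
      Finset.mem_erase.mpr ⟨fun e => hk (e ▸ hi), Finset.mem_univ _⟩
    rw [← Finset.sum_sdiff hB, Finset.mul_sum, Finset.mul_sum]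
    refine congrArg₂ (· + ·) (Finset.sum_congr rfl fun a ha => ?_)
      (Finset.sum_congr rfl fun a ha => ?_)
    · exact S.swap_mul_yProd hk (Finset.mem_sdiff.mp ha).2
    · have e := S.yProd_insert (Finset.notMem_erase a B)
      rw [Finset.insert_erase ha] at e
      rw [e, ← mul_assoc, S.perm_y, Equiv.swap_apply_right, mul_assoc,
        S.swap_mul_yProd (fun h => hk (Finset.mem_of_mem_erase h)) (Finset.notMem_erase a B)]
  rw [S.yProd_insert hk, ← mul_assoc, S.x_y_self, sub_mul, mul_assoc, S.x_mul_yProd hk,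
    Finset.sum_mul, h1, mul_add, mul_assoc]
  abel

/-- The element `∑_σ ∏_{σ(i) = i} (1 - x_i y_i) (-1)^σ σ`, normally ordered. -/
def central : R :=
  ∑ B : Finset (Fin N), (-1) ^ B.card * (S.xProd B * S.yProd B * S.antisym Bᶜ)

/-- The terms of the subsets `B` and `B ∪ {k}` enter the central element with opposite signs and are
treated together. Their joint commutator with `x_k` consists of terms in which an index `i ∈ B` has
lost its `y`, and terms in which an index `a` outside `B ∪ {k}` has gained an `x`. Both kinds have
one more `x` than `y`, so they can cancel between different `B`. -/
lemma commutator_pair {k : Fin N} {B : Finset (Fin N)} (hk : k ∉ B) :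
    (S.x k * (S.xProd B * S.yProd B * S.antisym (insert k (Finset.univ.erase k \ B)))
        - S.xProd B * S.yProd B * S.antisym (insert k (Finset.univ.erase k \ B)) * S.x k)
      - (S.x k * (S.xProd (insert k B) * S.yProd (insert k B)
            * S.antisym (Finset.univ.erase k \ B))
        - S.xProd (insert k B) * S.yProd (insert k B)
            * S.antisym (Finset.univ.erase k \ B) * S.x k)
      = ∑ i ∈ B, S.xProd B * S.yProd (B.erase i) * S.perm (Equiv.swap k i)
            * S.antisym (insert i (Finset.univ.erase k \ B))
        + ∑ a ∈ Finset.univ.erase k \ B, S.xProd (insert a B) * S.yProd B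
            * S.perm (Equiv.swap k a) * S.antisym (Finset.univ.erase k \ B) := by
  set C := Finset.univ.erase k \ B with hC
  have hkC : k ∉ C := by simp [hC]
  have hCB : ∀ a ∈ C, a ∉ B ∧ k ≠ a := fun a ha => by
    rw [hC, Finset.mem_sdiff, Finset.mem_erase] at ha
    exact ⟨ha.2, ha.1.1.symm⟩
  have hEx : S.antisym C * S.x k = S.x k * S.antisym C :=
    S.antisym_comm fun σ hσ => by rw [S.perm_x, hσ k hkC]
  set E := S.antisym C with hE
  set XB := S.xProd B
  set YB := S.yProd B
  have h1 := S.antisym_insert hkC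
  have h2 := S.antisym_insert_mul_x hkC
  have h3 := S.x_mul_yProd hk
  have h4 := S.x_mul_yProd_insert hk
  rw [← hC] at h4
  set YB' := S.yProd (insert k B)
  set E' := S.antisym (insert k C)
  have hXB : S.x k * XB = XB * S.x k := S.x_mul_xProd k B
  rw [S.xProd_insert' hk]
  have step : (S.x k * (XB * YB * E') - XB * YB * E' * S.x k)
      - (S.x k * (XB * S.x k * YB' * E) - XB * S.x k * YB' * E * S.x k)
      = XB * (∑ i ∈ B, S.yProd (B.erase i) * S.perm (Equiv.swap k i)) * E
        + XB * (∑ a ∈ C, YB * S.x a * S.perm (Equiv.swap k a)) * E := by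
    have e1 : S.x k * (XB * YB * E') = XB * (S.x k * YB) * E' := by
      rw [← mul_assoc, ← mul_assoc, hXB, mul_assoc XB]
    have e2 : S.x k * (XB * S.x k * YB' * E) = XB * S.x k * (S.x k * YB') * E := by
      rw [← mul_assoc, ← mul_assoc, ← mul_assoc, hXB]
      simp only [mul_assoc]
    have e3 : XB * S.x k * YB' * E * S.x k = XB * S.x k * (YB' * S.x k) * E := by
      rw [mul_assoc _ E, hEx]
      simp only [mul_assoc]
    have e4 : XB * YB * E' * S.x k = XB * YB * (E' * S.x k) := mul_assoc _ _ _
    have e5 : ∑ a ∈ C, YB * S.x a * S.perm (Equiv.swap k a)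
        = YB * ∑ a ∈ C, S.x a * S.perm (Equiv.swap k a) := by
      rw [Finset.mul_sum]
      exact Finset.sum_congr rfl fun a _ => mul_assoc _ _ _
    have e6 : ∑ i ∈ B, S.yProd (B.erase i) * S.perm (Equiv.swap k i)
        = S.x k * YB - YB * S.x k := by rw [h3]; abel
    rw [e1, e2, e3, e4, e5, e6, h2, h4, h1]
    noncomm_ring
  rw [step]
  have h5 : ∀ a ∈ C, YB * S.x a = S.x a * YB
      - ∑ i ∈ B, S.yProd (B.erase i) * S.perm (Equiv.swap a i) := fun a ha => by
    rw [S.x_mul_yProd (hCB a ha).1]; abel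
  have h6 : ∀ i ∈ B, S.antisym (insert i C)
      = E - (∑ a ∈ C, S.perm (Equiv.swap i a)) * E := fun i hi =>
    S.antisym_insert fun h => (hCB i h).1 hi
  -- Reordering `Y_B x_a` produces exactly the terms that complete the antisymmetrizer of `C` to
  -- that of `C ∪ {i}`.
  have h7 : ∑ a ∈ C, YB * S.x a * S.perm (Equiv.swap k a)
      = ∑ a ∈ C, S.x a * YB * S.perm (Equiv.swap k a)
        - ∑ i ∈ B, S.yProd (B.erase i) * S.perm (Equiv.swap k i)
          * ∑ a ∈ C, S.perm (Equiv.swap i a) := by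
    simp only [Finset.mul_sum]
    rw [Finset.sum_comm, ← Finset.sum_sub_distrib]
    refine Finset.sum_congr rfl fun a ha => ?_
    rw [h5 a ha, sub_mul, Finset.sum_mul]
    congr 1
    refine Finset.sum_congr rfl fun i hi => ?_
    rw [mul_assoc, mul_assoc, S.swap_identity (hCB a ha).2 (fun e => hk (e ▸ hi))]
  have h8 : ∀ i ∈ B, XB * S.yProd (B.erase i) * S.perm (Equiv.swap k i) * S.antisym (insert i C)
      = XB * (S.yProd (B.erase i) * S.perm (Equiv.swap k i)) * E
        - XB * (S.yProd (B.erase i) * S.perm (Equiv.swap k i)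
          * ∑ a ∈ C, S.perm (Equiv.swap i a)) * E := fun i hi => by
    rw [h6 i hi, mul_sub]
    simp only [mul_assoc]
  have h9 : ∀ a ∈ C, S.xProd (insert a B) * YB * S.perm (Equiv.swap k a) * E
      = XB * (S.x a * YB * S.perm (Equiv.swap k a)) * E := fun a ha => by
    rw [S.xProd_insert' (hCB a ha).1]
    simp only [mul_assoc, XB]
  rw [Finset.sum_congr rfl h8, Finset.sum_congr rfl h9, h7, Finset.sum_sub_distrib,
    ← Finset.sum_mul, ← Finset.sum_mul, ← Finset.sum_mul, ← Finset.mul_sum, ← Finset.mul_sum,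
    ← Finset.mul_sum, mul_sub, sub_mul]
  abel

lemma x_mul_central (k : Fin N) : S.x k * S.central = S.central * S.x k := by
  set T := (Finset.univ : Finset (Fin N)).erase k with hT
  have hu : (Finset.univ : Finset (Fin N)) = insert k T := by
    rw [hT, Finset.insert_erase (Finset.mem_univ k)]
  have hkT : k ∉ T := Finset.notMem_erase _ _
  have hc1 : ∀ B ∈ T.powerset, Bᶜ = insert k (T \ B) := by
    intro B hB
    rw [Finset.mem_powerset] at hB
    rw [Finset.compl_eq_univ_sdiff, hu, Finset.insert_sdiff_of_notMem _ fun h => hkT (hB h)]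
  have hc2 : ∀ B : Finset (Fin N), (insert k B)ᶜ = T \ B := by
    intro B
    ext i
    simp [hT]
  have hkB : ∀ B ∈ T.powerset, k ∉ B := fun B hB h => hkT (Finset.mem_powerset.mp hB h)
  have hsign : ∀ (n : ℕ) (a b : R), a * ((-1) ^ n * b) = (-1) ^ n * (a * b) := by
    intro n a b
    rw [← mul_assoc, ← mul_assoc, ((Commute.neg_one_right a).pow_right n).eq]
  have h0 : S.x k * S.central - S.central * S.x k = ∑ B ∈ T.powerset, (-1) ^ B.card *
      ((S.x k * (S.xProd B * S.yProd B * S.antisym (insert k (T \ B)))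
        - S.xProd B * S.yProd B * S.antisym (insert k (T \ B)) * S.x k)
      - (S.x k * (S.xProd (insert k B) * S.yProd (insert k B) * S.antisym (T \ B))
        - S.xProd (insert k B) * S.yProd (insert k B) * S.antisym (T \ B) * S.x k)) := by
    rw [central, Finset.mul_sum, Finset.sum_mul, ← Finset.sum_sub_distrib, ← Finset.powerset_univ,
      hu, Finset.sum_powerset_insert hkT, ← Finset.sum_add_distrib]
    refine Finset.sum_congr rfl fun B hB => ?_
    rw [hc1 B hB, hc2, Finset.card_insert_of_notMem (hkB B hB), hsign, hsign, pow_succ]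
    noncomm_ring
  rw [← sub_eq_zero, h0, Finset.sum_congr rfl fun B hB => by rw [S.commutator_pair (hkB B hB)]]
  simp only [mul_add, Finset.mul_sum]
  rw [Finset.sum_add_distrib, Finset.sum_sigma', Finset.sum_sigma', add_eq_zero_iff_eq_neg,
    ← Finset.sum_neg_distrib]
  -- The term in which `i` has lost its `y` for the subset `B` equals the term in which `i` gains an
  -- `x` for `B \ {i}`. The cardinalities differ by one, so the signs are opposite.
  refine Finset.sum_bij' (fun p _ => ⟨p.1.erase p.2, p.2⟩) (fun p _ => ⟨insert p.2 p.1, p.2⟩)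
    ?_ ?_ ?_ ?_ ?_
  · rintro ⟨B, i⟩ h
    simp only [Finset.mem_sigma, Finset.mem_powerset, Finset.mem_sdiff] at h ⊢
    exact ⟨(Finset.erase_subset _ _).trans h.1, h.1 h.2, Finset.notMem_erase _ _⟩
  · rintro ⟨B, i⟩ h
    simp only [Finset.mem_sigma, Finset.mem_powerset, Finset.mem_sdiff] at h ⊢
    exact ⟨Finset.insert_subset h.2.1 h.1, Finset.mem_insert_self _ _⟩
  · rintro ⟨B, i⟩ h
    simp only [Finset.mem_sigma] at h
    simp only [Finset.insert_erase h.2]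
  · rintro ⟨B, i⟩ h
    simp only [Finset.mem_sigma, Finset.mem_sdiff] at h
    simp only [Finset.erase_insert h.2.2]
  · rintro ⟨B, i⟩ h
    simp only [Finset.mem_sigma, Finset.mem_powerset] at h
    have e1 : insert i (T \ B) = T \ B.erase i := by
      rw [Finset.sdiff_erase (h.1 h.2)]
    have e2 : B.card = (B.erase i).card + 1 := by
      rw [Finset.card_erase_add_one h.2]
    simp only [Finset.insert_erase h.2]
    rw [e1, e2, pow_succ]
    noncomm_ring

end CherednikSystem

end BetheCherednik

end

noncomputable section

namespace BetheCherednik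

/-! ### Centrality of the elements `c_{ij}` -/

section Central

open Polynomial

variable {N : ℕ}

lemma prod_one_sub_eq_sum {R ι : Type*} [CommRing R] [DecidableEq ι] (s : Finset ι)
    (f : ι → R) : ∏ i ∈ s, (1 - f i) = ∑ t ∈ s.powerset, (-1) ^ t.card * ∏ i ∈ t, f i := by
  simp only [sub_eq_add_neg, Finset.prod_one_add, Finset.prod_neg]

/-- The fixed points of a permutation. -/
def fixedPts (σ : Equiv.Perm (Fin N)) : Finset (Fin N) := Finset.univ.filter fun i => σ i = i

/-- `∏_{i, σ(i) = i} (1 - (v - ξ_i)(u - η_i))`. -/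
def fixedProdOf {P : Type*} [CommRing P] (ξ η : Fin N → P) (σ : Equiv.Perm (Fin N)) : P[X][X] :=
  ∏ i ∈ fixedPts σ, (1 - (X - C (C (ξ i))) * C (X - C (η i)))

lemma fixedProd_eq_fixedProdOf (σ : Equiv.Perm (Fin N)) :
    fixedProd σ = fixedProdOf (fun i => (MvPolynomial.X (Sum.inl i) : PolyXY N))
      (fun i => MvPolynomial.X (Sum.inr i)) σ := rfl

lemma fixedProdOf_eq_sum {P : Type*} [CommRing P] (ξ η : Fin N → P) (σ : Equiv.Perm (Fin N)) :
    fixedProdOf ξ η σ = ∑ B ∈ (fixedPts σ).powerset, (-1) ^ B.card *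
      ((∏ i ∈ B, (X - C (C (ξ i)))) * ∏ i ∈ B, C (X - C (η i))) := by
  refine (prod_one_sub_eq_sum _ _).trans (Finset.sum_congr rfl fun B _ => ?_)
  rw [Finset.prod_mul_distrib]

lemma neg_one_pow_succ_mul {R : Type*} [Ring R] (n : ℕ) (r : R) :
    (-1) ^ (n + 1) * r = -((-1) ^ n * r) := by
  rw [pow_succ', mul_assoc, neg_one_mul]

lemma coeff_mul_C_C {R : Type*} [Ring R] (q : R[X][X]) (r : R) (a b : ℕ) :
    ((q * C (C r)).coeff a).coeff b = (q.coeff a).coeff b * r := by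
  rw [coeff_mul_C, coeff_mul_C]

namespace CherednikSystem

variable {H : Type*} [Ring H] (S : CherednikSystem N H)

/-- The elements `v - x_i`, `u - y_i` and `σ` of `H[u][v]`. -/
def poly : CherednikSystem N H[X][X] where
  x i := X - C (C (S.x i))
  y i := C (X - C (S.y i))
  perm := (C.comp C : H →+* H[X][X]).toMonoidHom.comp S.perm
  x_comm i j := by
    simp only [sub_mul, mul_sub, ← map_mul, S.x_comm i j, X_mul]
    abel
  y_comm i j := by
    rw [← C_mul, ← C_mul]
    simp only [sub_mul, mul_sub, ← map_mul, S.y_comm i j, X_mul]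
    congr 1
    abel
  perm_x σ k := by
    change C (C (S.perm σ)) * _ = _ * C (C (S.perm σ))
    rw [mul_sub, sub_mul, ← X_mul, ← map_mul, ← map_mul, ← map_mul, ← map_mul, S.perm_x]
  perm_y σ k := by
    change C (C (S.perm σ)) * _ = _ * C (C (S.perm σ))
    rw [← C_mul, ← C_mul, mul_sub, sub_mul, ← X_mul, ← map_mul, ← map_mul, S.perm_y]
  -- The variables `u` and `v` are central, so they drop out of commutators: `[v - x_i, u - y_j] =
  -- [x_i, y_j]`.
  x_y i j h := by
    change _ = _ + C (C (S.perm _))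
    have h1 : (C (C (S.x i)) * C (C (S.y j)) : H[X][X])
        = C (C (S.y j)) * C (C (S.x i)) + C (C (S.perm (Equiv.swap i j))) := by
      rw [← C_mul, ← C_mul, S.x_y i j h, C_add, C_add, C_mul, C_mul]
    have h2 : (C (C (S.x i)) * C X : H[X][X]) = C X * C (C (S.x i)) := by
      rw [← C_mul, ← C_mul, X_mul]
    rw [C_sub]
    simp only [sub_mul, mul_sub, h1, h2, X_mul]
    abel
  x_y_self i := by
    change _ = _ - ∑ a ∈ _, C (C (S.perm _))
    have h1 : (C (C (S.x i)) * C (C (S.y i)) : H[X][X])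
        = C (C (S.y i)) * C (C (S.x i))
          - ∑ a ∈ Finset.univ.erase i, C (C (S.perm (Equiv.swap i a))) := by
      rw [← C_mul, ← C_mul, S.x_y_self i, C_sub, C_sub, C_mul, C_mul, map_sum, map_sum]
    have h2 : (C (C (S.x i)) * C X : H[X][X]) = C X * C (C (S.x i)) := by
      rw [← C_mul, ← C_mul, X_mul]
    rw [C_sub]
    simp only [sub_mul, mul_sub, h1, h2, X_mul]
    abel

end CherednikSystem

section Ordered

variable {P H : Type*} [CommRing P] [Ring H] (ν : P →+ H)

/-- `q` is obtained from `p` by applying `ν` to the coefficients. -/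
def IsOrdered (p : P[X][X]) (q : H[X][X]) : Prop :=
  ∀ a b, ν ((p.coeff a).coeff b) = (q.coeff a).coeff b

variable {ν}

lemma isOrdered_one (h1 : ν 1 = 1) : IsOrdered ν 1 1 := by
  intro a b
  rw [coeff_one, coeff_one]
  split_ifs
  · rw [coeff_one, coeff_one]
    split_ifs
    · exact h1
    · exact map_zero _
  · exact map_zero _

lemma IsOrdered.sum {ι : Type*} (s : Finset ι) {p : ι → P[X][X]} {q : ι → H[X][X]}
    (h : ∀ i ∈ s, IsOrdered ν (p i) (q i)) : IsOrdered ν (∑ i ∈ s, p i) (∑ i ∈ s, q i) := by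
  intro a b
  simp only [finsetSum_coeff, map_sum]
  exact Finset.sum_congr rfl fun i hi => h i hi a b

lemma IsOrdered.neg_one_pow_mul {p : P[X][X]} {q : H[X][X]}
    (h : IsOrdered ν p q) (n : ℕ) : IsOrdered ν ((-1) ^ n * p) ((-1) ^ n * q) := by
  induction n with
  | zero => rwa [pow_zero, pow_zero, one_mul, one_mul]
  | succ n ih =>
    intro a b
    rw [neg_one_pow_succ_mul, neg_one_pow_succ_mul, coeff_neg, coeff_neg, map_neg, ih a b,
      coeff_neg, coeff_neg]

lemma IsOrdered.x_mul {p : P[X][X]} {q : H[X][X]} (h : IsOrdered ν p q) {ξ : P}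
    {r : H} (hr : ∀ f, ν (ξ * f) = r * ν f) :
    IsOrdered ν ((X - C (C ξ)) * p) ((X - C (C r)) * q) := by
  intro a b
  rw [sub_mul, sub_mul, coeff_sub, coeff_sub, coeff_sub, coeff_sub, coeff_C_mul, coeff_C_mul,
    coeff_C_mul, coeff_C_mul, map_sub, hr, h a b]
  congr 1
  cases a with
  | zero => rw [coeff_X_mul_zero, coeff_X_mul_zero]; exact map_zero _
  | succ a => rw [coeff_X_mul, coeff_X_mul]; exact h a b

lemma IsOrdered.mul_y {p : P[X][X]} {q : H[X][X]} (h : IsOrdered ν p q) {η : P}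
    {r : H} (hr : ∀ f, ν (f * η) = ν f * r) :
    IsOrdered ν (p * C (X - C η)) (q * C (X - C r)) := by
  intro a b
  rw [coeff_mul_C, coeff_mul_C, mul_sub, mul_sub, coeff_sub, coeff_sub, coeff_mul_C, coeff_mul_C,
    map_sub, hr, h a b]
  congr 1
  cases b with
  | zero => rw [coeff_mul_X_zero, coeff_mul_X_zero]; exact map_zero _
  | succ b => rw [coeff_mul_X, coeff_mul_X]; exact h a b

variable [Algebra ℂ H] {S : CherednikSystem N H} {ξ η : Fin N → P}

/-- The product is built by attaching factors with `x` on the left and factors with `y` on the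
right, the only two operations that normal ordering respects. -/
lemma isOrdered_xProd_mul_yProd (h1 : ν 1 = 1)
    (hx : ∀ i f, ν (ξ i * f) = S.x i * ν f)
    (hy : ∀ i f, ν (f * η i) = ν f * S.y i) (B B' : Finset (Fin N)) :
    IsOrdered ν ((∏ i ∈ B, (X - C (C (ξ i))))
        * ∏ i ∈ B', C (X - C (η i)))
      (S.poly.xProd B * S.poly.yProd B') := by
  induction B using Finset.induction_on with
  | empty =>
    rw [Finset.prod_empty, one_mul, CherednikSystem.xProd_empty, one_mul]
    induction B' using Finset.induction_on with
    | empty =>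
      rw [Finset.prod_empty, CherednikSystem.yProd_empty]
      exact isOrdered_one h1
    | insert k B' hk ih =>
      rw [Finset.prod_insert hk, mul_comm, CherednikSystem.yProd_insert' _ hk]
      exact ih.mul_y (hy k)
  | insert k B hk ih =>
    rw [Finset.prod_insert hk, CherednikSystem.xProd_insert _ hk, mul_assoc, mul_assoc]
    exact ih.x_mul (hx k)

lemma isOrdered_fixedProdOf (h1 : ν 1 = 1)
    (hx : ∀ i f, ν (ξ i * f) = S.x i * ν f)
    (hy : ∀ i f, ν (f * η i) = ν f * S.y i) (σ : Equiv.Perm (Fin N)) :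
    IsOrdered ν (fixedProdOf ξ η σ) (∑ B ∈ (fixedPts σ).powerset,
      (-1) ^ B.card * (S.poly.xProd B * S.poly.yProd B)) := by
  rw [fixedProdOf_eq_sum]
  exact IsOrdered.sum _ fun B _ => (isOrdered_xProd_mul_yProd h1 hx hy B B).neg_one_pow_mul _

/-- A permutation of the complement of `B` is a permutation that fixes every point of `B`, so the
two summations can be exchanged. -/
lemma CherednikSystem.poly_central : S.poly.central = ∑ σ : Equiv.Perm (Fin N),
    (∑ B ∈ (fixedPts σ).powerset, (-1) ^ B.card * (S.poly.xProd B * S.poly.yProd B))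
        * C (C (((Equiv.Perm.sign σ : ℤˣ) : ℤ) • S.perm σ)) := by
  have h1 : ∀ σ : Equiv.Perm (Fin N), (C (C (((Equiv.Perm.sign σ : ℤˣ) : ℤ) • S.perm σ)))
      = ((Equiv.Perm.sign σ : ℤˣ) : ℤ) • S.poly.perm σ := by
    intro σ
    rw [map_zsmul, map_zsmul]
    rfl
  simp only [h1, CherednikSystem.central, CherednikSystem.antisym, Finset.mul_sum, Finset.sum_mul]
  rw [Finset.sum_comm' (t' := Finset.univ) (s' := fun σ => (fixedPts σ).powerset)]
  · refine Finset.sum_congr rfl fun σ _ => Finset.sum_congr rfl fun B _ => ?_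
    simp only [mul_assoc]
  · intro B σ
    simp only [Finset.mem_univ, true_and, and_true, Finset.mem_filter, Finset.mem_powerset,
      Finset.mem_compl, not_not, fixedPts, Finset.subset_iff]

/-- The sum is a coefficient of the central element attached to `v - x_i`, `u - y_i` and `σ`. That
element commutes with `v - x_k`, hence with `x_k`, and so do all its coefficients. -/
lemma commute_x_sum_fixedProdOf (h1 : ν 1 = 1)
    (hx : ∀ i f, ν (ξ i * f) = S.x i * ν f)
    (hy : ∀ i f, ν (f * η i) = ν f * S.y i) (a b : ℕ) (k : Fin N) :
    Commute (S.x k) (∑ σ : Equiv.Perm (Fin N), ν (((fixedProdOf ξ η σ).coeff a).coeff b)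
      * (((Equiv.Perm.sign σ : ℤˣ) : ℤ) • S.perm σ)) := by
  have e : ∑ σ : Equiv.Perm (Fin N), ν (((fixedProdOf ξ η σ).coeff a).coeff b)
      * (((Equiv.Perm.sign σ : ℤˣ) : ℤ) • S.perm σ) = (S.poly.central.coeff a).coeff b := by
    rw [CherednikSystem.poly_central]
    simp only [finsetSum_coeff]
    refine Finset.sum_congr rfl fun σ _ => ?_
    rw [coeff_mul_C_C, ← isOrdered_fixedProdOf h1 hx hy σ]
  have h := S.poly.x_mul_central k
  change (X - C (C (S.x k))) * _ = _ * (X - C (C (S.x k))) at h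
  rw [sub_mul, mul_sub, X_mul, sub_right_inj] at h
  have h' := congrArg (fun p => (p.coeff a).coeff b) h
  rw [e]
  simp only [coeff_mul_C, coeff_C_mul] at h'
  exact h'

end Ordered

variable (N) in
/-- The generators of `H_N` as a system. -/
def cherednikSystem : CherednikSystem N (Cherednik N) where
  x := xH
  y := yH
  perm := permH N
  x_comm := xH_mul_comm
  y_comm := yH_mul_comm
  perm_x := permH_mul_xH
  perm_y := permH_mul_yH
  x_y := xH_mul_yH
  x_y_self := xH_mul_yH_self

lemma neg_one_pow_mul_comm {R : Type*} [Ring R] (n : ℕ) (a : R) :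
    (-1) ^ n * a = a * (-1) ^ n := ((Commute.neg_one_left a).pow_left n).eq

lemma cZ_mul_xH (i j : Fin (N + 1)) (k : Fin N) : cZ N i j * xH k = xH k * cZ N i j := by
  have h : _ = _ := commute_x_sum_fixedProdOf (ν := (normalOrder N).toAddMonoidHom)
    (S := cherednikSystem N) (ξ := fun i => MvPolynomial.X (Sum.inl i))
    (η := fun i => MvPolynomial.X (Sum.inr i)) normalOrder_one normalOrder_X_mul
    normalOrder_mul_X (N - i) (N - j) k
  change xH k * _ = _ * xH k at h
  rw [cZ, neg_one_pow_mul_comm, mul_assoc, neg_one_pow_mul_comm, ← mul_assoc, ← mul_assoc]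
  exact congrArg (· * (-1) ^ N) h.symm

lemma coeff_coeff_map {R S : Type*} [CommRing R] [CommRing S] (g : R →+* S) (p : R[X][X])
    (a b : ℕ) : ((p.map (mapRingHom g)).coeff a).coeff b = g ((p.coeff a).coeff b) := by
  rw [coeff_map, coe_mapRingHom, coeff_map]

lemma map_fixedProdOf {P P' : Type*} [CommRing P] [CommRing P'] (g : P →+* P') (ξ η : Fin N → P)
    (σ : Equiv.Perm (Fin N)) : (fixedProdOf ξ η σ).map (mapRingHom g)
      = fixedProdOf (fun i => g (ξ i)) (fun i => g (η i)) σ := by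
  rw [fixedProdOf, Polynomial.map_prod, fixedProdOf]
  refine Finset.prod_congr rfl fun i _ => ?_
  simp

lemma swap_fixedProdOf {P : Type*} [CommRing P] (ξ η : Fin N → P) (σ : Equiv.Perm (Fin N)) :
    Bivariate.swap (fixedProdOf ξ η σ) = fixedProdOf η ξ σ := by
  rw [fixedProdOf, map_prod, fixedProdOf]
  refine Finset.prod_congr rfl fun i _ => ?_
  simp only [map_sub, map_mul, Bivariate.swap_Y, Bivariate.swap_C_C, Bivariate.swap_X, map_one]
  rw [mul_comm]

lemma fixedPts_inv (σ : Equiv.Perm (Fin N)) : fixedPts σ⁻¹ = fixedPts σ := by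
  ext i
  simp only [fixedPts, Finset.mem_filter, Finset.mem_univ, true_and]
  rw [Equiv.Perm.inv_eq_iff_eq, eq_comm]

lemma fixedProd_inv (σ : Equiv.Perm (Fin N)) : fixedProd σ⁻¹ = fixedProd σ := by
  rw [fixedProd_eq_fixedProdOf, fixedProd_eq_fixedProdOf, fixedProdOf, fixedProdOf, fixedPts_inv]

/-- Only variables whose indices are fixed by `σ` occur. -/
lemma diagPerm_fixedProd_coeff (σ : Equiv.Perm (Fin N)) (a b : ℕ) :
    diagPerm σ (((fixedProd σ).coeff a).coeff b) = ((fixedProd σ).coeff a).coeff b := by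
  have h := coeff_coeff_map (diagPerm σ : PolyXY N →ₐ[ℂ] PolyXY N).toRingHom
    (fixedProdOf (fun i => (MvPolynomial.X (Sum.inl i) : PolyXY N))
      (fun i => MvPolynomial.X (Sum.inr i)) σ) a b
  refine h.symm.trans ?_
  rw [map_fixedProdOf]
  refine congrArg (fun p => Polynomial.coeff (Polynomial.coeff p a) b)
    (Finset.prod_congr rfl fun i hi => ?_)
  have hi' : σ i = i := (Finset.mem_filter.mp hi).2
  have e1 : (diagPerm σ : PolyXY N →ₐ[ℂ] PolyXY N) (MvPolynomial.X (Sum.inl i))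
      = MvPolynomial.X (Sum.inl i) := by rw [diagPerm, MvPolynomial.rename_X, Sum.map_inl, hi']
  have e2 : (diagPerm σ : PolyXY N →ₐ[ℂ] PolyXY N) (MvPolynomial.X (Sum.inr i))
      = MvPolynomial.X (Sum.inr i) := by rw [diagPerm, MvPolynomial.rename_X, Sum.map_inr, hi']
  exact congrArg₂ (fun x y : PolyXY N => 1 - (X - C (C x)) * C (X - C y)) e1 e2

lemma rename_swap_fixedProd_coeff (σ : Equiv.Perm (Fin N)) (a b : ℕ) :
    MvPolynomial.rename Sum.swap (((fixedProd σ).coeff a).coeff b)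
      = ((fixedProd σ).coeff b).coeff a := by
  have h := coeff_coeff_map (MvPolynomial.rename Sum.swap : PolyXY N →ₐ[ℂ] PolyXY N).toRingHom
    (fixedProdOf (fun i => (MvPolynomial.X (Sum.inl i) : PolyXY N))
      (fun i => MvPolynomial.X (Sum.inr i)) σ) a b
  refine h.symm.trans ?_
  rw [map_fixedProdOf, ← coeff_swap, swap_fixedProdOf]
  refine congrArg (fun p => Polynomial.coeff (Polynomial.coeff p b) a)
    (Finset.prod_congr rfl fun i hi => ?_)
  exact congrArg₂ (fun x y : PolyXY N => 1 - (X - C (C x)) * C (X - C y))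
    (MvPolynomial.rename_X _ _) (MvPolynomial.rename_X _ _)

lemma antiFlip_cZ_term (σ : Equiv.Perm (Fin N)) (a b : ℕ) :
    antiFlip N (normalOrder N (((fixedProd σ).coeff a).coeff b)
        * (((Equiv.Perm.sign σ : ℤˣ) : ℤ) • permH N σ))
      = MulOpposite.op (normalOrder N (((fixedProd σ⁻¹).coeff b).coeff a)
        * (((Equiv.Perm.sign σ⁻¹ : ℤˣ) : ℤ) • permH N σ⁻¹)) := by
  rw [map_mul, map_zsmul, antiFlip_permH, antiFlip_normalOrder, rename_swap_fixedProd_coeff,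
    mul_smul_comm, ← MulOpposite.op_mul, permH_mul_normalOrder, fixedProd_inv, mul_smul_comm,
    MulOpposite.op_smul, Equiv.Perm.sign_inv]
  rw [← fixedProd_inv, diagPerm_fixedProd_coeff]

/-- The flip exchanges `x` and `y`, hence `u` and `v`, and inverts permutations. Reversing the order
puts the permutation in front of its coefficient; it moves back freely because the coefficient is
invariant under it. The sum over `σ⁻¹` is the sum over `σ`. -/
lemma antiFlip_cZ (i j : Fin (N + 1)) : antiFlip N (cZ N i j) = MulOpposite.op (cZ N j i) := by
  have h : antiFlip N ((-1) ^ N) = MulOpposite.op ((-1) ^ N) := by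
    rw [map_pow, MulOpposite.op_pow]
    congr 1
    rw [MulOpposite.op_neg, MulOpposite.op_one]
    exact (map_neg _ _).trans (congrArg _ (map_one _))
  rw [cZ, cZ, map_mul, h, map_sum, neg_one_pow_mul_comm, MulOpposite.op_mul, Finset.op_sum,
    Finset.sum_congr rfl fun σ _ => antiFlip_cZ_term σ (N - i) (N - j)]
  congr 1
  · rw [← Equiv.sum_comp (Equiv.inv (Equiv.Perm (Fin N)))]
    rfl

lemma cZ_mul_yH (i j : Fin (N + 1)) (k : Fin N) : cZ N i j * yH k = yH k * cZ N i j := by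
  have h := congrArg (antiFlip N) (cZ_mul_xH j i k)
  rw [map_mul, map_mul, antiFlip_cZ, antiFlip_xH, ← MulOpposite.op_mul, ← MulOpposite.op_mul] at h
  exact (MulOpposite.op_injective h).symm

/-- For `i ≠ j` the transposition `s_{ij}` is the commutator of `x_i` and `y_j`, so the `x`'s and
`y`'s alone generate the algebra. -/
lemma mem_center_of_commute {c : Cherednik N} (hx : ∀ k, c * xH k = xH k * c)
    (hy : ∀ k, c * yH k = yH k * c) : c ∈ Subalgebra.center ℂ (Cherednik N) := by
  rw [Subalgebra.mem_center_iff]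
  intro h
  induction h using cherednik_induction with
  | hx i => exact (hx i).symm
  | hy i => exact (hy i).symm
  | hs i j =>
    by_cases hij : i = j
    · subst hij; rw [sH_self, one_mul, mul_one]
    · have e : (sH i j : Cherednik N) = xH i * yH j - yH j * xH i := by
        rw [xH_mul_yH i j hij, permH_swap, add_sub_cancel_left]
      rw [e, sub_mul, mul_sub, mul_assoc, ← hy, ← mul_assoc, ← hx, mul_assoc (yH j), ← hx,
        ← mul_assoc (yH j), ← hy]
      simp only [mul_assoc]
  | hc r => exact Algebra.commutes r c
  | hadd a b ha hb => rw [add_mul, mul_add, ha, hb]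
  | hmul a b ha hb => rw [mul_assoc, hb, ← mul_assoc, ha, mul_assoc]

lemma cZ_mem_center (i j : Fin (N + 1)) : cZ N i j ∈ Subalgebra.center ℂ (Cherednik N) :=
  mem_center_of_commute (cZ_mul_xH i j) (cZ_mul_yH i j)

end Central

end BetheCherednik

end

noncomputable section

namespace BetheCherednik

section LeadingTerms

open Polynomial

/-! ### Signed elementary symmetric polynomials -/

section Signed

variable {P ι : Type*} [CommRing P]

/-- The coefficients of `∏_{i ∈ B} (t - f_i)`. -/
def rootCoeff (f : ι → P) (B : Finset ι) (m : ℕ) : P := (∏ i ∈ B, (X - C (f i))).coeff m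

/-- The coefficients of `∏_{i ∈ B} (1 - f_i t)`: up to sign, the elementary symmetric polynomials
of the `f_i`. -/
def signedEsymm (f : ι → P) (B : Finset ι) (m : ℕ) : P := (∏ i ∈ B, (1 - C (f i) * X)).coeff m

lemma rootCoeff_empty_succ (f : ι → P) (m : ℕ) : rootCoeff f ∅ (m + 1) = 0 := by
  rw [rootCoeff, Finset.prod_empty, coeff_one, if_neg (Nat.succ_ne_zero m)]

lemma signedEsymm_zero (f : ι → P) (B : Finset ι) : signedEsymm f B 0 = 1 := by
  rw [signedEsymm, coeff_zero_prod]
  simp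

lemma coeff_coeff_prod_mul_prod (f g : ι → P) (B : Finset ι) (a b : ℕ) :
    (((∏ i ∈ B, (X - C (C (f i)))) * ∏ i ∈ B, C (X - C (g i))).coeff a).coeff b
      = rootCoeff f B a * rootCoeff g B b := by
  have h1 : ∏ i ∈ B, (X - C (C (f i))) = (∏ i ∈ B, (X - C (f i))).map C := by
    rw [Polynomial.map_prod]
    exact Finset.prod_congr rfl fun i _ => by rw [Polynomial.map_sub, map_X, map_C]
  rw [h1, ← map_prod, coeff_mul_C, coeff_map, coeff_C_mul, rootCoeff, rootCoeff]

lemma map_signedEsymm {P' : Type*} [CommRing P'] (g : P →+* P') (f : ι → P) (B : Finset ι) (m : ℕ) :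
    g (signedEsymm f B m) = signedEsymm (fun i => g (f i)) B m := by
  rw [signedEsymm, signedEsymm, ← coeff_map, Polynomial.map_prod]
  simp

variable [DecidableEq ι]

lemma rootCoeff_insert_zero (f : ι → P) {B : Finset ι} {k : ι} (hk : k ∉ B) :
    rootCoeff f (insert k B) 0 = -(f k * rootCoeff f B 0) := by
  rw [rootCoeff, Finset.prod_insert hk, sub_mul, coeff_sub, coeff_X_mul_zero, coeff_C_mul, zero_sub,
    rootCoeff]

lemma rootCoeff_insert_succ (f : ι → P) {B : Finset ι} {k : ι} (hk : k ∉ B) (m : ℕ) :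
    rootCoeff f (insert k B) (m + 1) = rootCoeff f B m - f k * rootCoeff f B (m + 1) := by
  rw [rootCoeff, Finset.prod_insert hk, sub_mul, coeff_sub, coeff_X_mul, coeff_C_mul, rootCoeff,
    rootCoeff]

lemma signedEsymm_insert_succ (f : ι → P) {B : Finset ι} {k : ι} (hk : k ∉ B) (m : ℕ) :
    signedEsymm f (insert k B) (m + 1) = signedEsymm f B (m + 1) - f k * signedEsymm f B m := by
  rw [signedEsymm, Finset.prod_insert hk, sub_mul, one_mul, coeff_sub, mul_assoc, coeff_C_mul,
    coeff_X_mul, signedEsymm, signedEsymm]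

lemma rootCoeff_eq_zero (f : ι → P) (B : Finset ι) {m : ℕ} (hm : B.card < m) :
    rootCoeff f B m = 0 := by
  induction B using Finset.induction_on generalizing m with
  | empty =>
    obtain ⟨m, rfl⟩ := Nat.exists_eq_succ_of_ne_zero (Nat.ne_of_gt hm)
    exact rootCoeff_empty_succ f m
  | insert k B hk ih =>
    rw [Finset.card_insert_of_notMem hk] at hm
    obtain ⟨m, rfl⟩ := Nat.exists_eq_succ_of_ne_zero (Nat.ne_of_gt (Nat.zero_lt_of_lt hm))
    rw [rootCoeff_insert_succ f hk, ih (by omega), ih (by omega), mul_zero, sub_zero]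

lemma signedEsymm_eq_zero (f : ι → P) (B : Finset ι) {m : ℕ} (hm : B.card < m) :
    signedEsymm f B m = 0 := by
  induction B using Finset.induction_on generalizing m with
  | empty =>
    rw [Finset.card_empty] at hm
    rw [signedEsymm, Finset.prod_empty, coeff_one, if_neg (Nat.ne_of_gt hm)]
  | insert k B hk ih =>
    rw [Finset.card_insert_of_notMem hk] at hm
    obtain ⟨m, rfl⟩ := Nat.exists_eq_succ_of_ne_zero (Nat.ne_of_gt (Nat.zero_lt_of_lt hm))
    rw [signedEsymm_insert_succ f hk, ih (by omega), ih (by omega), mul_zero, sub_zero]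

/-- The polynomial `∏ (1 - f_i t)` is the reversal of `∏ (t - f_i)`. The signed form is indexed by
degree, independently of the number of roots. -/
lemma rootCoeff_eq_signedEsymm (f : ι → P) (B : Finset ι) {m i : ℕ} (h : m + i = B.card) :
    rootCoeff f B m = signedEsymm f B i := by
  induction B using Finset.induction_on generalizing m i with
  | empty =>
    rw [Finset.card_empty] at h
    obtain ⟨rfl, rfl⟩ : m = 0 ∧ i = 0 := by omega
    rw [rootCoeff, signedEsymm, Finset.prod_empty, Finset.prod_empty]
  | insert k B hk ih =>
    rw [Finset.card_insert_of_notMem hk] at h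
    cases m with
    | zero =>
      obtain rfl : i = B.card + 1 := by omega
      rw [rootCoeff_insert_zero f hk, signedEsymm_insert_succ f hk,
        signedEsymm_eq_zero f B (Nat.lt_succ_self _), ih (i := B.card) (by omega), zero_sub]
    | succ m =>
      cases i with
      | zero =>
        rw [rootCoeff_insert_succ f hk, rootCoeff_eq_zero f B (m := m + 1) (by omega), mul_zero,
          sub_zero, signedEsymm_zero, ih (i := 0) (by omega), signedEsymm_zero]
      | succ i =>
        rw [rootCoeff_insert_succ f hk, signedEsymm_insert_succ f hk, ih (i := i + 1) (by omega),
          ih (i := i) (by omega)]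

lemma rootCoeff_card (f : ι → P) (B : Finset ι) : rootCoeff f B B.card = 1 := by
  rw [rootCoeff_eq_signedEsymm f B (i := 0) (by omega), signedEsymm_zero]

end Signed

variable {N : ℕ}

lemma neg_one_pow_mul_map {P H : Type*} [Ring P] [Ring H] (ν : P →+ H) (n : ℕ) (f : P) :
    (-1) ^ n * ν f = ν ((-1) ^ n * f) := by
  induction n with
  | zero => rw [pow_zero, pow_zero, one_mul, one_mul]
  | succ n ih => rw [neg_one_pow_succ_mul, neg_one_pow_succ_mul, ih, map_neg]

lemma neg_one_pow_mul_fixedProdOf_coeff {P : Type*} [CommRing P] (ξ η : Fin N → P)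
    (σ : Equiv.Perm (Fin N)) (a b : ℕ) :
    (-1) ^ N * ((fixedProdOf ξ η σ).coeff a).coeff b = ∑ B ∈ (fixedPts σ).powerset,
      (-1) ^ (N + B.card) * (rootCoeff ξ B a * rootCoeff η B b) := by
  have h : ∀ (n : ℕ) (p : P[X][X]), (((-1) ^ n * p).coeff a).coeff b
      = (-1) ^ n * (p.coeff a).coeff b := by
    intro n p
    exact (neg_one_pow_mul_map ((lcoeff P b).toAddMonoidHom.comp
      (lcoeff P[X] a).toAddMonoidHom) n p).symm
  rw [fixedProdOf_eq_sum]
  simp only [finsetSum_coeff, h, coeff_coeff_prod_mul_prod, Finset.mul_sum, pow_add, mul_assoc]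

lemma card_univ_fin : (Finset.univ : Finset (Fin N)).card = N := by
  rw [Finset.card_univ, Fintype.card_fin]

/-- A nontrivial permutation moves at least two points. -/
lemma card_fixedPts_lt {M : ℕ} {σ : Equiv.Perm (Fin (M + 1))} (h : σ ≠ 1) :
    (fixedPts σ).card < M := by
  have h1 := Equiv.Perm.two_le_card_support_of_ne_one h
  have h2 : fixedPts σ = σ.supportᶜ := by
    ext i
    simp [fixedPts]
  have h3 := Finset.card_le_univ σ.support
  rw [h2, Finset.card_compl, Fintype.card_fin]
  rw [Fintype.card_fin] at h3
  omega

lemma fixedPts_one : fixedPts (1 : Equiv.Perm (Fin N)) = Finset.univ := by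
  simp [fixedPts]

lemma sum_powersetCard_univ {M : ℕ} {P : Type*} [AddCommMonoid P] (F : Finset (Fin (M + 1)) → P) :
    ∑ B ∈ Finset.powersetCard M Finset.univ, F B = ∑ k, F (Finset.univ.erase k) := by
  symm
  refine Finset.sum_bij (fun k _ => Finset.univ.erase k) ?_ ?_ ?_ fun _ _ => rfl
  · intro k _
    rw [Finset.mem_powersetCard]
    refine ⟨Finset.subset_univ _, ?_⟩
    rw [Finset.card_erase_of_mem (Finset.mem_univ k), Finset.card_univ, Fintype.card_fin]
    rfl
  · intro k _ l _ h
    by_contra hkl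
    have : k ∈ Finset.univ.erase k := by
      rw [h]
      exact Finset.mem_erase.mpr ⟨hkl, Finset.mem_univ k⟩
    exact Finset.notMem_erase k _ this
  · intro B hB
    rw [Finset.mem_powersetCard] at hB
    have hc : Bᶜ.card = 1 := by
      rw [Finset.card_compl, Fintype.card_fin, hB.2]
      omega
    obtain ⟨k, hk⟩ := Finset.card_eq_one.mp hc
    refine ⟨k, Finset.mem_univ k, ?_⟩
    rw [← compl_compl B, hk, Finset.compl_singleton]

lemma sum_powerset_alternating {M : ℕ} {P : Type*} [CommRing P] (F : Finset (Fin (M + 1)) → P) :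
    ∑ B ∈ (Finset.univ : Finset (Fin (M + 1))).powerset, (-1) ^ (M + 1 + B.card) * F B
      = (∑ j ∈ Finset.range M, ∑ B ∈ Finset.powersetCard j Finset.univ,
          (-1) ^ (M + 1 + B.card) * F B)
        + (F Finset.univ - ∑ k, F (Finset.univ.erase k)) := by
  have e1 : ∑ B ∈ Finset.powersetCard M (Finset.univ : Finset (Fin (M + 1))),
      (-1) ^ (M + 1 + B.card) * F B = -∑ k, F (Finset.univ.erase k) := by
    rw [sum_powersetCard_univ, ← Finset.sum_neg_distrib]
    refine Finset.sum_congr rfl fun k _ => ?_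
    rw [Finset.card_erase_of_mem (Finset.mem_univ k), Finset.card_univ, Fintype.card_fin,
      Odd.neg_one_pow ⟨M, by simp; ring⟩, neg_one_mul]
  have e2 : ∑ B ∈ Finset.powersetCard (M + 1) (Finset.univ : Finset (Fin (M + 1))),
      (-1) ^ (M + 1 + B.card) * F B = F Finset.univ := by
    have : Finset.powersetCard (M + 1) (Finset.univ : Finset (Fin (M + 1))) = {Finset.univ} := by
      have := Finset.powersetCard_self (Finset.univ : Finset (Fin (M + 1)))
      rwa [card_univ_fin] at this
    rw [this, Finset.sum_singleton, Finset.card_univ, Fintype.card_fin,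
      Even.neg_one_pow ⟨M + 1, rfl⟩, one_mul]
  rw [Finset.sum_powerset, Finset.card_univ, Fintype.card_fin, Finset.sum_range_succ,
    Finset.sum_range_succ, e1, e2]
  ring

/-! ### Leading terms of the central elements -/

/-- `x_i` in `ℂ[x, y]`. -/
def xVar (i : Fin N) : PolyXY N := MvPolynomial.X (Sum.inl i)

/-- `y_i` in `ℂ[x, y]`. -/
def yVar (i : Fin N) : PolyXY N := MvPolynomial.X (Sum.inr i)

lemma ltDeg_zero {f : PolyXY N} (hf : f ∈ ltDeg N 0) : f = 0 := by
  ext m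
  exact hf m (Nat.zero_le _)

lemma mul_mem_ltDeg' {d e : ℕ} {f g : PolyXY N} (hf : f ∈ ltDeg N d) (hg : g ∈ ltDeg N e) :
    f * g ∈ ltDeg N (d + e) := by
  cases d with
  | zero => rw [ltDeg_zero hf, zero_mul]; exact zero_mem _
  | succ d => exact ltDeg_mono (by omega) (mul_mem_ltDeg hf hg)

lemma neg_one_pow_mul_mem_ltDeg {d : ℕ} (n : ℕ) {f : PolyXY N} (hf : f ∈ ltDeg N d) :
    (-1) ^ n * f ∈ ltDeg N d := by
  rcases neg_one_pow_eq_or (PolyXY N) n with h | h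
  · rwa [h, one_mul]
  · rw [h, neg_one_mul]; exact neg_mem hf

/-- The coefficient of `t^m` is homogeneous of degree `|B| - m` in the roots. The summand one is
there because `ltDeg` bounds the degree strictly; for `m > |B|` the truncated bound is zero, and so
is the coefficient. -/
lemma rootCoeff_mem_ltDeg {v : Fin N → Fin N ⊕ Fin N} (B : Finset (Fin N)) (m : ℕ) :
    rootCoeff (fun i => (MvPolynomial.X (v i) : PolyXY N)) B m ∈ ltDeg N (B.card + 1 - m) := by
  induction B using Finset.induction_on generalizing m with
  | empty =>
    cases m with
    | zero =>
      have := rootCoeff_card (fun i => (MvPolynomial.X (v i) : PolyXY N)) ∅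
      rw [Finset.card_empty] at this ⊢
      rw [this]
      exact one_mem_ltDeg
    | succ m => rw [rootCoeff_empty_succ]; exact zero_mem _
  | insert k B hk ih =>
    rw [Finset.card_insert_of_notMem hk]
    cases m with
    | zero =>
      rw [rootCoeff_insert_zero _ hk]
      exact neg_mem (X_mul_mem_ltDeg _ (ih 0))
    | succ m =>
      rw [rootCoeff_insert_succ _ hk]
      refine sub_mem (ltDeg_mono (by omega) (ih m)) ?_
      by_cases h : m ≤ B.card
      · exact ltDeg_mono (by omega) (X_mul_mem_ltDeg _ (ih (m + 1)))
      · rw [rootCoeff_eq_zero _ B (by omega), mul_zero]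
        exact zero_mem _

lemma cZ_eq_sum (i j : Fin (N + 1)) : cZ N i j = ∑ σ : Equiv.Perm (Fin N),
    normalOrder N (∑ B ∈ (fixedPts σ).powerset, (-1) ^ (N + B.card)
      * (rootCoeff xVar B (N - i) * rootCoeff yVar B (N - j)))
      * (((Equiv.Perm.sign σ : ℤˣ) : ℤ) • permH N σ) := by
  rw [cZ, Finset.mul_sum]
  refine Finset.sum_congr rfl fun σ _ => ?_
  rw [← mul_assoc]
  congr 1
  refine (neg_one_pow_mul_map (normalOrder N).toAddMonoidHom N _).trans ?_
  exact congrArg (normalOrder N) (neg_one_pow_mul_fixedProdOf_coeff xVar yVar σ _ _)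

/-- If only the full set of indices contributes, then only the identity contributes, since it is the
only permutation with all points fixed. This applies when `i` or `j` is zero, where a power `N` of
`v` or `u` requires `N` factors. -/
lemma cZ_eq_of_unique {i j : Fin (N + 1)}
    (h : ∀ B : Finset (Fin N), B ≠ Finset.univ →
      rootCoeff xVar B (N - i) * rootCoeff yVar B (N - j) = (0 : PolyXY N)) :
    cZ N i j = normalOrder N (rootCoeff xVar Finset.univ (N - i)
      * rootCoeff yVar Finset.univ (N - j)) := by
  rw [cZ_eq_sum, Finset.sum_eq_single 1]
  · rw [Finset.sum_eq_single Finset.univ]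
    · rw [Finset.card_univ, Fintype.card_fin, Even.neg_one_pow ⟨N, rfl⟩, one_mul,
        Equiv.Perm.sign_one, Units.val_one, one_smul, map_one, mul_one]
    · intro B _ hB
      rw [h B hB, mul_zero]
    · intro hu
      rw [fixedPts_one] at hu
      exact absurd (Finset.mem_powerset_self _) hu
  · intro σ _ hσ
    rw [Finset.sum_eq_zero, map_zero, zero_mul]
    intro B hB
    rw [h B, mul_zero]
    rintro rfl
    refine hσ (Equiv.ext fun i => ?_)
    have := Finset.mem_powerset.mp hB (Finset.mem_univ i)
    exact (Finset.mem_filter.mp this).2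
  · simp

lemma card_lt_of_ne_univ {B : Finset (Fin N)} (h : B ≠ Finset.univ) : B.card < N := by
  have := Finset.card_lt_card (Finset.ssubset_univ_iff.mpr h)
  rwa [Finset.card_univ, Fintype.card_fin] at this

lemma cZ_zero_right (i : Fin (N + 1)) :
    cZ N i 0 = normalOrder N (signedEsymm xVar Finset.univ i) := by
  have hu : rootCoeff (yVar : Fin N → PolyXY N) Finset.univ N = 1 := by
    have := rootCoeff_card (yVar : Fin N → PolyXY N) Finset.univ
    rwa [card_univ_fin] at this
  have hi := i.2
  rw [cZ_eq_of_unique fun B hB => ?_]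
  · rw [Fin.val_zero, Nat.sub_zero, hu, mul_one, rootCoeff_eq_signedEsymm (i := i)]
    rw [card_univ_fin]
    omega
  · rw [Fin.val_zero, Nat.sub_zero, rootCoeff_eq_zero yVar B (card_lt_of_ne_univ hB), mul_zero]

lemma cZ_zero_left (j : Fin (N + 1)) :
    cZ N 0 j = normalOrder N (signedEsymm yVar Finset.univ j) := by
  have hu : rootCoeff (xVar : Fin N → PolyXY N) Finset.univ N = 1 := by
    have := rootCoeff_card (xVar : Fin N → PolyXY N) Finset.univ
    rwa [card_univ_fin] at this
  have hj := j.2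
  rw [cZ_eq_of_unique fun B hB => ?_]
  · rw [Fin.val_zero, Nat.sub_zero, hu, one_mul, rootCoeff_eq_signedEsymm (i := j)]
    rw [card_univ_fin]
    omega
  · rw [Fin.val_zero, Nat.sub_zero, rootCoeff_eq_zero xVar B (card_lt_of_ne_univ hB), zero_mul]

lemma cZ_mul_cZ (i j : Fin (N + 1)) : cZ N i 0 * cZ N 0 j = normalOrder N
    (signedEsymm xVar Finset.univ i * signedEsymm yVar Finset.univ j) := by
  have hx : ∀ n, signedEsymm (xVar : Fin N → PolyXY N) Finset.univ n
      = MvPolynomial.rename Sum.inl (signedEsymm MvPolynomial.X Finset.univ n) := fun n => by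
    refine Eq.trans ?_ (map_signedEsymm (MvPolynomial.rename Sum.inl :
      MvPolynomial (Fin N) ℂ →ₐ[ℂ] PolyXY N).toRingHom MvPolynomial.X Finset.univ n).symm
    exact congrArg (fun f => signedEsymm f Finset.univ n)
      (funext fun i => (MvPolynomial.rename_X Sum.inl i).symm)
  have hy : ∀ n, signedEsymm (yVar : Fin N → PolyXY N) Finset.univ n
      = MvPolynomial.rename Sum.inr (signedEsymm MvPolynomial.X Finset.univ n) := fun n => by
    refine Eq.trans ?_ (map_signedEsymm (MvPolynomial.rename Sum.inr :
      MvPolynomial (Fin N) ℂ →ₐ[ℂ] PolyXY N).toRingHom MvPolynomial.X Finset.univ n).symm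
    exact congrArg (fun f => signedEsymm f Finset.univ n)
      (funext fun i => (MvPolynomial.rename_X Sum.inr i).symm)
  rw [cZ_zero_right, cZ_zero_left, hx, hy, normalOrder_rename, normalOrder_inl, normalOrder_inr]

/-- `∑_k e_a(x with x_k omitted) e_b(y with y_k omitted)`, up to sign. -/
def omitSum (N a b : ℕ) : PolyXY N :=
  ∑ k : Fin N, signedEsymm xVar (Finset.univ.erase k) a * signedEsymm yVar (Finset.univ.erase k) b

/-- In `c_{a+1,b+1}` a subset `B` of fixed points contributes in degree `2|B| - 2M + a + b`. The
full set gives the product of elementary symmetric polynomials, which is `c_{a+1,0} c_{0,b+1}`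
exactly. The sets with one point omitted give, for the identity, the next term `omitSum`. Smaller
sets have lower degree, and a nontrivial permutation admits only smaller sets. -/
lemma cZ_mul_cZ_sub {M a b : ℕ} (ha : a ≤ M) (hb : b ≤ M) :
    cZ (M + 1) ⟨a + 1, by omega⟩ 0 * cZ (M + 1) 0 ⟨b + 1, by omega⟩
      - cZ (M + 1) ⟨a + 1, by omega⟩ ⟨b + 1, by omega⟩
      - normalOrder (M + 1) (omitSum (M + 1) a b) ∈ ltFil (M + 1) (a + b) := by
  set F : Finset (Fin (M + 1)) → PolyXY (M + 1) := fun B =>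
    rootCoeff xVar B (M - a) * rootCoeff yVar B (M - b) with hF
  have hsmall : ∀ B : Finset (Fin (M + 1)), B.card < M →
      (-1) ^ (M + 1 + B.card) * F B ∈ ltDeg (M + 1) (a + b) := by
    intro B hB
    refine neg_one_pow_mul_mem_ltDeg _ (mul_mem_ltDeg' ?_ ?_)
    · exact ltDeg_mono (by omega) (rootCoeff_mem_ltDeg B (M - a))
    · exact ltDeg_mono (by omega) (rootCoeff_mem_ltDeg B (M - b))
  have hlead : F Finset.univ - ∑ k, F (Finset.univ.erase k)
      = signedEsymm xVar Finset.univ (a + 1) * signedEsymm yVar Finset.univ (b + 1)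
        - omitSum (M + 1) a b := by
    refine congrArg₂ (· - ·) ?_ (Finset.sum_congr rfl fun k _ => ?_)
    · rw [hF]
      change rootCoeff _ _ _ * rootCoeff _ _ _ = _
      rw [rootCoeff_eq_signedEsymm _ _ (i := a + 1) (by rw [card_univ_fin]; omega),
        rootCoeff_eq_signedEsymm _ _ (i := b + 1) (by rw [card_univ_fin]; omega)]
    · have hc : (Finset.univ.erase k).card = M := by
        rw [Finset.card_erase_of_mem (Finset.mem_univ k), card_univ_fin]
        rfl
      change rootCoeff _ _ _ * rootCoeff _ _ _ = _
      rw [rootCoeff_eq_signedEsymm _ _ (i := a) (by rw [hc]; omega),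
        rootCoeff_eq_signedEsymm _ _ (i := b) (by rw [hc]; omega)]
  have hc : cZ (M + 1) ⟨a + 1, by omega⟩ ⟨b + 1, by omega⟩ = ∑ σ : Equiv.Perm (Fin (M + 1)),
      normalOrder (M + 1) (∑ B ∈ (fixedPts σ).powerset, (-1) ^ (M + 1 + B.card) * F B)
        * (((Equiv.Perm.sign σ : ℤˣ) : ℤ) • permH (M + 1) σ) := by
    rw [cZ_eq_sum]
    have e1 : M + 1 - (a + 1) = M - a := by omega
    have e2 : M + 1 - (b + 1) = M - b := by omega
    simp only [e1, e2, hF]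
  have hrest : ∑ σ ∈ (Finset.univ : Finset (Equiv.Perm (Fin (M + 1)))).erase 1,
      normalOrder (M + 1) (∑ B ∈ (fixedPts σ).powerset, (-1) ^ (M + 1 + B.card) * F B)
        * (((Equiv.Perm.sign σ : ℤˣ) : ℤ) • permH (M + 1) σ) ∈ ltFil (M + 1) (a + b) := by
    refine sum_mem fun σ hσ => ?_
    rw [mul_smul_comm]
    refine zsmul_mem (mem_ltFil (sum_mem fun B hB => hsmall B ?_) σ) _
    exact (Finset.card_le_card (Finset.mem_powerset.mp hB)).trans_lt
      (card_fixedPts_lt (Finset.ne_of_mem_erase hσ))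
  have hone : normalOrder (M + 1) (∑ j ∈ Finset.range M, ∑ B ∈ Finset.powersetCard j Finset.univ,
      (-1) ^ (M + 1 + B.card) * F B) ∈ ltFil (M + 1) (a + b) := by
    refine normalOrder_mem_ltFil (sum_mem fun j hj => sum_mem fun B hB => hsmall B ?_)
    rw [(Finset.mem_powersetCard.mp hB).2]
    exact Finset.mem_range.mp hj
  rw [cZ_mul_cZ, hc, ← Finset.add_sum_erase _ _ (Finset.mem_univ 1), fixedPts_one,
    sum_powerset_alternating, hlead, map_add, map_sub, Equiv.Perm.sign_one, Units.val_one, one_smul,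
    map_one, mul_one]
  have := neg_mem (add_mem hone hrest)
  convert this using 1
  abel

end LeadingTerms

end BetheCherednik

end

noncomputable section

namespace BetheCherednik

open MvPolynomial hiding funext

/-! ### The elements `c_{ij}` generate the center -/

section Center

variable {N : ℕ}

variable (N) in
/-- The subalgebra generated by the elements `c_{ij}`. -/
def cAlgebra : Subalgebra ℂ (Cherednik N) :=
  Algebra.adjoin ℂ (Set.range fun p : Fin (N + 1) × Fin (N + 1) => cZ N p.1 p.2)

lemma cZ_mem_cAlgebra (i j : Fin (N + 1)) : cZ N i j ∈ cAlgebra N :=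
  Algebra.subset_adjoin ⟨(i, j), rfl⟩

lemma cAlgebra_le_center : cAlgebra N ≤ Subalgebra.center ℂ (Cherednik N) :=
  Algebra.adjoin_le (by rintro _ ⟨p, rfl⟩; exact cZ_mem_center _ _)

variable (N) in
/-- The polynomials of degree at most `n` that are leading terms of elements of `cAlgebra`. -/
def leadSpace (n : ℕ) : Submodule ℂ (PolyXY N) where
  carrier := {f | f ∈ ltDeg N (n + 1) ∧ ∃ z ∈ cAlgebra N, z - normalOrder N f ∈ ltFil N n}
  zero_mem' := ⟨zero_mem _, 0, zero_mem _, by rw [map_zero, sub_zero]; exact zero_mem _⟩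
  add_mem' := by
    rintro f g ⟨hf, z, hz, h⟩ ⟨hg, z', hz', h'⟩
    refine ⟨add_mem hf hg, z + z', add_mem hz hz', ?_⟩
    have := add_mem h h'
    rw [map_add]
    convert this using 1
    abel
  smul_mem' := by
    rintro c f ⟨hf, z, hz, h⟩
    refine ⟨Submodule.smul_mem _ c hf, c • z, Subalgebra.smul_mem _ hz c, ?_⟩
    have := Submodule.smul_mem _ c h
    rwa [smul_sub, ← map_smul] at this

lemma ltFil_zero {h : Cherednik N} (hh : h ∈ ltFil N 0) : h = 0 := by
  refine ltFil_induction (P := fun h => h = 0) rfl (fun f g hf hg => by rw [hf, hg, add_zero])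
    (fun f hf σ => by rw [ltDeg_zero hf, map_zero, zero_mul]) hh

lemma mem_leadSpace_of_ltDeg {n : ℕ} {f : PolyXY N} (hf : f ∈ ltDeg N n) : f ∈ leadSpace N n := by
  refine ⟨ltDeg_mono (Nat.le_succ n) hf, 0, zero_mem _, ?_⟩
  rw [zero_sub]
  exact neg_mem (normalOrder_mem_ltFil hf)

lemma one_mem_leadSpace : (1 : PolyXY N) ∈ leadSpace N 0 := by
  refine ⟨one_mem_ltDeg, 1, one_mem _, ?_⟩
  rw [normalOrder_one, sub_self]
  exact zero_mem _

lemma mul_mem_leadSpace {n m : ℕ} {f g : PolyXY N} (hf : f ∈ leadSpace N n)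
    (hg : g ∈ leadSpace N m) : f * g ∈ leadSpace N (n + m) := by
  obtain ⟨hf, z, hz, h⟩ := hf
  obtain ⟨hg, z', hz', h'⟩ := hg
  have hfg := mul_mem_ltDeg hf hg
  refine ⟨hfg, z * z', mul_mem hz hz', ?_⟩
  have hz1 : z' ∈ ltFil N (m + 1) := by
    have := add_mem (ltFil_mono (Nat.le_succ m) h') (normalOrder_mem_ltFil hg)
    rwa [sub_add_cancel] at this
  have h1 : (z - normalOrder N f) * z' ∈ ltFil N (n + m) := by
    -- In filtration index zero the error vanishes; this case is separate because the product bound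
    -- needs positive indices.
    cases n with
    | zero => rw [ltFil_zero h, zero_mul]; exact zero_mem _
    | succ n => exact ltFil_mono (by omega) (ltFil_mul_ltFil h hz1)
  have h2 : normalOrder N f * (z' - normalOrder N g) ∈ ltFil N (n + m) := by
    cases m with
    | zero => rw [ltFil_zero h', mul_zero]; exact zero_mem _
    | succ m => exact ltFil_mul_ltFil (normalOrder_mem_ltFil hf) h'
  have := add_mem (add_mem h1 h2) (normalOrder_mul_sub hf hg)
  convert this using 1
  rw [sub_mul, mul_sub]
  abel

/-! ### Power sums are leading terms -/

lemma signedEsymm_mem_ltDeg {v : Fin N → Fin N ⊕ Fin N} (B : Finset (Fin N)) (m : ℕ) :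
    signedEsymm (fun i => (X (v i) : PolyXY N)) B m ∈ ltDeg N (m + 1) := by
  by_cases h : m ≤ B.card
  · rw [← rootCoeff_eq_signedEsymm _ B (m := B.card - m) (by omega)]
    exact ltDeg_mono (by omega) (rootCoeff_mem_ltDeg B _)
  · rw [signedEsymm_eq_zero _ B (by omega)]
    exact zero_mem _

lemma signedEsymm_xVar_mem (i : ℕ) :
    signedEsymm xVar Finset.univ i ∈ leadSpace N i := by
  by_cases h : i ≤ N
  · refine ⟨signedEsymm_mem_ltDeg _ _, cZ N ⟨i, by omega⟩ 0, cZ_mem_cAlgebra _ _, ?_⟩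
    rw [cZ_zero_right, sub_self]
    exact zero_mem _
  · rw [signedEsymm_eq_zero _ _ (by rw [card_univ_fin]; omega)]
    exact zero_mem _

lemma signedEsymm_yVar_mem (i : ℕ) :
    signedEsymm yVar Finset.univ i ∈ leadSpace N i := by
  by_cases h : i ≤ N
  · refine ⟨signedEsymm_mem_ltDeg _ _, cZ N 0 ⟨i, by omega⟩, cZ_mem_cAlgebra _ _, ?_⟩
    rw [cZ_zero_left, sub_self]
    exact zero_mem _
  · rw [signedEsymm_eq_zero _ _ (by rw [card_univ_fin]; omega)]
    exact zero_mem _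

/-- For `a, b ≤ N - 1` this is the leading term of `c_{a+1,0} c_{0,b+1} - c_{a+1,b+1}`. Otherwise
the sum vanishes, since only `N - 1` variables remain after one is omitted. -/
lemma omitSum_mem (a b : ℕ) : omitSum N a b ∈ leadSpace N (a + b) := by
  obtain _ | M := N
  · rw [omitSum, Finset.univ_eq_empty, Finset.sum_empty]
    exact zero_mem _
  have hc : ∀ k : Fin (M + 1), (Finset.univ.erase k).card = M := fun k => by
    rw [Finset.card_erase_of_mem (Finset.mem_univ k), card_univ_fin]
    rfl
  by_cases ha : a ≤ M
  · by_cases hb : b ≤ M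
    · refine ⟨sum_mem fun k _ => ?_, _, ?_, cZ_mul_cZ_sub ha hb⟩
      · have hx : signedEsymm xVar (Finset.univ.erase k) a ∈ ltDeg (M + 1) (a + 1) :=
          signedEsymm_mem_ltDeg _ _
        have hy : signedEsymm yVar (Finset.univ.erase k) b ∈ ltDeg (M + 1) (b + 1) :=
          signedEsymm_mem_ltDeg _ _
        have hxy := mul_mem_ltDeg hx hy
        exact hxy
      · exact sub_mem (mul_mem (cZ_mem_cAlgebra _ _) (cZ_mem_cAlgebra _ _)) (cZ_mem_cAlgebra _ _)
    · rw [omitSum, Finset.sum_eq_zero]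
      · exact zero_mem _
      · intro k _
        rw [signedEsymm_eq_zero yVar _ (by rw [hc]; omega), mul_zero]
  · rw [omitSum, Finset.sum_eq_zero]
    · exact zero_mem _
    · intro k _
      rw [signedEsymm_eq_zero xVar _ (by rw [hc]; omega), zero_mul]

/-- `∑_k x_k^l y_k^m e_a(x with x_k omitted) e_b(y with y_k omitted)`, up to sign. -/
def omitPowerSum (N l m a b : ℕ) : PolyXY N :=
  ∑ k : Fin N, xVar k ^ l * yVar k ^ m
    * (signedEsymm xVar (Finset.univ.erase k) a * signedEsymm yVar (Finset.univ.erase k) b)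

lemma signedEsymm_erase {P : Type*} [CommRing P] (f : Fin N → P) (k : Fin N) (a : ℕ) :
    f k * signedEsymm f (Finset.univ.erase k) a
      = signedEsymm f (Finset.univ.erase k) (a + 1) - signedEsymm f Finset.univ (a + 1) := by
  have := signedEsymm_insert_succ f (Finset.notMem_erase k Finset.univ) a
  rw [Finset.insert_erase (Finset.mem_univ k)] at this
  rw [this]
  ring

/-- Splitting off `x_k` expresses `x_k e_a(x without x_k)` as a difference of `e_{a+1}` with and
without `x_k`, up to sign. A power of `x_k` is thus traded for a higher index, down to the sums
already known to be leading terms. -/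
lemma omitPowerSum_succ_left (l m a b : ℕ) : omitPowerSum N (l + 1) m a b
    = omitPowerSum N l m (a + 1) b - signedEsymm xVar Finset.univ (a + 1) * omitPowerSum N l m 0 b := by
  rw [omitPowerSum, omitPowerSum, omitPowerSum, Finset.mul_sum, ← Finset.sum_sub_distrib]
  refine Finset.sum_congr rfl fun k _ => ?_
  have h := signedEsymm_erase (xVar : Fin N → PolyXY N) k a
  rw [signedEsymm_zero]
  linear_combination
    (xVar k ^ l * yVar k ^ m * signedEsymm yVar (Finset.univ.erase k) b) * h

lemma omitPowerSum_succ_right (l m a b : ℕ) : omitPowerSum N l (m + 1) a b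
    = omitPowerSum N l m a (b + 1) - signedEsymm yVar Finset.univ (b + 1) * omitPowerSum N l m a 0 := by
  rw [omitPowerSum, omitPowerSum, omitPowerSum, Finset.mul_sum, ← Finset.sum_sub_distrib]
  refine Finset.sum_congr rfl fun k _ => ?_
  have h := signedEsymm_erase (yVar : Fin N → PolyXY N) k b
  rw [signedEsymm_zero yVar]
  linear_combination
    (xVar k ^ l * yVar k ^ m * signedEsymm xVar (Finset.univ.erase k) a) * h

lemma leadSpace_cast {n n' : ℕ} (h : n = n') {f : PolyXY N} (hf : f ∈ leadSpace N n) :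
    f ∈ leadSpace N n' := h ▸ hf

lemma omitPowerSum_mem (l m a b : ℕ) : omitPowerSum N l m a b ∈ leadSpace N (l + m + a + b) := by
  induction l generalizing a b with
  | zero =>
    induction m generalizing a b with
    | zero =>
      refine leadSpace_cast (n := a + b) (by omega) ?_
      have := omitSum_mem (N := N) a b
      rw [omitSum] at this
      simpa only [omitPowerSum, pow_zero, one_mul] using this
    | succ m ih =>
      rw [omitPowerSum_succ_right]
      exact sub_mem (leadSpace_cast (by omega) (ih a (b + 1)))
        (leadSpace_cast (by omega) (mul_mem_leadSpace (signedEsymm_yVar_mem (b + 1)) (ih a 0)))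
  | succ l ih =>
    rw [omitPowerSum_succ_left]
    exact sub_mem (leadSpace_cast (by omega) (ih (a + 1) b))
      (leadSpace_cast (by omega) (mul_mem_leadSpace (signedEsymm_xVar_mem (a + 1)) (ih 0 b)))

/-- `x_i^{p_1} y_i^{p_2}`. -/
def xyPow (i : Fin N) (p : ℕ × ℕ) : PolyXY N := xVar i ^ p.1 * yVar i ^ p.2

lemma xyPow_add (i : Fin N) (p q : ℕ × ℕ) : xyPow i (p + q) = xyPow i p * xyPow i q := by
  rw [xyPow, xyPow, xyPow, Prod.fst_add, Prod.snd_add, pow_add, pow_add]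
  ring

lemma sum_xyPow_mem (p : ℕ × ℕ) : ∑ i : Fin N, xyPow i p ∈ leadSpace N (p.1 + p.2) := by
  have := omitPowerSum_mem (N := N) p.1 p.2 0 0
  simpa only [omitPowerSum, xyPow, signedEsymm_zero, mul_one, add_zero] using this

/-! ### Symmetrized monomials are leading terms -/

/-- The symmetrization of a monomial in the variables `x_k`, `y_k`, `k ∈ T`. -/
def symmMonomial (T : Finset (Fin N)) (m : Fin N → ℕ × ℕ) : PolyXY N :=
  ∑ σ : Equiv.Perm (Fin N), ∏ k ∈ T, xyPow (σ k) (m k)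

/-- Weyl's polarization step: the variable contributed by the power sum either coincides with one
already used by the monomial, where the exponents add up, or it is new. The new positions outside
`T` all give the same symmetrization. -/
lemma symmMonomial_mul (T : Finset (Fin N)) {k : Fin N} (hk : k ∉ T) (m : Fin N → ℕ × ℕ) :
    symmMonomial T m * ∑ i, xyPow i (m k)
      = ∑ i ∈ T, symmMonomial T (Function.update m i (m i + m k))
        + Tᶜ.card • symmMonomial (insert k T) m := by
  have e1 : symmMonomial T m * ∑ i, xyPow i (m k)
      = ∑ i, ∑ σ : Equiv.Perm (Fin N), (∏ j ∈ T, xyPow (σ j) (m j)) * xyPow (σ i) (m k) := by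
    rw [symmMonomial, Finset.sum_mul, Finset.sum_comm]
    refine Finset.sum_congr rfl fun σ _ => ?_
    rw [← Equiv.sum_comp σ, Finset.mul_sum]
  rw [e1, ← Finset.sum_add_sum_compl T, ← Finset.sum_const]
  refine congrArg₂ (· + ·) (Finset.sum_congr rfl fun i hi => ?_)
    (Finset.sum_congr rfl fun i hi => ?_)
  · refine Finset.sum_congr rfl fun σ _ => ?_
    have e2 : ∏ j ∈ T.erase i, xyPow (σ j) (Function.update m i (m i + m k) j)
        = ∏ j ∈ T.erase i, xyPow (σ j) (m j) := Finset.prod_congr rfl fun j hj => by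
      rw [Function.update_of_ne (Finset.ne_of_mem_erase hj)]
    rw [← Finset.mul_prod_erase T _ hi, ← Finset.mul_prod_erase T _ hi, Function.update_self,
      xyPow_add, e2]
    ring
  · rw [symmMonomial, ← Equiv.sum_comp (Equiv.mulRight (Equiv.swap i k))]
    refine Finset.sum_congr rfl fun σ _ => ?_
    rw [Finset.prod_insert hk, mul_comm]
    simp only [Equiv.coe_mulRight, Equiv.Perm.mul_apply, Equiv.swap_apply_left]
    congr 1
    refine Finset.prod_congr rfl fun j hj => ?_
    rw [Equiv.swap_apply_of_ne_of_ne (ne_of_mem_of_not_mem hj (Finset.mem_compl.mp hi))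
      (ne_of_mem_of_not_mem hj hk)]

/-- The product formula is solved for the symmetrization over `T ∪ {k}`; its multiplicity is the
size of the complement of `T`, which contains `k`. All other terms involve only `T`, so induction on
`T` applies. -/
lemma symmMonomial_mem (T : Finset (Fin N)) (m : Fin N → ℕ × ℕ) :
    symmMonomial T m ∈ leadSpace N (∑ k ∈ T, ((m k).1 + (m k).2)) := by
  induction T using Finset.induction_on generalizing m with
  | empty =>
    rw [symmMonomial, Finset.sum_empty]
    refine sum_mem fun σ _ => ?_
    rw [Finset.prod_empty]
    exact one_mem_leadSpace
  | insert k T hk ih =>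
    have hc : (Tᶜ.card : ℂ) ≠ 0 := by
      rw [Nat.cast_ne_zero]
      exact Finset.card_ne_zero_of_mem (Finset.mem_compl.mpr hk)
    rw [← Submodule.smul_mem_iff _ hc, Nat.cast_smul_eq_nsmul,
      ← add_sub_cancel_left (∑ i ∈ T, symmMonomial T (Function.update m i (m i + m k)))
        (Tᶜ.card • symmMonomial (insert k T) m), ← symmMonomial_mul T hk, Finset.sum_insert hk]
    refine sub_mem (leadSpace_cast (add_comm _ _) (mul_mem_leadSpace (ih m) (sum_xyPow_mem (m k))))
      (sum_mem fun i hi => leadSpace_cast ?_ (ih _))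
    rw [← Finset.add_sum_erase T _ hi, ← Finset.add_sum_erase T _ hi, Function.update_self,
      Finset.sum_congr (g := fun j => (m j).1 + (m j).2) rfl fun j hj => by
        rw [Function.update_of_ne (Finset.ne_of_mem_erase hj)], Prod.fst_add, Prod.snd_add]
    ring

lemma diagPerm_monomial (σ : Equiv.Perm (Fin N)) (m : Fin N ⊕ Fin N →₀ ℕ) :
    diagPerm σ (monomial m 1) = ∏ k, xyPow (σ k) (m (Sum.inl k), m (Sum.inr k)) := by
  rw [monomial_eq, C_1, one_mul, Finsupp.prod_fintype _ _ fun i => pow_zero _,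
    Fintype.prod_sum_type, map_mul, map_prod, map_prod, ← Finset.prod_mul_distrib]
  refine Finset.prod_congr rfl fun k _ => ?_
  rw [map_pow, map_pow, diagPerm, rename_X, rename_X]
  rfl

lemma sum_diagPerm_mem {n : ℕ} {f : PolyXY N} (hf : f ∈ ltDeg N (n + 1)) :
    ∑ σ : Equiv.Perm (Fin N), diagPerm σ f ∈ leadSpace N n := by
  refine ltDeg_induction (P := fun f => ∑ σ : Equiv.Perm (Fin N), diagPerm σ f ∈ leadSpace N n)
    (by simp [zero_mem]) (fun f g hf hg => ?_) (fun m c hm => ?_) hf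
  · simp only [map_add, Finset.sum_add_distrib]
    exact add_mem hf hg
  · rcases Nat.lt_succ_iff_lt_or_eq.mp hm with h | h
    · exact sum_mem fun σ _ => mem_leadSpace_of_ltDeg
        (rename_mem_ltDeg _ (monomial_mem_ltDeg h c))
    · have : (monomial m c : PolyXY N) = c • monomial m 1 := by
        rw [smul_monomial, smul_eq_mul, mul_one]
      simp only [this, map_smul]
      rw [← Finset.smul_sum]
      refine Submodule.smul_mem _ c ?_
      simp only [diagPerm_monomial]
      refine leadSpace_cast ?_ (symmMonomial_mem Finset.univ _)
      rw [← h, Finsupp.degree_eq_sum, Fintype.sum_sum_type, Finset.sum_add_distrib]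

/-- Invariant polynomials are leading terms of elements of `cAlgebra`. -/
lemma invariant_mem_leadSpace {n : ℕ} {f : PolyXY N} (hf : f ∈ ltDeg N (n + 1))
    (h : ∀ σ, diagPerm σ f = f) : f ∈ leadSpace N n := by
  have h1 := sum_diagPerm_mem hf
  simp only [h, Finset.sum_const, Finset.card_univ] at h1
  have hc : (Fintype.card (Equiv.Perm (Fin N)) : ℂ) ≠ 0 := by
    rw [Nat.cast_ne_zero]
    exact Fintype.card_ne_zero
  rwa [← Nat.cast_smul_eq_nsmul ℂ, Submodule.smul_mem_iff _ hc] at h1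

/-! ### Leading terms of central elements -/

lemma pbw_mem_ltFil_iff {n : ℕ} {g : Equiv.Perm (Fin N) → PolyXY N} :
    pbw N g ∈ ltFil N n ↔ ∀ σ, g σ ∈ ltDeg N n := by
  refine ⟨?_, pbw_mem_ltFil⟩
  rintro ⟨g', hg', h⟩ σ
  rw [← pbw_injective h]
  exact hg' σ trivial

lemma mem_ltDeg_iff {n : ℕ} {f : PolyXY N} : f ∈ ltDeg N n ↔ f = 0 ∨ f.totalDegree < n := by
  constructor
  · intro hf
    by_cases h0 : f = 0
    · exact Or.inl h0
    · refine Or.inr ?_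
      have hn : 0 < n := by
        by_contra hn
        obtain rfl : n = 0 := by omega
        exact h0 (ltDeg_zero hf)
      rw [totalDegree, Finset.sup_lt_iff hn]
      intro m hm
      by_contra hlt
      refine (mem_support_iff.mp hm) (hf m ?_)
      rw [Finsupp.degree_eq_sum, ← Finsupp.sum_fintype m (fun _ e => e) fun _ => rfl]
      omega
  · rintro (rfl | h)
    · exact zero_mem _
    · intro m hm
      refine coeff_eq_zero_of_totalDegree_lt (h.trans_le ?_)
      rwa [Finsupp.degree_apply] at hm

/-- The expression is `(x_k - x_l) f`, and in a domain multiplication by a nonzero linear form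
raises the degree by exactly one. -/
lemma mem_ltDeg_of_mul_mem {n : ℕ} {f : PolyXY N} {k l : Fin N} (hkl : k ≠ l)
    (h : X (Sum.inl k) * f - f * X (Sum.inl l) ∈ ltDeg N (n + 1)) : f ∈ ltDeg N n := by
  have e : X (Sum.inl k) * f - f * X (Sum.inl l)
      = (X (Sum.inl k) - X (Sum.inl l) : PolyXY N) * f := by ring
  have hne : (X (Sum.inl k) - X (Sum.inl l) : PolyXY N) ≠ 0 := zDiff_ne_zero hkl
  have hdeg : (X (Sum.inl k) - X (Sum.inl l) : PolyXY N).totalDegree = 1 :=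
    ((isHomogeneous_X ℂ _).sub (isHomogeneous_X ℂ _)).totalDegree hne
  rw [e, mem_ltDeg_iff] at h
  rw [mem_ltDeg_iff]
  rcases h with h | h
  · exact Or.inl ((mul_eq_zero.mp h).resolve_left hne)
  · by_cases hf : f = 0
    · exact Or.inl hf
    · rw [totalDegree_mul_of_isDomain hne hf, hdeg] at h
      exact Or.inr (by omega)

lemma pbw_mul_permH (g : Equiv.Perm (Fin N) → PolyXY N) (ρ : Equiv.Perm (Fin N)) :
    pbw N g * permH N ρ = pbw N fun σ => g (σ * ρ⁻¹) := by
  rw [pbw_apply, pbw_apply, Finset.sum_mul, ← Equiv.sum_comp (Equiv.mulRight ρ⁻¹)]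
  refine Finset.sum_congr rfl fun σ _ => ?_
  rw [Equiv.coe_mulRight, mul_assoc, ← map_mul, inv_mul_cancel_right]

lemma permH_mul_pbw (g : Equiv.Perm (Fin N) → PolyXY N) (ρ : Equiv.Perm (Fin N)) :
    permH N ρ * pbw N g = pbw N fun σ => diagPerm ρ (g (ρ⁻¹ * σ)) := by
  rw [pbw_apply, pbw_apply, Finset.mul_sum, ← Equiv.sum_comp (Equiv.mulLeft ρ⁻¹)]
  refine Finset.sum_congr rfl fun σ _ => ?_
  rw [Equiv.coe_mulLeft, ← mul_assoc, permH_mul_normalOrder, mul_assoc, ← map_mul,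
    mul_inv_cancel_left]

lemma xH_mul_pbw (g : Equiv.Perm (Fin N) → PolyXY N) (k : Fin N) :
    xH k * pbw N g = pbw N fun σ => X (Sum.inl k) * g σ := by
  rw [pbw_apply, pbw_apply, Finset.mul_sum]
  refine Finset.sum_congr rfl fun σ _ => ?_
  rw [normalOrder_X_mul, mul_assoc]

/-- Modulo lower terms `x_k` moves past `:f: σ` and becomes `x_{σ(k)}`. -/
lemma pbw_mul_xH_sub {n : ℕ} {g : Equiv.Perm (Fin N) → PolyXY N} (hg : ∀ σ, g σ ∈ ltDeg N (n + 1))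
    (k : Fin N) :
    pbw N g * xH k - (pbw N fun σ => g σ * X (Sum.inl (σ k))) ∈ ltFil N (n + 1) := by
  rw [pbw_apply, pbw_apply, Finset.sum_mul, ← Finset.sum_sub_distrib]
  refine sum_mem fun σ _ => ?_
  have hX : xH (σ k) = normalOrder N (X (Sum.inl (σ k))) := by
    have := normalOrder_X_mul (σ k) 1
    rw [mul_one, normalOrder_one, mul_one] at this
    exact this.symm
  have h := ltFil_mul_permH (normalOrder_mul_sub (hg σ) (X_mem_ltDeg (Sum.inl (σ k)))) σ
  rw [← hX, sub_mul, mul_assoc, ← permH_mul_xH, ← mul_assoc] at h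
  exact h

/-- Induction on the filtration: the leading term of a central element is also the leading term of
an element of `cAlgebra`, and subtracting that element lowers the degree. -/
lemma center_le_cAlgebra : Subalgebra.center ℂ (Cherednik N) ≤ cAlgebra N := by
  suffices h : ∀ n, ∀ z ∈ Subalgebra.center ℂ (Cherednik N), z ∈ ltFil N n → z ∈ cAlgebra N by
    intro z hz
    obtain ⟨n, hn⟩ := exists_mem_ltFil z
    exact h n z hz hn
  intro n
  induction n with
  | zero => intro z _ h; rw [ltFil_zero h]; exact zero_mem _
  | succ n ih =>
    intro z hz hzn
    obtain ⟨g, hg, rfl⟩ := hzn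
    replace hg : ∀ σ, g σ ∈ ltDeg N (n + 1) := fun σ => hg σ trivial
    have hz' := Subalgebra.mem_center_iff.mp hz
    -- Commuting with `x_k` forces `(x_k - x_{σ(k)}) g_σ` to have lower degree than expected, and
    -- `k` is chosen with `σ(k) ≠ k`.
    have h1 : ∀ σ, σ ≠ 1 → g σ ∈ ltDeg N n := by
      intro σ hσ
      obtain ⟨k, hk⟩ : ∃ k, σ k ≠ k := by
        by_contra h
        push Not at h
        exact hσ (Equiv.ext h)
      have h2 := pbw_mul_xH_sub hg k
      rw [← hz' (xH k), xH_mul_pbw, ← map_sub, pbw_mem_ltFil_iff] at h2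
      exact mem_ltDeg_of_mul_mem (Ne.symm hk) (h2 σ)
    -- Conjugation by `ρ` fixes the central element; comparing the components at `ρ` of `ρ z = z ρ`
    -- shows that `g 1` is invariant.
    have h2 : ∀ ρ, diagPerm ρ (g 1) = g 1 := by
      intro ρ
      have h3 := hz' (permH N ρ)
      rw [permH_mul_pbw, pbw_mul_permH] at h3
      have h4 := congrFun (pbw_injective h3) ρ
      rwa [inv_mul_cancel, mul_inv_cancel] at h4
    obtain ⟨-, z', hz1, hz2⟩ := invariant_mem_leadSpace (hg 1) h2
    have h3 : pbw N g - normalOrder N (g 1) ∈ ltFil N n := by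
      have e : pbw N g - normalOrder N (g 1) = pbw N (g - Pi.single 1 (g 1)) := by
        rw [map_sub, pbw_single, map_one, mul_one]
      rw [e]
      refine pbw_mem_ltFil fun σ => ?_
      rw [Pi.sub_apply]
      by_cases hσ : σ = 1
      · rw [hσ, Pi.single_eq_same, sub_self]; exact zero_mem _
      · rw [Pi.single_eq_of_ne hσ, sub_zero]; exact h1 σ hσ
    have h4 : pbw N g - z' ∈ cAlgebra N := by
      refine ih _ (sub_mem hz (cAlgebra_le_center hz1)) ?_
      have := sub_mem h3 hz2
      rwa [sub_sub_sub_cancel_right] at this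
    have := add_mem h4 hz1
    rwa [sub_add_cancel] at this

lemma center_eq_cAlgebra : Subalgebra.center ℂ (Cherednik N) = cAlgebra N :=
  le_antisymm center_le_cAlgebra cAlgebra_le_center

end Center

end BetheCherednik

end

noncomputable section

namespace BetheCherednik

/-! ### Comparison of the two families of operators and the two isomorphisms -/

section Comparison

open Polynomial

variable {N : ℕ}

lemma prod_neg_eq {R ι : Type*} [CommRing R] (s : Finset ι) (f : ι → R) :
    ∏ i ∈ s, -f i = (-1) ^ s.card * ∏ i ∈ s, f i := by
  simp only [← Finset.prod_const, ← Finset.prod_mul_distrib, neg_one_mul]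

lemma prod_pairFactor_eq {P : Type*} [CommRing P] (ξ η : Fin N → P) (σ : Equiv.Perm (Fin N)) :
    ∏ k, pairFactor (σ k = k) (ξ k) (η k) = (-1) ^ N * fixedProdOf ξ η σ := by
  have h : ∀ k, pairFactor (σ k = k) (ξ k) (η k)
      = -(if σ k = k then 1 - (X - C (C (ξ k))) * C (X - C (η k)) else 1) := by
    intro k
    rw [pairFactor]
    split_ifs <;> ring
  refine (Finset.prod_congr rfl fun k _ => h k).trans ((prod_neg_eq _ _).trans ?_)
  rw [Finset.card_univ, Fintype.card_fin, fixedProdOf, fixedPts, Finset.prod_filter]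

/-- The two universal polynomials use the variables in opposite roles: `u` accompanies `z` on the
Bethe side, while `v` accompanies `x` on the Cherednik side. This is why `b̄_{ij}` corresponds to
`c_{ij}` although the monomials in `u` and `v` are exchanged. -/
lemma coeff_prod_pairFactor {P : Type*} [CommRing P] (ξ η : Fin N → P)
    (σ : Equiv.Perm (Fin N)) (a b : ℕ) :
    ((∏ k, pairFactor (σ k = k) (η k) (ξ k)).coeff b).coeff a
      = (-1) ^ N * ((fixedProdOf ξ η σ).coeff a).coeff b := by
  have h : Bivariate.swap (∏ k, pairFactor (σ k = k) (ξ k) (η k))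
      = ∏ k, pairFactor (σ k = k) (η k) (ξ k) := by
    rw [map_prod]
    exact Finset.prod_congr rfl fun k _ => swap_pairFactor _ _ _
  rw [← h, coeff_swap, prod_pairFactor_eq]
  exact (neg_one_pow_mul_map ((lcoeff P b).toAddMonoidHom.comp
      (lcoeff P[X] a).toAddMonoidHom) N _).symm

/-- `(-1)^N` times the coefficients of `fixedProd`. -/
def signedFixedCoeff (σ : Equiv.Perm (Fin N)) (a b : ℕ) : PolyXY N :=
  (-1) ^ N * ((fixedProdOf xVar yVar σ).coeff a).coeff b

lemma cZ_eq_sum_signedFixedCoeff (i j : Fin (N + 1)) : cZ N i j = ∑ σ : Equiv.Perm (Fin N),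
    ((Equiv.Perm.sign σ : ℤˣ) : ℤ) • (normalOrder N (signedFixedCoeff σ (N - i) (N - j))
      * permH N σ) := by
  rw [cZ, Finset.mul_sum]
  refine Finset.sum_congr rfl fun σ _ => ?_
  rw [← mul_assoc, mul_smul_comm]
  congr 2
  exact neg_one_pow_mul_map (normalOrder N).toAddMonoidHom N _

/-- A fixed point of `ρ⁻¹τ` is a site where `ρ` and `τ` agree. There `y_k`, evaluated as `λ_{ρ(k)}`,
is `λ_{τ(k)}`, so the factors on the two sides match one by one. -/
lemma rename_signedFixedCoeff (τ ρ : Equiv.Perm (Fin N)) (a b : ℕ) :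
    ((Equiv.Perm.sign (ρ⁻¹ * τ) : ℤˣ) : ℤ) •
        MvPolynomial.rename (Sum.map id ρ) (signedFixedCoeff (ρ⁻¹ * τ) a b)
      = betheCoeff τ ρ b a := by
  have hs : Equiv.Perm.sign (ρ⁻¹ * τ) = Equiv.Perm.sign (ρ * τ⁻¹) := by
    rw [Equiv.Perm.sign_mul, Equiv.Perm.sign_mul, Equiv.Perm.sign_inv, Equiv.Perm.sign_inv]
  rw [betheCoeff, hs]
  congr 1
  have h1 := map_fixedProdOf (MvPolynomial.rename (Sum.map id ρ) : PolyXY N →ₐ[ℂ] PolyZL N).toRingHom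
    (xVar : Fin N → PolyXY N) yVar (ρ⁻¹ * τ)
  have h2 := coeff_coeff_map (MvPolynomial.rename (Sum.map id ρ) : PolyXY N →ₐ[ℂ] PolyZL N).toRingHom
    (fixedProdOf (xVar : Fin N → PolyXY N) yVar (ρ⁻¹ * τ)) a b
  have hiff : ∀ k, (ρ⁻¹ * τ) k = k ↔ ρ k = τ k := fun k => by
    rw [Equiv.Perm.mul_apply, Equiv.Perm.inv_eq_iff_eq, eq_comm]
  have h3 : ∏ k, pairFactor (ρ k = τ k) (MvPolynomial.X (Sum.inr (τ k)) : PolyZL N)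
        (MvPolynomial.X (Sum.inl k))
      = ∏ k, pairFactor ((ρ⁻¹ * τ) k = k)
        ((MvPolynomial.rename (Sum.map id ρ) : PolyXY N →ₐ[ℂ] PolyZL N).toRingHom (yVar k))
        ((MvPolynomial.rename (Sum.map id ρ) : PolyXY N →ₐ[ℂ] PolyZL N).toRingHom (xVar k)) := by
    refine Finset.prod_congr rfl fun k _ => ?_
    have hx : (MvPolynomial.rename (Sum.map id ρ) : PolyXY N →ₐ[ℂ] PolyZL N).toRingHom (xVar k)
        = MvPolynomial.X (Sum.inl k) := MvPolynomial.rename_X _ _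
    have hy : (MvPolynomial.rename (Sum.map id ρ) : PolyXY N →ₐ[ℂ] PolyZL N).toRingHom (yVar k)
        = MvPolynomial.X (Sum.inr (ρ k)) := MvPolynomial.rename_X _ _
    rw [hx, hy]
    by_cases h : ρ k = τ k
    · rw [pairFactor, pairFactor, if_pos h, if_pos ((hiff k).mpr h), h]
    · simp only [pairFactor, if_neg h, if_neg fun h' => h ((hiff k).mp h')]
  rw [h3, coeff_prod_pairFactor, ← h1, h2, signedFixedCoeff, map_mul, map_pow, map_neg, map_one]
  rfl

/-- The term of `σ` sends the basis vector of `τ` to a multiple of that of `τ σ⁻¹`; hence only `σ =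
ρ⁻¹τ` contributes to the entry at `ρ`. -/
lemma dunklRep_cZ_single (i j : Fin (N + 1)) (τ : Equiv.Perm (Fin N)) :
    dunklRep N (cZ N i j) (Pi.single τ 1) = fun ρ => betheCoeff τ ρ (N - j) (N - i) := by
  funext ρ
  rw [cZ_eq_sum_signedFixedCoeff, map_sum, LinearMap.sum_apply, Finset.sum_apply,
    Finset.sum_eq_single (ρ⁻¹ * τ)]
  · have e : τ * (ρ⁻¹ * τ)⁻¹ = ρ := by group
    rw [map_zsmul, LinearMap.smul_apply, Pi.smul_apply, dunklRep_single, e, Pi.single_eq_same,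
      rename_signedFixedCoeff]
  · intro σ _ hσ
    rw [map_zsmul, LinearMap.smul_apply, Pi.smul_apply, dunklRep_single, Pi.single_eq_of_ne,
      smul_zero]
    rintro rfl
    exact hσ (by group)
  · simp

variable (N) in
/-- The action of the center of `H_N` on `𝒱₁`. -/
def centerRep : Subalgebra.center ℂ (Cherednik N) →ₐ[ℂ] Module.End ℂ (VOne N) where
  toFun c := (permEquiv N).toLinearMap ∘ₗ dunklRep N c ∘ₗ (permEquiv N).symm.toLinearMap
  map_one' := by ext v; simp
  map_mul' c d := by ext v; simp
  map_zero' := by ext v; simp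
  map_add' c d := by ext v; simp
  commutes' r := by ext v; simp

lemma centerRep_permEquiv (c : Subalgebra.center ℂ (Cherednik N)) (m : PermMod N) :
    centerRep N c (permEquiv N m) = permEquiv N (dunklRep N c m) := by
  change permEquiv N (dunklRep N c ((permEquiv N).symm (permEquiv N m))) = _
  rw [LinearEquiv.symm_apply_apply]

lemma centerRep_injective : Function.Injective (centerRep N) := by
  intro c d h
  refine Subtype.ext (dunklRep_injective (LinearMap.ext fun m => ?_))
  refine (permEquiv N).injective ?_
  rw [← centerRep_permEquiv, ← centerRep_permEquiv, h]

/-- Both operators are linear over `ℂ[z, λ]`, the left one because `c_{ij}` commutes with the `x_k`.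
So it is enough that their matrices agree on the basis of permutations. -/
lemma centerRep_cZ (i j : Fin (N + 1)) :
    centerRep N ⟨cZ N i j, cZ_mem_center i j⟩ = bBar N i j := by
  refine end_VOne_ext (fun p => ?_) (fun p => commute_bBar i j p) fun τ => ?_
  · refine LinearMap.ext fun v => ?_
    obtain ⟨m, rfl⟩ := (permEquiv N).surjective v
    rw [Module.End.mul_apply, Module.End.mul_apply, polyMulOne_permEquiv, centerRep_permEquiv,
      centerRep_permEquiv, polyMulOne_permEquiv, dunklRep_smul_of_commute (cZ_mul_xH i j)]
  · rw [centerRep_permEquiv, dunklRep_cZ_single, bBar_permEquiv]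

/-- Matching generators: the `c_{ij}` generate the center and the `b̄_{ij}` generate the image of
the Bethe algebra. -/
lemma range_centerRep : (centerRep N).range = betheImage N := by
  have h : (⊤ : Subalgebra ℂ (Subalgebra.center ℂ (Cherednik N)))
      = Algebra.adjoin ℂ (Set.range fun p : Fin (N + 1) × Fin (N + 1) =>
        (⟨cZ N p.1 p.2, cZ_mem_center p.1 p.2⟩ : Subalgebra.center ℂ (Cherednik N))) := by
    refine (Subalgebra.map_injective (f := (Subalgebra.center ℂ (Cherednik N)).val)
      Subtype.val_injective ?_)
    rw [AlgHom.map_adjoin, Algebra.map_top, Subalgebra.range_val]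
    refine center_eq_cAlgebra.trans ?_
    rw [cAlgebra, ← Set.range_comp]
    rfl
  rw [← Algebra.map_top, h, AlgHom.map_adjoin, betheImage_eq_adjoin_bBar, ← Set.range_comp]
  congr 2
  funext p
  exact centerRep_cZ p.1 p.2

variable (N) in
/-- The isomorphism between the center of `H_N` and the image of the Bethe algebra. -/
def centerEquiv : Subalgebra.center ℂ (Cherednik N) ≃ₐ[ℂ] betheImage N :=
  (AlgEquiv.ofInjective (centerRep N) centerRep_injective).trans
    (Subalgebra.equivOfEq _ _ range_centerRep)

lemma centerEquiv_cZ (i j : Fin (N + 1)) (h : bBar N i j ∈ betheImage N) :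
    centerEquiv N ⟨cZ N i j, cZ_mem_center i j⟩ = ⟨bBar N i j, h⟩ :=
  Subtype.ext (centerRep_cZ i j)

lemma antiFlip_antiFlip (h : Cherednik N) :
    (antiFlip N (antiFlip N h).unop).unop = h := by
  induction h using cherednik_induction with
  | hx i => rw [antiFlip_xH, MulOpposite.unop_op, antiFlip_yH, MulOpposite.unop_op]
  | hy i => rw [antiFlip_yH, MulOpposite.unop_op, antiFlip_xH, MulOpposite.unop_op]
  | hs i j => rw [antiFlip_sH, MulOpposite.unop_op, antiFlip_sH, MulOpposite.unop_op]
  | hc r =>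
    rw [AlgHom.commutes, MulOpposite.algebraMap_apply, MulOpposite.unop_op, AlgHom.commutes,
      MulOpposite.algebraMap_apply, MulOpposite.unop_op]
  | hadd a b ha hb => rw [map_add, MulOpposite.unop_add, map_add, MulOpposite.unop_add, ha, hb]
  | hmul a b ha hb => rw [map_mul, MulOpposite.unop_mul, map_mul, MulOpposite.unop_mul, ha, hb]

lemma antiFlip_mem_center {c : Cherednik N} (hc : c ∈ Subalgebra.center ℂ (Cherednik N)) :
    (antiFlip N c).unop ∈ Subalgebra.center ℂ (Cherednik N) := by
  rw [Subalgebra.mem_center_iff] at hc ⊢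
  intro h
  rw [← antiFlip_antiFlip h, ← MulOpposite.unop_mul, ← MulOpposite.unop_mul, ← map_mul, ← map_mul,
    hc]

variable (N) in
/-- The automorphism of the center of `H_N` induced by the antiautomorphism `antiFlip`. -/
def centerFlip : Subalgebra.center ℂ (Cherednik N) ≃ₐ[ℂ] Subalgebra.center ℂ (Cherednik N) where
  toFun c := ⟨(antiFlip N c).unop, antiFlip_mem_center c.2⟩
  invFun c := ⟨(antiFlip N c).unop, antiFlip_mem_center c.2⟩
  left_inv c := Subtype.ext (antiFlip_antiFlip (c : Cherednik N))
  right_inv c := Subtype.ext (antiFlip_antiFlip (c : Cherednik N))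
  -- An antiautomorphism is multiplicative on the center, where the order of factors does not
  -- matter.
  map_mul' c d := Subtype.ext (by
    change (antiFlip N ((c : Cherednik N) * d)).unop = (antiFlip N c).unop * (antiFlip N d).unop
    rw [← Subalgebra.mem_center_iff.mp c.2 d, map_mul, MulOpposite.unop_mul])
  map_add' c d := Subtype.ext (by
    change (antiFlip N ((c : Cherednik N) + d)).unop = (antiFlip N c).unop + (antiFlip N d).unop
    rw [map_add, MulOpposite.unop_add])
  commutes' r := Subtype.ext (by
    change (antiFlip N (algebraMap ℂ _ r)).unop = algebraMap ℂ _ r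
    rw [AlgHom.commutes, MulOpposite.algebraMap_apply, MulOpposite.unop_op])

lemma centerFlip_cZ (i j : Fin (N + 1)) :
    centerFlip N ⟨cZ N i j, cZ_mem_center i j⟩ = ⟨cZ N j i, cZ_mem_center j i⟩ :=
  Subtype.ext (congrArg MulOpposite.unop (antiFlip_cZ i j))

/-- Homomorphisms from the image of the Bethe algebra are determined by the values on the `b̄_{ij}`. -/
lemma betheImage_equiv_ext {Z : Type*} [Semiring Z] [Algebra ℂ Z] {f g : betheImage N ≃ₐ[ℂ] Z}
    (h : ∀ i j, f ⟨bBar N i j, bBar_mem i j⟩ = g ⟨bBar N i j, bBar_mem i j⟩) : f = g := by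
  refine AlgEquiv.ext fun b => ?_
  obtain ⟨b, hb⟩ := b
  have hb' := hb
  rw [betheImage_eq_adjoin_bBar] at hb'
  have key : ∀ b ∈ Algebra.adjoin ℂ (Set.range fun p : Fin (N + 1) × Fin (N + 1) =>
      bBar N p.1 p.2), ∃ hb : b ∈ betheImage N, f ⟨b, hb⟩ = g ⟨b, hb⟩ := by
    intro b hb
    induction hb using Algebra.adjoin_induction with
    | mem x hx => obtain ⟨p, rfl⟩ := hx; exact ⟨bBar_mem _ _, h _ _⟩
    | algebraMap r =>
      exact ⟨Subalgebra.algebraMap_mem _ r, (f.commutes r).trans (g.commutes r).symm⟩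
    | add x y _ _ hx hy =>
      obtain ⟨hx, ex⟩ := hx
      obtain ⟨hy, ey⟩ := hy
      refine ⟨add_mem hx hy, ?_⟩
      have ef := map_add f ⟨x, hx⟩ ⟨y, hy⟩
      have eg := map_add g ⟨x, hx⟩ ⟨y, hy⟩
      rw [ex, ey] at ef
      exact ef.trans eg.symm
    | mul x y _ _ hx hy =>
      obtain ⟨hx, ex⟩ := hx
      obtain ⟨hy, ey⟩ := hy
      refine ⟨mul_mem hx hy, ?_⟩
      have ef := map_mul f ⟨x, hx⟩ ⟨y, hy⟩
      have eg := map_mul g ⟨x, hx⟩ ⟨y, hy⟩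
      rw [ex, ey] at ef
      exact ef.trans eg.symm
  exact (key b hb').2

end Comparison

end BetheCherednik

end

theorem corollary2p10 (N : ℕ) :
    ∃ (hb : ∀ i j : Fin (N + 1), BetheCherednik.bBar N i j ∈ BetheCherednik.betheImage N),
      (∃! τ : BetheCherednik.betheImage N ≃ₐ[ℂ]
          Subalgebra.center ℂ (BetheCherednik.Cherednik N),
        ∀ i j : Fin (N + 1),
          (τ ⟨BetheCherednik.bBar N i j, hb i j⟩ : BetheCherednik.Cherednik N)
            = BetheCherednik.cZ N i j) ∧
      (∃! τ : BetheCherednik.betheImage N ≃ₐ[ℂ]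
          Subalgebra.center ℂ (BetheCherednik.Cherednik N),
        ∀ i j : Fin (N + 1),
          (τ ⟨BetheCherednik.bBar N i j, hb i j⟩ : BetheCherednik.Cherednik N)
            = BetheCherednik.cZ N j i) := by
  have h : ∀ i j, (BetheCherednik.centerEquiv N).symm
      ⟨BetheCherednik.bBar N i j, BetheCherednik.bBar_mem i j⟩
        = ⟨BetheCherednik.cZ N i j, BetheCherednik.cZ_mem_center i j⟩ := fun i j => by
    rw [AlgEquiv.symm_apply_eq, BetheCherednik.centerEquiv_cZ]
  refine ⟨BetheCherednik.bBar_mem, ⟨(BetheCherednik.centerEquiv N).symm, fun i j => ?_, ?_⟩,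
    -- Here `b̄_{ij} ↦ c_{ij} ↦ c_{ji}`.
    ⟨(BetheCherednik.centerEquiv N).symm.trans (BetheCherednik.centerFlip N), fun i j => ?_, ?_⟩⟩
  · rw [h]
  · intro τ hτ
    refine BetheCherednik.betheImage_equiv_ext fun i j => Subtype.ext ?_
    rw [hτ, h]
  · rw [AlgEquiv.trans_apply, h, BetheCherednik.centerFlip_cZ]
  · intro τ hτ
    refine BetheCherednik.betheImage_equiv_ext fun i j => Subtype.ext ?_
    rw [hτ, AlgEquiv.trans_apply, h, BetheCherednik.centerFlip_cZ]
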